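/- **Setting.** Use coordinates $(t,\rho,z)$ with $t$ in an open interval $I\subseteq\mathbb R$ and $(\rho,z)$ in the half plane $\mathbb R^2_+=\{\rho\ge 0\}$. A dot is $\partial_t$; capital indices $A,B\in\{\rho,z\}$ are moved with the flat metric $\delta_{AB}$; $\partial$ denotes spatial derivatives; $\Delta=\partial_\rho^2+\partial_z^2$, ${}^{(3)}\Delta=\Delta+\rho^{-1}\partial_\rho$, $r=\sqrt{\rho^2+z^2}$, and $(\mathcal L\beta)_{AB}=\partial_A\beta_B+\partial_B\beta_A-\delta_{AB}\partial_C\beta^C$. The axially symmetric linear perturbations of Minkowski in the maximal–isothermal gauge consist of functions $\sigma_1,q_1,\omega_1$, a vector $\beta_1^A$ and a symmetric trace-free tensor $\chi_{1AB}$, all smooth up to the axis $\rho=0$. With $u_1=\sigma_1+q_1$ and $p=\dot\sigma_1-2\beta_1^\rho/\rho$ they satisfy, for $\rho>0$, $$-\dot p+{}^{(3)}\Delta\sigma_1=0,\qquad -\ddot\omega_1+{}^{(3)}\Delta\omega_1=\frac{4\,\partial_\rho\omega_1}{\rho},$$ $$2\dot u_1=\partial_A\beta_1^A+\frac{2\beta_1^\rho}{\rho},\qquad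 \dot\chi_{1AB}=2\partial_{(A}q_1\partial_{B)}\rho-\delta_{AB}\partial_\rho q_1,$$ $$\partial^A\chi_{1AB}=-p\,\partial_B\rho,\qquad \Delta q_1+{}^{(3)}\Delta\sigma_1=0,\qquad (\mathcal L\beta_1)_{AB}=\frac2\rho\chi_{1AB}.$$ Write $f=o_1(r^k)$ if, as $r\to\infty$, $f=o(r^k)$ and $\partial f=o(r^{k-1})$, uniformly for $t$ in compact subsets of $I$. Assume: * fall-off: $\sigma_1,\beta_1^A,\chi_{1AB},\dot\sigma_1,\dot\beta_1^A,\dot\chi_{1AB}=o_1(r^{-1/2})$; * axis regularity: $\sigma_1,q_1,\omega_1,\beta_1^z$ extend across the axis as smooth even functions of $\rho$, and $\beta_1^\rho$ as a smooth odd function of $\rho$; * twist: with $\bar\omega_1=\omega_1/\rho^4$, both $\bar\omega_1$ and $\dot{\bar\omega}_1$ are $O_1(1)$ at the axis (that is, they are $O(1)$ and their first spatial derivatives are $O(\rho^{-1})$ as $\rho\to0^+$) and $o_1(r^{-5/2})$ at infinity. Define the energies, with values in $[0,\infty]$, $$m_\sigma[p,\sigma,\chi]=\int_{\mathbb R^2_+}\Big(2p^2+2|\partial\sigma|^2+4\frac{\chi^{AB}\chi_{AB}}{\rho^2}\Big)\rho\,d\rho\,dz,$$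 $$m_\omega[\omega]=\int_{\mathbb R^2_+}\frac{2\dot\omega^2+2|\partial\omega|^2}{\rho^3}\,d\rho\,dz,\qquad m_{\bar\omega}[v]=\int_{\mathbb R^2_+}2\big(\dot v^2+|\partial v|^2\big)\rho^5\,d\rho\,dz .$$ **Theorem.** (i) $m_\sigma[p,\sigma_1,\chi_1]$, $m_\omega[\omega_1]$ and $m_{\bar\omega}[\bar\omega_1]$ do not depend on $t\in I$, and $m_\omega[\omega_1]=m_{\bar\omega}[\bar\omega_1]$. The higher order energies are conserved too: for every $n$, $m_\omega[\partial_t^n\omega_1]$ and $m_{\bar\omega}[\partial_t^n\bar\omega_1]$ do not depend on $t$, and neither does $m_\sigma[\partial_t^np,\partial_t^n\sigma_1,\partial_t^n\chi_1]$, where for $n\ge2$ it is understood that the fall-off $o_1(r^{-1/2})$ also holds for $\partial_t^k\sigma_1,\partial_t^k\beta_1^A,\partial_t^k\chi_{1AB}$ with $2\le k\le n$. (ii) There is a numerical constant $C>0$, independent of the solution and of $I$, such that at all times in $I$ and at all points (with $\rho>0$ in the second bound) $$C\,|\sigma_1|^2\le m_\sigma[p,\sigma_1,\chi_1]+m_\sigma[\dot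 p,\dot\sigma_1,\dot\chi_1],\qquad C\,\Big(\frac{|\omega_1|}{\rho^4}\Big)^2\le m_\omega[\ddot\omega_1]+m_\omega[\dddot\omega_1],$$ where the (time-independent) right-hand sides may be evaluated at any time in $I$. -/

import Mathlib

open Set Filter Topology MeasureTheory
open scoped ENNReal

namespace LinGrav

/-- A function `f t ρ z` of time and of the cylindrical coordinates. Only the values on the
half plane `ρ ≥ 0` are meaningful; the values for `ρ < 0` are those of an extension across the
axis, used to express smoothness up to the axis and parity in `ρ`. -/
abbrev Field := ℝ → ℝ → ℝ → ℝ

noncomputable section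

/-- Partial derivative in `t`. -/
def dt (f : Field) : Field := fun t ρ z => deriv (fun s => f s ρ z) t

/-- Partial derivative in `ρ`. -/
def dρ (f : Field) : Field := fun t ρ z => deriv (fun s => f t s z) ρ

/-- Partial derivative in `z`. -/
def dz (f : Field) : Field := fun t ρ z => deriv (fun s => f t ρ s) z

/-- The flat two-dimensional Laplacian `∂ρ² + ∂z²`. -/
def lap (f : Field) : Field := fun t ρ z => dρ (dρ f) t ρ z + dz (dz f) t ρ z

/-- The three-dimensional flat Laplacian on axially symmetric functions. -/
def lap3 (f : Field) : Field := fun t ρ z => lap f t ρ z + dρ f t ρ z / ρ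

/-- `|∂f|²`, the squared norm of the spatial gradient. -/
def gradSq (f : Field) : Field := fun t ρ z => dρ f t ρ z ^ 2 + dz f t ρ z ^ 2

/-- Smoothness for times in `I`, up to (and across) the axis. -/
def IsSmooth (I : Set ℝ) (f : Field) : Prop :=
  ContDiffOn ℝ ((⊤ : ℕ∞) : WithTop ℕ∞) (fun x : ℝ × ℝ × ℝ => f x.1 x.2.1 x.2.2) (I ×ˢ (univ : Set (ℝ × ℝ)))

def IsEven (I : Set ℝ) (f : Field) : Prop := ∀ t ∈ I, ∀ ρ z, f t (-ρ) z = f t ρ z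

def IsOdd (I : Set ℝ) (f : Field) : Prop := ∀ t ∈ I, ∀ ρ z, f t (-ρ) z = -f t ρ z

/-- `f = o₁(r ^ k)` as `r = √(ρ² + z²) → ∞` in the half plane, uniformly for `t` in compact
subsets of `I`: `f = o(r ^ k)`, and the first spatial derivatives are `o(r ^ (k - 1))`. -/
def LittleO1 (I : Set ℝ) (k : ℝ) (f : Field) : Prop :=
  ∀ K ⊆ I, IsCompact K → ∀ ε > 0, ∃ R : ℝ, ∀ t ∈ K, ∀ ρ > 0, ∀ z,
    R ≤ √(ρ ^ 2 + z ^ 2) →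
      |f t ρ z| ≤ ε * √(ρ ^ 2 + z ^ 2) ^ k ∧
      |dρ f t ρ z| ≤ ε * √(ρ ^ 2 + z ^ 2) ^ (k - 1) ∧
      |dz f t ρ z| ≤ ε * √(ρ ^ 2 + z ^ 2) ^ (k - 1)

/-- `f = O₁(1)` at the axis: `f = O(1)`, and the first spatial derivatives are `O(ρ⁻¹)`,
as `ρ → 0+` at every `t` and `z`. -/
def BigO1Axis (I : Set ℝ) (f : Field) : Prop :=
  ∀ t ∈ I, ∀ z,
    (fun ρ => f t ρ z) =O[𝓝[>] 0] (fun _ => (1 : ℝ)) ∧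
    (fun ρ => dρ f t ρ z) =O[𝓝[>] 0] (fun ρ : ℝ => ρ⁻¹) ∧
    (fun ρ => dz f t ρ z) =O[𝓝[>] 0] (fun ρ : ℝ => ρ⁻¹)

/-- The unknowns of the linear axially symmetric perturbations of Minkowski in the
maximal-isothermal gauge (all first order quantities; the first order lapse is zero). -/
structure Perturbation where
  σ : Field
  q : Field
  ω : Field
  βρ : Field
  βz : Field
  χρρ : Field
  χρz : Field
  χzz : Field

namespace Perturbation

/-- The perturbation of the conformal factor; `u = log ρ + σ + q` linearizes to `σ₁ + q₁`. -/
def u (P : Perturbation) : Field := fun t ρ z => P.σ t ρ z + P.q t ρ z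

/-- `p = ∂ₜσ₁ - 2 β^ρ / ρ`. -/
def p (P : Perturbation) : Field := fun t ρ z => dt P.σ t ρ z - 2 * P.βρ t ρ z / ρ

/-- The rescaled twist `ω₁ / ρ⁴`. -/
def ωbar (P : Perturbation) : Field := fun t ρ z => P.ω t ρ z / ρ ^ 4

/-- Smooth solutions, for times in `I`, of the linearized equations. Two-dimensional indices are
moved with the flat metric, and the tensor equations are written in components. -/
structure IsSolution (P : Perturbation) (I : Set ℝ) : Prop where
  smooth_σ : IsSmooth I P.σ
  smooth_q : IsSmooth I P.q
  smooth_ω : IsSmooth I P.ω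
  smooth_βρ : IsSmooth I P.βρ
  smooth_βz : IsSmooth I P.βz
  smooth_χρρ : IsSmooth I P.χρρ
  smooth_χρz : IsSmooth I P.χρz
  smooth_χzz : IsSmooth I P.χzz
  /-- maximal gauge -/
  trace_free : ∀ t ∈ I, ∀ ρ > 0, ∀ z, P.χρρ t ρ z + P.χzz t ρ z = 0
  evol_σ : ∀ t ∈ I, ∀ ρ > 0, ∀ z, -dt P.p t ρ z + lap3 P.σ t ρ z = 0
  evol_ω : ∀ t ∈ I, ∀ ρ > 0, ∀ z,
    -dt (dt P.ω) t ρ z + lap3 P.ω t ρ z = 4 * dρ P.ω t ρ z / ρ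
  evol_u : ∀ t ∈ I, ∀ ρ > 0, ∀ z,
    2 * dt P.u t ρ z = dρ P.βρ t ρ z + dz P.βz t ρ z + 2 * P.βρ t ρ z / ρ
  evol_χρρ : ∀ t ∈ I, ∀ ρ > 0, ∀ z, dt P.χρρ t ρ z = 2 * dρ P.q t ρ z - dρ P.q t ρ z
  evol_χρz : ∀ t ∈ I, ∀ ρ > 0, ∀ z, dt P.χρz t ρ z = dz P.q t ρ z
  evol_χzz : ∀ t ∈ I, ∀ ρ > 0, ∀ z, dt P.χzz t ρ z = -dρ P.q t ρ z
  momentum_ρ : ∀ t ∈ I, ∀ ρ > 0, ∀ z, dρ P.χρρ t ρ z + dz P.χρz t ρ z = -P.p t ρ z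
  momentum_z : ∀ t ∈ I, ∀ ρ > 0, ∀ z, dρ P.χρz t ρ z + dz P.χzz t ρ z = 0
  hamiltonian : ∀ t ∈ I, ∀ ρ > 0, ∀ z, lap P.q t ρ z + lap3 P.σ t ρ z = 0
  shift_ρρ : ∀ t ∈ I, ∀ ρ > 0, ∀ z,
    2 * dρ P.βρ t ρ z - (dρ P.βρ t ρ z + dz P.βz t ρ z) = 2 / ρ * P.χρρ t ρ z
  shift_ρz : ∀ t ∈ I, ∀ ρ > 0, ∀ z,
    dρ P.βz t ρ z + dz P.βρ t ρ z = 2 / ρ * P.χρz t ρ z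
  shift_zz : ∀ t ∈ I, ∀ ρ > 0, ∀ z,
    2 * dz P.βz t ρ z - (dρ P.βρ t ρ z + dz P.βz t ρ z) = 2 / ρ * P.χzz t ρ z

/-- Regularity at the axis. The shift equation then forces, on the half plane,
`χρρ = ρ * (smooth even)` and `χρz = ρ * (smooth odd)`, so nothing is imposed on `χ`. -/
structure AxisRegular (P : Perturbation) (I : Set ℝ) : Prop where
  even_σ : IsEven I P.σ
  even_q : IsEven I P.q
  even_ω : IsEven I P.ω
  even_βz : IsEven I P.βz
  odd_βρ : IsOdd I P.βρ

/-- The fall off `o₁(r ^ (-1/2))` at infinity of the `k`-th time derivatives of `σ₁`, `β₁`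
and `χ₁`. -/
structure FallsOff (P : Perturbation) (I : Set ℝ) (k : ℕ) : Prop where
  σ : LittleO1 I (-1 / 2) (dt^[k] P.σ)
  βρ : LittleO1 I (-1 / 2) (dt^[k] P.βρ)
  βz : LittleO1 I (-1 / 2) (dt^[k] P.βz)
  χρρ : LittleO1 I (-1 / 2) (dt^[k] P.χρρ)
  χρz : LittleO1 I (-1 / 2) (dt^[k] P.χρz)
  χzz : LittleO1 I (-1 / 2) (dt^[k] P.χzz)

/-- The conditions on the twist, at the axis and at infinity. -/
structure TwistConditions (P : Perturbation) (I : Set ℝ) : Prop where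
  axis : BigO1Axis I P.ωbar
  axis_dt : BigO1Axis I (dt P.ωbar)
  infinity : LittleO1 I (-5 / 2) P.ωbar
  infinity_dt : LittleO1 I (-5 / 2) (dt P.ωbar)

end Perturbation

/-- The integral over the half plane `ρ > 0`, with respect to `dρ dz`, of a nonnegative density
at time `t`, with values in `[0, ∞]`. -/
def halfPlaneIntegral (ε : Field) (t : ℝ) : ℝ≥0∞ :=
  ∫⁻ x in {x : ℝ × ℝ | 0 < x.1}, ENNReal.ofReal (ε t x.1 x.2)

/-- `m_σ[p, σ, χ]` at time `t`; the argument `χ` is given by its components `a = χρρ`,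
`b = χρz = χzρ` and `c = χzz`, and `χ^{AB} χ_{AB} = a² + 2 b² + c²`. -/
def massσ (p σ a b c : Field) (t : ℝ) : ℝ≥0∞ :=
  halfPlaneIntegral (fun t ρ z =>
    (2 * p t ρ z ^ 2 + 2 * gradSq σ t ρ z
      + 4 * (a t ρ z ^ 2 + 2 * b t ρ z ^ 2 + c t ρ z ^ 2) / ρ ^ 2) * ρ) t

/-- `m_ω[ω]` at time `t`. -/
def massω (ω : Field) (t : ℝ) : ℝ≥0∞ :=
  halfPlaneIntegral (fun t ρ z => 2 * dt ω t ρ z ^ 2 / ρ ^ 3 + 2 * gradSq ω t ρ z / ρ ^ 3) t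

/-- `m_ω̄[v]` at time `t`. -/
def massωbar (v : Field) (t : ℝ) : ℝ≥0∞ :=
  halfPlaneIntegral (fun t ρ z => 2 * (dt v t ρ z ^ 2 + gradSq v t ρ z) * ρ ^ 5) t

/-- `m_σ[∂ₜⁿp, ∂ₜⁿσ₁, ∂ₜⁿχ₁]` at time `t`. -/
def Perturbation.massσ (P : Perturbation) (n : ℕ) (t : ℝ) : ℝ≥0∞ :=
  LinGrav.massσ (dt^[n] P.p) (dt^[n] P.σ) (dt^[n] P.χρρ) (dt^[n] P.χρz) (dt^[n] P.χzz) t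

/-- `m_ω[∂ₜⁿω₁]` at time `t`. -/
def Perturbation.massω (P : Perturbation) (n : ℕ) (t : ℝ) : ℝ≥0∞ :=
  LinGrav.massω (dt^[n] P.ω) t

/-- `m_ω̄[∂ₜⁿω̄₁]` at time `t`. -/
def Perturbation.massωbar (P : Perturbation) (n : ℕ) (t : ℝ) : ℝ≥0∞ :=
  LinGrav.massωbar (dt^[n] P.ωbar) t

end

end LinGrav

/-!
**Regularity at the axis.** A smooth field that vanishes on the axis is `ρ` times a smooth field
(`IsSmooth.exists_eq_rho_mul`). Hence `β^ρ = ρ B`, `∂ρσ = ρ g` and, by the twist conditions, `ω =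
ρ⁴ v` with `B`, `g`, `v` smooth across the axis and `v` even (`exists_smooth_twist`). The shift
equation expresses `χ / ρ` through `∂β`. All energy densities become smooth fields, which can be
integrated over the boxes `0 < ρ < L`, `|z| < L`, and `v` solves the axisymmetric wave equation in
seven space dimensions (`twist_wave`).

**Conservation.** The energies are not assumed finite, so one cannot differentiate them. Each
density `e` satisfies `∂ₜe = div F` with no flux through the axis, and `F = F₁ + F₂` with `|F₁| ≤
e`. A cutoff whose level sets move inwards at the speed of light loses energy through `F₁`, while
the contribution of `F₂` tends to zero as the cutoff radius grows; doing this towards the future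
and towards the past gives equality of the energies at any two times
(`halfPlaneIntegral_conserved`). For the twist `F₂ = 0`. For `m_σ`, the part `F₂` is `8 (β^ρ ∂σ +
β^A ∂ₜχ_A)`, which the fall-off makes `o(r⁻¹)` (`flux_negligible`). The equations are invariant
under time translations, so the energy of order `n` is the energy of the `n`-th time derivative of
the solution. Fall-off of `∂ₜⁿ⁺¹χ` is not needed for it: for `n ≥ 1`, `∂ₜⁿ⁺¹χ` is the trace-free
part of a gradient of `∂ₜⁿq`, where `∂ₜⁿq` is determined by time derivatives of `β` and `σ` of
order at most `n`, and the remaining gradient can be moved to the cutoff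
(`gradient_flux_negligible`, `massσ_one_conserved`).

The densities of `m_ω` and `m_ω̄` differ by `∂ρ(8 ρ⁴ v²)` (`boxInt_twistDensity`). The boundary
term at infinity vanishes for `v = o(r^(-5/2))`, and it is nonnegative in any case, so that `m_ω̄
≤ m_ω` for all time derivatives of `ω`.

**Pointwise bounds.** The energies bound `∂σ` and the three-dimensional Laplacian `∂ₜp` of `σ` in
`L²`, respectively the gradient and the Laplacian of `∂ₜ²v`, itself the seven-dimensional
Laplacian of `v`. Localized integrations by parts (`LocalEstimate`) turn this into bounds for all
second derivatives of `σ` (`SqBdd.second_derivatives`) and all third and fourth derivatives of `v`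
(`third_fourth_derivatives`); the cutoff errors vanish in the limit because the fields concerned
grow slowly in `L²` (`SqSub`). In the second case one also uses that `∂ρv / ρ` satisfies an
equation of the same kind in nine dimensions.

The Sobolev inequality is then proved along the scale: the mean of a field over the square `(ρ, z)
+ λ [1, 2] × [0, 1]`, which for every `λ > 0` stays away from the axis, equals the value at `(ρ,
z)` for `λ = 0` and tends to `0` as `λ → ∞`. Its `λ`-derivatives are moments of the derivatives of
the field, and by Cauchy–Schwarz a field with `∫ ρ ^ a f² ≤ N` has moments bounded by a multiple
of `√N λ ^ (-(a + 2) / 2)` (`abs_moment_le`). Integrating these bounds, from `∞` down to `λ = 1`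
and from there to `0`, bounds the value itself (`abs_le_of_first_second`,
`abs_le_of_third_fourth`).
-/

namespace LinGrav

variable {I : Set ℝ} {f g : Field} {t ρ z : ℝ}

/-! ### Smooth fields and their partial derivatives -/

/-- A field as a function of one variable in `ℝ × ℝ × ℝ`. -/
def unc (f : Field) : ℝ × ℝ × ℝ → ℝ := fun x => f x.1 x.2.1 x.2.2

theorem isOpen_dom (hI : IsOpen I) : IsOpen (I ×ˢ (univ : Set (ℝ × ℝ))) := hI.prod isOpen_univ

theorem IsSmooth.contDiffAt (hI : IsOpen I) (hf : IsSmooth I f) (ht : t ∈ I) (ρ z : ℝ) :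
    ContDiffAt ℝ ((⊤ : ℕ∞) : WithTop ℕ∞) (unc f) (t, ρ, z) :=
  ContDiffOn.contDiffAt hf ((isOpen_dom hI).mem_nhds ⟨ht, mem_univ _⟩)

theorem IsSmooth.hasFDerivAt (hI : IsOpen I) (hf : IsSmooth I f) (ht : t ∈ I) (ρ z : ℝ) :
    HasFDerivAt (unc f) (fderiv ℝ (unc f) (t, ρ, z)) (t, ρ, z) :=
  ((hf.contDiffAt hI ht ρ z).differentiableAt (by simp)).hasFDerivAt

theorem IsSmooth.hasDerivAt_dt (hI : IsOpen I) (hf : IsSmooth I f) (ht : t ∈ I) (ρ z : ℝ) :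
    HasDerivAt (fun s => f s ρ z) (dt f t ρ z) t := by
  have h := (hf.hasFDerivAt hI ht ρ z).comp_hasDerivAt t
    ((hasDerivAt_id t).prodMk (hasDerivAt_const t (ρ, z)))
  exact h.differentiableAt.hasDerivAt

theorem IsSmooth.hasDerivAt_dρ (hI : IsOpen I) (hf : IsSmooth I f) (ht : t ∈ I) (ρ z : ℝ) :
    HasDerivAt (fun s => f t s z) (dρ f t ρ z) ρ := by
  have h := (hf.hasFDerivAt hI ht ρ z).comp_hasDerivAt ρ
    ((hasDerivAt_const ρ t).prodMk ((hasDerivAt_id ρ).prodMk (hasDerivAt_const ρ z)))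
  exact h.differentiableAt.hasDerivAt

theorem IsSmooth.hasDerivAt_dz (hI : IsOpen I) (hf : IsSmooth I f) (ht : t ∈ I) (ρ z : ℝ) :
    HasDerivAt (fun s => f t ρ s) (dz f t ρ z) z := by
  have h := (hf.hasFDerivAt hI ht ρ z).comp_hasDerivAt z
    ((hasDerivAt_const z t).prodMk ((hasDerivAt_const z ρ).prodMk (hasDerivAt_id z)))
  exact h.differentiableAt.hasDerivAt

theorem IsSmooth.dt_eq (hI : IsOpen I) (hf : IsSmooth I f) (ht : t ∈ I) (ρ z : ℝ) :
    dt f t ρ z = fderiv ℝ (unc f) (t, ρ, z) (1, 0, 0) := by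
  have h := (hf.hasFDerivAt hI ht ρ z).comp_hasDerivAt t
    ((hasDerivAt_id t).prodMk (hasDerivAt_const t (ρ, z)))
  exact h.deriv

theorem IsSmooth.dρ_eq (hI : IsOpen I) (hf : IsSmooth I f) (ht : t ∈ I) (ρ z : ℝ) :
    dρ f t ρ z = fderiv ℝ (unc f) (t, ρ, z) (0, 1, 0) := by
  have h := (hf.hasFDerivAt hI ht ρ z).comp_hasDerivAt ρ
    ((hasDerivAt_const ρ t).prodMk ((hasDerivAt_id ρ).prodMk (hasDerivAt_const ρ z)))
  exact h.deriv

theorem IsSmooth.dz_eq (hI : IsOpen I) (hf : IsSmooth I f) (ht : t ∈ I) (ρ z : ℝ) :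
    dz f t ρ z = fderiv ℝ (unc f) (t, ρ, z) (0, 0, 1) := by
  have h := (hf.hasFDerivAt hI ht ρ z).comp_hasDerivAt z
    ((hasDerivAt_const z t).prodMk ((hasDerivAt_const z ρ).prodMk (hasDerivAt_id z)))
  exact h.deriv

theorem IsSmooth.congr (hf : IsSmooth I f) (h : ∀ t ∈ I, ∀ ρ z, g t ρ z = f t ρ z) :
    IsSmooth I g :=
  ContDiffOn.congr hf fun x hx => h x.1 hx.1 x.2.1 x.2.2

theorem IsSmooth.fderiv_apply (hI : IsOpen I) (hf : IsSmooth I f) (v : ℝ × ℝ × ℝ) :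
    IsSmooth I (fun t ρ z => fderiv ℝ (unc f) (t, ρ, z) v) := by
  have h : ContDiffOn ℝ ((⊤ : ℕ∞) : WithTop ℕ∞) (fderiv ℝ (unc f)) (I ×ˢ (univ : Set (ℝ × ℝ))) :=
    ContDiffOn.fderiv_of_isOpen hf (isOpen_dom hI) (by simp)
  exact h.clm_apply contDiffOn_const

theorem IsSmooth.dt (hI : IsOpen I) (hf : IsSmooth I f) : IsSmooth I (dt f) :=
  (hf.fderiv_apply hI (1, 0, 0)).congr fun _ ht ρ z => hf.dt_eq hI ht ρ z

theorem IsSmooth.dρ (hI : IsOpen I) (hf : IsSmooth I f) : IsSmooth I (dρ f) :=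
  (hf.fderiv_apply hI (0, 1, 0)).congr fun _ ht ρ z => hf.dρ_eq hI ht ρ z

theorem IsSmooth.dz (hI : IsOpen I) (hf : IsSmooth I f) : IsSmooth I (dz f) :=
  (hf.fderiv_apply hI (0, 0, 1)).congr fun _ ht ρ z => hf.dz_eq hI ht ρ z

theorem IsSmooth.iterate_dt (hI : IsOpen I) (hf : IsSmooth I f) (n : ℕ) :
    IsSmooth I (LinGrav.dt^[n] f) := by
  induction n with
  | zero => exact hf
  | succ n ih => rw [Function.iterate_succ_apply']; exact ih.dt hI

theorem IsSmooth.add (hf : IsSmooth I f) (hg : IsSmooth I g) :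
    IsSmooth I (fun t ρ z => f t ρ z + g t ρ z) := ContDiffOn.add hf hg

theorem IsSmooth.sub (hf : IsSmooth I f) (hg : IsSmooth I g) :
    IsSmooth I (fun t ρ z => f t ρ z - g t ρ z) := ContDiffOn.sub hf hg

theorem IsSmooth.mul (hf : IsSmooth I f) (hg : IsSmooth I g) :
    IsSmooth I (fun t ρ z => f t ρ z * g t ρ z) := ContDiffOn.mul hf hg

theorem IsSmooth.pow (hf : IsSmooth I f) (n : ℕ) :
    IsSmooth I (fun t ρ z => f t ρ z ^ n) := ContDiffOn.pow hf n

theorem IsSmooth.div_const (hf : IsSmooth I f) (c : ℝ) :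
    IsSmooth I (fun t ρ z => f t ρ z / c) := ContDiffOn.div_const hf c

theorem isSmooth_const (c : ℝ) : IsSmooth I (fun _ _ _ => c) := contDiffOn_const

theorem isSmooth_rho : IsSmooth I (fun _ ρ _ => ρ) :=
  ContDiff.contDiffOn (by fun_prop)

theorem isSmooth_z : IsSmooth I (fun _ _ z => z) :=
  ContDiff.contDiffOn (by fun_prop)

theorem IsSmooth.continuousAt (hI : IsOpen I) (hf : IsSmooth I f) (ht : t ∈ I) (ρ z : ℝ) :
    ContinuousAt (unc f) (t, ρ, z) := (hf.contDiffAt hI ht ρ z).continuousAt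

theorem IsSmooth.continuous_space (hI : IsOpen I) (hf : IsSmooth I f) (ht : t ∈ I) :
    Continuous (fun x : ℝ × ℝ => f t x.1 x.2) := by
  refine continuous_iff_continuousAt.2 fun x => ?_
  exact (hf.continuousAt hI ht x.1 x.2).comp (f := fun x : ℝ × ℝ => (t, x))
    (by fun_prop)

theorem IsSmooth.fderiv_comm (hI : IsOpen I) (hf : IsSmooth I f) (ht : t ∈ I) (ρ z : ℝ)
    (v w : ℝ × ℝ × ℝ) :
    fderiv ℝ (unc fun t ρ z => fderiv ℝ (unc f) (t, ρ, z) v) (t, ρ, z) w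
      = fderiv ℝ (unc fun t ρ z => fderiv ℝ (unc f) (t, ρ, z) w) (t, ρ, z) v := by
  have hd : DifferentiableAt ℝ (fderiv ℝ (unc f)) (t, ρ, z) :=
    ((hf.contDiffAt hI ht ρ z).fderiv_right (m := 1) (by norm_cast)).differentiableAt (by simp)
  have key : ∀ a b : ℝ × ℝ × ℝ,
      fderiv ℝ (unc fun t ρ z => fderiv ℝ (unc f) (t, ρ, z) a) (t, ρ, z) b
        = fderiv ℝ (fderiv ℝ (unc f)) (t, ρ, z) b a := by
    intro a b
    have h1 : (unc fun t ρ z => fderiv ℝ (unc f) (t, ρ, z) a) = fun x => fderiv ℝ (unc f) x a := rfl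
    have h2 := hd.hasFDerivAt.clm_apply (hasFDerivAt_const a (t, ρ, z))
    rw [h1, h2.fderiv]
    simp
  rw [key, key]
  have hs : IsSymmSndFDerivAt ℝ (unc f) (t, ρ, z) :=
    (hf.contDiffAt hI ht ρ z).isSymmSndFDerivAt (by
      simp only [minSmoothness_of_isRCLikeNormedField]
      exact WithTop.coe_le_coe.2 (le_top : (2 : ℕ∞) ≤ ⊤))
  exact hs w v

theorem dt_congr (hI : IsOpen I) (h : ∀ t ∈ I, f t ρ z = g t ρ z) (ht : t ∈ I) :
    dt f t ρ z = dt g t ρ z :=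
  Filter.EventuallyEq.deriv_eq (Filter.eventually_of_mem (hI.mem_nhds ht) h)

theorem dρ_congr_pos (h : ∀ ρ > 0, f t ρ z = g t ρ z) (hρ : 0 < ρ) :
    dρ f t ρ z = dρ g t ρ z :=
  Filter.EventuallyEq.deriv_eq (Filter.eventually_of_mem (Ioi_mem_nhds hρ) h)

theorem dρ_congr (h : ∀ ρ, f t ρ z = g t ρ z) : dρ f t ρ z = dρ g t ρ z := by
  unfold dρ; simp only [h]

theorem dz_congr (h : ∀ z, f t ρ z = g t ρ z) : dz f t ρ z = dz g t ρ z := by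
  unfold dz; simp only [h]

theorem iterate_dt_congr (hI : IsOpen I) (h : ∀ t ∈ I, f t ρ z = g t ρ z) (n : ℕ) (ht : t ∈ I) :
    dt^[n] f t ρ z = dt^[n] g t ρ z := by
  induction n generalizing t with
  | zero => exact h t ht
  | succ n ih =>
    rw [Function.iterate_succ_apply', Function.iterate_succ_apply']
    exact dt_congr hI (fun t ht => ih ht) ht

theorem IsSmooth.dρ_dt (hI : IsOpen I) (hf : IsSmooth I f) (ht : t ∈ I) (ρ z : ℝ) :
    LinGrav.dρ (LinGrav.dt f) t ρ z = LinGrav.dt (LinGrav.dρ f) t ρ z := by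
  rw [dρ_congr (g := fun t ρ z => fderiv ℝ (unc f) (t, ρ, z) (1, 0, 0))
      (fun ρ => hf.dt_eq hI ht ρ z),
    dt_congr (g := fun t ρ z => fderiv ℝ (unc f) (t, ρ, z) (0, 1, 0)) hI
      (fun t ht => hf.dρ_eq hI ht ρ z) ht,
    (hf.fderiv_apply hI _).dρ_eq hI ht,
    (hf.fderiv_apply hI _).dt_eq hI ht, hf.fderiv_comm hI ht]

theorem IsSmooth.dz_dt (hI : IsOpen I) (hf : IsSmooth I f) (ht : t ∈ I) (ρ z : ℝ) :
    LinGrav.dz (LinGrav.dt f) t ρ z = LinGrav.dt (LinGrav.dz f) t ρ z := by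
  rw [dz_congr (g := fun t ρ z => fderiv ℝ (unc f) (t, ρ, z) (1, 0, 0))
      (fun z => hf.dt_eq hI ht ρ z),
    dt_congr (g := fun t ρ z => fderiv ℝ (unc f) (t, ρ, z) (0, 0, 1)) hI
      (fun t ht => hf.dz_eq hI ht ρ z) ht,
    (hf.fderiv_apply hI _).dz_eq hI ht, (hf.fderiv_apply hI _).dt_eq hI ht, hf.fderiv_comm hI ht]

theorem IsSmooth.dρ_dz (hI : IsOpen I) (hf : IsSmooth I f) (ht : t ∈ I) (ρ z : ℝ) :
    LinGrav.dρ (LinGrav.dz f) t ρ z = LinGrav.dz (LinGrav.dρ f) t ρ z := by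
  rw [dρ_congr (g := fun t ρ z => fderiv ℝ (unc f) (t, ρ, z) (0, 0, 1))
      (fun ρ => hf.dz_eq hI ht ρ z),
    dz_congr (g := fun t ρ z => fderiv ℝ (unc f) (t, ρ, z) (0, 1, 0))
      (fun z => hf.dρ_eq hI ht ρ z),
    (hf.fderiv_apply hI _).dρ_eq hI ht, (hf.fderiv_apply hI _).dz_eq hI ht, hf.fderiv_comm hI ht]

/-- A continuous identity on `ρ > 0` persists on the axis. -/
theorem IsSmooth.eq_on_axis (hI : IsOpen I) (hf : IsSmooth I f) (hg : IsSmooth I g) (ht : t ∈ I)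
    (h : ∀ ρ > 0, f t ρ z = g t ρ z) : f t 0 z = g t 0 z := by
  have hc : ∀ {f : Field}, IsSmooth I f → Tendsto (fun ρ => f t ρ z) (𝓝[>] 0) (𝓝 (f t 0 z)) :=
    fun hf => ((hf.hasDerivAt_dρ hI ht 0 z).continuousAt.tendsto).mono_left nhdsWithin_le_nhds
  refine tendsto_nhds_unique (hc hf) ((hc hg).congr' ?_)
  filter_upwards [self_mem_nhdsWithin] with ρ hρ using (h ρ hρ).symm

/-! ### Smooth division by `ρ` -/

theorem hasFDerivAt_integral_unit {E H : Type} [NormedAddCommGroup E] [NormedSpace ℝ E]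
    [ProperSpace E] [NormedAddCommGroup H] [NormedSpace ℝ H] {U : Set E} (hU : IsOpen U)
    {F : E × ℝ → H} (hF : ContDiffOn ℝ 1 F (U ×ˢ univ)) {x : E} (hx : x ∈ U) :
    HasFDerivAt (fun x => ∫ θ in Icc (0 : ℝ) 1, F (x, θ))
      (∫ θ in Icc (0 : ℝ) 1, (fderiv ℝ F (x, θ)).comp (ContinuousLinearMap.inl ℝ E ℝ)) x := by
  have hUo : IsOpen (U ×ˢ (univ : Set ℝ)) := hU.prod isOpen_univ
  obtain ⟨r, hr, hrU⟩ := Metric.nhds_basis_closedBall.mem_iff.1 (hU.mem_nhds hx)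
  have hcF' : ContinuousOn (fun y : E × ℝ => (fderiv ℝ F y).comp (ContinuousLinearMap.inl ℝ E ℝ))
      (U ×ˢ univ) :=
    (hF.continuousOn_fderiv_of_isOpen hUo (by simp)).clm_comp continuousOn_const
  have hK : IsCompact (Metric.closedBall x r ×ˢ Icc (0 : ℝ) 1) :=
    (isCompact_closedBall x r).prod isCompact_Icc
  obtain ⟨C, hC⟩ := hK.exists_bound_of_continuousOn
    (hcF'.mono (prod_mono hrU (subset_univ _)))
  have hslice : ∀ y ∈ U, ContinuousOn (fun θ : ℝ => F (y, θ)) (Icc 0 1) := fun y hy =>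
    hF.continuousOn.comp (by fun_prop) (fun θ _ => ⟨hy, mem_univ _⟩)
  have hslice' : ContinuousOn
      (fun θ : ℝ => (fderiv ℝ F (x, θ)).comp (ContinuousLinearMap.inl ℝ E ℝ)) (Icc 0 1) :=
    hcF'.comp (f := fun θ : ℝ => (x, θ)) (by fun_prop) (fun θ _ => ⟨hx, mem_univ _⟩)
  refine hasFDerivAt_integral_of_dominated_of_fderiv_le (𝕜 := ℝ) (bound := fun _ => C)
    (F := fun x θ => F (x, θ))
    (F' := fun x θ => (fderiv ℝ F (x, θ)).comp (ContinuousLinearMap.inl ℝ E ℝ))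
    (Metric.ball_mem_nhds x hr) ?_ ?_ ?_ ?_ ?_ ?_
  · filter_upwards [hU.mem_nhds hx] with y hy
    exact (hslice y hy).aestronglyMeasurable measurableSet_Icc
  · exact (hslice x hx).integrableOn_compact isCompact_Icc
  · exact hslice'.aestronglyMeasurable measurableSet_Icc
  · refine (ae_restrict_iff' measurableSet_Icc).2 (ae_of_all _ fun θ hθ y hy => ?_)
    exact hC (y, θ) ⟨Metric.ball_subset_closedBall hy, hθ⟩
  · exact (continuousOn_const (c := C)).integrableOn_compact isCompact_Icc
  · refine ae_of_all _ fun θ y hy => ?_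
    have hd : HasFDerivAt F (fderiv ℝ F (y, θ)) (y, θ) :=
      ((hF.contDiffAt (hUo.mem_nhds ⟨hrU (Metric.ball_subset_closedBall hy),
        mem_univ _⟩)).differentiableAt (by simp)).hasFDerivAt
    exact hd.comp y (hasFDerivAt_prodMk_left (𝕜 := ℝ) y θ)

theorem contDiffOn_integral_unit {E : Type} [NormedAddCommGroup E] [NormedSpace ℝ E]
    [ProperSpace E] {U : Set E} (hU : IsOpen U) (n : ℕ) :
    ∀ {H : Type} [NormedAddCommGroup H] [NormedSpace ℝ H] {F : E × ℝ → H},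
      ContDiffOn ℝ (n + 1) F (U ×ˢ univ) →
      ContDiffOn ℝ n (fun x => ∫ θ in Icc (0 : ℝ) 1, F (x, θ)) U := by
  have hUo : IsOpen (U ×ˢ (univ : Set ℝ)) := hU.prod isOpen_univ
  induction n with
  | zero =>
    intro H _ _ F hF
    refine contDiffOn_zero.2 fun x hx => ?_
    exact (hasFDerivAt_integral_unit hU (by simpa using hF) hx).continuousAt.continuousWithinAt
  | succ n ih =>
    intro H _ _ F hF
    have h1 : ContDiffOn ℝ 1 F (U ×ˢ univ) := hF.of_le (by
      norm_cast; omega)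
    push_cast
    rw [contDiffOn_succ_iff_fderiv_of_isOpen hU]
    refine ⟨fun x hx => (hasFDerivAt_integral_unit hU h1 hx).differentiableAt.differentiableWithinAt,
      by simp, ?_⟩
    have h2 : ContDiffOn ℝ (n + 1)
        (fun y : E × ℝ => (fderiv ℝ F y).comp (ContinuousLinearMap.inl ℝ E ℝ)) (U ×ˢ univ) :=
      (hF.fderiv_of_isOpen hUo (by push_cast; rfl)).clm_comp contDiffOn_const
    exact (ih h2).congr fun x hx => (hasFDerivAt_integral_unit hU h1 hx).fderiv

/-- A smooth field vanishing on the axis is `ρ` times a smooth field, namely `∫₀¹ ∂ρ f (θ ρ) dθ`. -/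
theorem IsSmooth.exists_eq_rho_mul (hI : IsOpen I) (hf : IsSmooth I f)
    (h0 : ∀ t ∈ I, ∀ z, f t 0 z = 0) :
    ∃ g : Field, IsSmooth I g ∧ ∀ t ∈ I, ∀ ρ z, f t ρ z = ρ * g t ρ z := by
  refine ⟨fun t ρ z => ∫ θ in Icc (0 : ℝ) 1, LinGrav.dρ f t (θ * ρ) z, ?_, ?_⟩
  · have hs : ContDiffOn ℝ ((⊤ : ℕ∞) : WithTop ℕ∞)
        (fun y : (ℝ × ℝ × ℝ) × ℝ => LinGrav.dρ f y.1.1 (y.2 * y.1.2.1) y.1.2.2)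
        ((I ×ˢ (univ : Set (ℝ × ℝ))) ×ˢ univ) :=
      ContDiffOn.comp (g := unc (LinGrav.dρ f))
        (f := fun y : (ℝ × ℝ × ℝ) × ℝ => (y.1.1, y.2 * y.1.2.1, y.1.2.2))
        (hf.dρ hI) (by fun_prop) (fun y hy => ⟨hy.1.1, mem_univ _⟩)
    refine contDiffOn_infty.2 fun n => ?_
    exact contDiffOn_integral_unit (isOpen_dom hI) n (hs.of_le (by
      exact_mod_cast le_top))
  · intro t ht ρ z
    have hd : ∀ θ ∈ uIcc (0 : ℝ) 1,
        HasDerivAt (fun θ => f t (θ * ρ) z) (LinGrav.dρ f t (θ * ρ) z * ρ) θ := by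
      intro θ _
      have h := (hf.hasDerivAt_dρ hI ht (θ * ρ) z).comp θ ((hasDerivAt_id θ).mul_const ρ)
      rw [one_mul] at h
      exact h
    have hc : Continuous fun θ : ℝ => LinGrav.dρ f t (θ * ρ) z * ρ :=
      (((hf.dρ hI).continuous_space hI ht).comp
        (by fun_prop : Continuous fun θ : ℝ => (θ * ρ, z))).mul continuous_const
    have h := intervalIntegral.integral_eq_sub_of_hasDerivAt hd (hc.intervalIntegrable 0 1)
    rw [intervalIntegral.integral_mul_const, one_mul, zero_mul, h0 t ht z, sub_zero,
      intervalIntegral.integral_of_le zero_le_one, ← integral_Icc_eq_integral_Ioc] at h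
    rw [← h, mul_comm]

/-! ### Parity in `ρ` -/

theorem IsEven.dt (hI : IsOpen I) (hf : IsEven I f) : IsEven I (dt f) := fun _ ht ρ z =>
  Filter.EventuallyEq.deriv_eq (Filter.eventually_of_mem (hI.mem_nhds ht) fun t ht => hf t ht ρ z)

theorem IsOdd.dt (hI : IsOpen I) (hf : IsOdd I f) : IsOdd I (dt f) := fun t ht ρ z => by
  have h : (fun s => f s (-ρ) z) =ᶠ[𝓝 t] fun s => -f s ρ z :=
    Filter.eventually_of_mem (hI.mem_nhds ht) fun t ht => hf t ht ρ z
  have h' := h.deriv_eq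
  rw [deriv.fun_neg] at h'
  exact h'

theorem IsEven.dρ (hf : IsEven I f) : IsOdd I (dρ f) := fun t ht ρ z => by
  have h : (fun s => f t s z) = fun s => f t (-s) z := by ext s; rw [hf t ht s z]
  have h2 := deriv_comp_neg (fun s => f t s z) ρ
  unfold LinGrav.dρ
  rw [← h] at h2
  linarith

theorem IsOdd.axis (hf : IsOdd I f) (ht : t ∈ I) (z : ℝ) : f t 0 z = 0 := by
  have := hf t ht 0 z
  rw [neg_zero] at this
  linarith

/-- The `ρ`-derivative of a smooth even field is `ρ` times a smooth field, which is again even. -/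
theorem IsSmooth.exists_dρ_eq (hI : IsOpen I) (hf : IsSmooth I f) (he : IsEven I f) :
    ∃ g : Field, IsSmooth I g ∧ IsEven I g ∧ ∀ t ∈ I, ∀ ρ z, LinGrav.dρ f t ρ z = ρ * g t ρ z := by
  obtain ⟨g, hg, h⟩ := (hf.dρ hI).exists_eq_rho_mul hI (fun t ht z => he.dρ.axis ht z)
  refine ⟨g, hg, fun t ht ρ z => ?_, h⟩
  rcases eq_or_ne ρ 0 with rfl | hρ
  · rw [neg_zero]
  · have h1 := he.dρ t ht ρ z
    rw [h t ht, h t ht] at h1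
    exact mul_left_cancel₀ hρ (by linarith)

end LinGrav

namespace LinGrav

variable {I : Set ℝ} {f g : Field} {t ρ z L : ℝ}

/-! ### Integrals over boxes exhausting the half plane -/

/-- The open box `0 < ρ < L`, `-L < z < L`. -/
def box (L : ℝ) : Set (ℝ × ℝ) := Ioo 0 L ×ˢ Ioo (-L) L

/-- The integral of a field over a box at time `t`. -/
noncomputable def boxInt (L : ℝ) (f : Field) (t : ℝ) : ℝ := ∫ x in box L, f t x.1 x.2

theorem measurableSet_box : MeasurableSet (box L) := measurableSet_Ioo.prod measurableSet_Ioo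

theorem box_subset_Icc : box L ⊆ Icc ((0 : ℝ), -L) (L, L) := by
  rw [← Icc_prod_Icc]; exact prod_mono Ioo_subset_Icc_self Ioo_subset_Icc_self

theorem box_ae_eq_Icc : (box L : Set (ℝ × ℝ)) =ᵐ[volume] Icc ((0 : ℝ), -L) (L, L) := by
  rw [← Icc_prod_Icc]
  exact Measure.set_prod_ae_eq Ioo_ae_eq_Icc Ioo_ae_eq_Icc

theorem box_mono {L L' : ℝ} (h : L ≤ L') : box L ⊆ box L' := by
  refine prod_mono (Ioo_subset_Ioo_right h) (Ioo_subset_Ioo (by linarith) h)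

theorem integrableOn_box {h : ℝ × ℝ → ℝ} (hc : Continuous h) : IntegrableOn h (box L) :=
  (hc.continuousOn.integrableOn_compact isCompact_Icc).mono_set box_subset_Icc

theorem IsSmooth.integrableOn_box (hI : IsOpen I) (hf : IsSmooth I f) (ht : t ∈ I) :
    IntegrableOn (fun x : ℝ × ℝ => f t x.1 x.2) (box L) :=
  LinGrav.integrableOn_box (hf.continuous_space hI ht)

theorem boxInt_congr (h : ∀ x ∈ box L, f t x.1 x.2 = g t x.1 x.2) :
    boxInt L f t = boxInt L g t :=
  setIntegral_congr_fun measurableSet_box h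

theorem boxInt_mono (hI : IsOpen I) (hf : IsSmooth I f) (hg : IsSmooth I g) (ht : t ∈ I)
    (h : ∀ x ∈ box L, f t x.1 x.2 ≤ g t x.1 x.2) : boxInt L f t ≤ boxInt L g t :=
  setIntegral_mono_on (hf.integrableOn_box hI ht) (hg.integrableOn_box hI ht) measurableSet_box h

theorem boxInt_nonneg (h : ∀ x ∈ box L, 0 ≤ f t x.1 x.2) : 0 ≤ boxInt L f t :=
  setIntegral_nonneg measurableSet_box h

theorem boxInt_mono_set (hI : IsOpen I) (hf : IsSmooth I f) (ht : t ∈ I) {L' : ℝ} (hL : L ≤ L')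
    (h : ∀ x ∈ box L', 0 ≤ f t x.1 x.2) : boxInt L f t ≤ boxInt L' f t :=
  setIntegral_mono_set (hf.integrableOn_box hI ht)
    ((ae_restrict_iff' measurableSet_box).2 (ae_of_all _ h)) (LE.le.eventuallyLE (box_mono hL))

theorem boxInt_add (hI : IsOpen I) (hf : IsSmooth I f) (hg : IsSmooth I g) (ht : t ∈ I) :
    boxInt L (fun t ρ z => f t ρ z + g t ρ z) t = boxInt L f t + boxInt L g t :=
  integral_add (hf.integrableOn_box hI ht) (hg.integrableOn_box hI ht)

theorem boxInt_sub (hI : IsOpen I) (hf : IsSmooth I f) (hg : IsSmooth I g) (ht : t ∈ I) :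
    boxInt L (fun t ρ z => f t ρ z - g t ρ z) t = boxInt L f t - boxInt L g t :=
  integral_sub (hf.integrableOn_box hI ht) (hg.integrableOn_box hI ht)

theorem boxInt_const_mul (c : ℝ) :
    boxInt L (fun t ρ z => c * f t ρ z) t = c * boxInt L f t :=
  integral_const_mul c _

theorem volume_box (hL : 0 ≤ L) : volume.real (box L) = 2 * L ^ 2 := by
  rw [box, Measure.real, Measure.volume_eq_prod, Measure.prod_prod, Real.volume_Ioo, Real.volume_Ioo,
    ENNReal.toReal_mul, ENNReal.toReal_ofReal (by linarith), ENNReal.toReal_ofReal (by linarith)]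
  ring

theorem volume_box_lt_top : volume (box L) < ∞ := by
  rw [box, Measure.volume_eq_prod, Measure.prod_prod, Real.volume_Ioo, Real.volume_Ioo]
  exact ENNReal.mul_lt_top ENNReal.ofReal_lt_top ENNReal.ofReal_lt_top

theorem abs_boxInt_le (hL : 0 ≤ L) {c : ℝ} (h : ∀ x ∈ box L, |f t x.1 x.2| ≤ c) :
    |boxInt L f t| ≤ c * (2 * L ^ 2) := by
  rw [← volume_box hL]
  exact norm_setIntegral_le_of_norm_le_const (f := fun x : ℝ × ℝ => f t x.1 x.2)
    volume_box_lt_top h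

/-- The divergence theorem on a box. -/
theorem boxInt_div_eq (hI : IsOpen I) {X Y : Field} (hX : IsSmooth I X) (hY : IsSmooth I Y)
    (ht : t ∈ I) (hL : 0 ≤ L) :
    boxInt L (fun t ρ z => dρ X t ρ z + dz Y t ρ z) t =
      (((∫ ρ in (0 : ℝ)..L, Y t ρ L) - ∫ ρ in (0 : ℝ)..L, Y t ρ (-L)) + ∫ z in (-L)..L, X t L z)
        - ∫ z in (-L)..L, X t 0 z := by
  have hder : ∀ {W : Field}, IsSmooth I W → ∀ x : ℝ × ℝ,
      HasFDerivAt (fun x : ℝ × ℝ => W t x.1 x.2)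
        ((fderiv ℝ (unc W) (t, x)).comp (ContinuousLinearMap.inr ℝ ℝ (ℝ × ℝ))) x :=
    fun hW x => (hW.hasFDerivAt hI ht x.1 x.2).comp x (hasFDerivAt_prodMk_right (𝕜 := ℝ) t x)
  have h := integral_divergence_prod_Icc_of_hasFDerivAt_off_countable_of_le
    (fun x => X t x.1 x.2) (fun x => Y t x.1 x.2)
    (fun x => (fderiv ℝ (unc X) (t, x)).comp (ContinuousLinearMap.inr ℝ ℝ (ℝ × ℝ)))
    (fun x => (fderiv ℝ (unc Y) (t, x)).comp (ContinuousLinearMap.inr ℝ ℝ (ℝ × ℝ)))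
    ((0 : ℝ), -L) (L, L) ⟨hL, by simp only; linarith⟩ ∅ countable_empty
    (hX.continuous_space hI ht).continuousOn (hY.continuous_space hI ht).continuousOn
    (fun x _ => hder hX x) (fun x _ => hder hY x)
  have he : (fun x : ℝ × ℝ =>
      ((fderiv ℝ (unc X) (t, x)).comp (ContinuousLinearMap.inr ℝ ℝ (ℝ × ℝ))) (1, 0) +
      ((fderiv ℝ (unc Y) (t, x)).comp (ContinuousLinearMap.inr ℝ ℝ (ℝ × ℝ))) (0, 1))
      = fun x => dρ X t x.1 x.2 + dz Y t x.1 x.2 := by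
    ext x
    rw [hX.dρ_eq hI ht, hY.dz_eq hI ht]
    rfl
  rw [he] at h
  rw [boxInt, setIntegral_congr_set box_ae_eq_Icc]
  exact h (((((hX.dρ hI).add (hY.dz hI)).continuous_space hI ht).continuousOn).integrableOn_compact
    isCompact_Icc)

theorem boxInt_div_eq_zero (hI : IsOpen I) {X Y : Field} (hX : IsSmooth I X) (hY : IsSmooth I Y)
    (ht : t ∈ I) (hL : 0 ≤ L) (hX0 : ∀ z, X t 0 z = 0) (hXL : ∀ z, X t L z = 0)
    (hYL : ∀ ρ, Y t ρ L = 0) (hYL' : ∀ ρ, Y t ρ (-L) = 0) :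
    boxInt L (fun t ρ z => dρ X t ρ z + dz Y t ρ z) t = 0 := by
  rw [boxInt_div_eq hI hX hY ht hL]
  simp [hX0, hXL, hYL, hYL']

theorem hasDerivAt_setIntegral_of_compact {K : Set (ℝ × ℝ)} {Q : Set (ℝ × ℝ)}
    (hK : IsCompact K) (hQ : Q ⊆ K) (hQm : MeasurableSet Q) (hI : IsOpen I) (hf : IsSmooth I f)
    (ht : t ∈ I) :
    HasDerivAt (fun t => ∫ x in Q, f t x.1 x.2) (∫ x in Q, dt f t x.1 x.2) t := by
  obtain ⟨r, hr, hrI⟩ := Metric.nhds_basis_closedBall.mem_iff.1 (hI.mem_nhds ht)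
  have hint : ∀ {f : Field}, IsSmooth I f → ∀ {t : ℝ}, t ∈ I →
      IntegrableOn (fun x : ℝ × ℝ => f t x.1 x.2) Q := fun hf _ ht =>
    ((hf.continuous_space hI ht).continuousOn.integrableOn_compact hK).mono_set hQ
  have hcomp : IsCompact (Metric.closedBall t r ×ˢ K) := (isCompact_closedBall t r).prod hK
  obtain ⟨C, hC⟩ := hcomp.exists_bound_of_continuousOn (f := unc (dt f))
    (ContinuousOn.mono (hf.dt hI).continuousOn (prod_mono hrI (subset_univ _)))
  refine (hasDerivAt_integral_of_dominated_loc_of_deriv_le (bound := fun _ => C)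
    (F := fun t (x : ℝ × ℝ) => f t x.1 x.2) (F' := fun t (x : ℝ × ℝ) => dt f t x.1 x.2)
    (Metric.ball_mem_nhds t hr) ?_ (hint hf ht) (hint (hf.dt hI) ht).aestronglyMeasurable
    ?_ ?_ ?_).2
  · filter_upwards [hI.mem_nhds ht] with y hy using (hint hf hy).aestronglyMeasurable
  · refine (ae_restrict_iff' hQm).2 (ae_of_all _ fun x hx y hy => ?_)
    exact hC (y, x) ⟨Metric.ball_subset_closedBall hy, hQ hx⟩
  · exact ((continuousOn_const (c := C)).integrableOn_compact hK).mono_set hQ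
  · exact ae_of_all _ fun x y hy =>
      hf.hasDerivAt_dt hI (hrI (Metric.ball_subset_closedBall hy)) x.1 x.2

theorem hasDerivAt_boxInt (hI : IsOpen I) (hf : IsSmooth I f) (ht : t ∈ I) :
    HasDerivAt (boxInt L f) (boxInt L (dt f) t) t :=
  hasDerivAt_setIntegral_of_compact isCompact_Icc box_subset_Icc measurableSet_box hI hf ht

/-! ### Energies and box integrals -/

theorem measurableSet_halfPlane : MeasurableSet {x : ℝ × ℝ | 0 < x.1} :=
  measurableSet_lt measurable_const measurable_fst

theorem halfPlaneIntegral_congr (h : ∀ ρ > 0, ∀ z, f t ρ z = g t ρ z) :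
    halfPlaneIntegral f t = halfPlaneIntegral g t :=
  setLIntegral_congr_fun measurableSet_halfPlane fun x hx => by
    simp only [h x.1 hx x.2]

theorem ofReal_boxInt (hI : IsOpen I) (hf : IsSmooth I f) (ht : t ∈ I)
    (h : ∀ ρ > 0, ∀ z, 0 ≤ f t ρ z) :
    ENNReal.ofReal (boxInt L f t) = ∫⁻ x in box L, ENNReal.ofReal (f t x.1 x.2) :=
  ofReal_integral_eq_lintegral_ofReal (hf.integrableOn_box hI ht)
    ((ae_restrict_iff' measurableSet_box).2 (ae_of_all _ fun x hx => h x.1 hx.1.1 x.2))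

theorem ofReal_boxInt_le (hI : IsOpen I) (hf : IsSmooth I f) (ht : t ∈ I)
    (h : ∀ ρ > 0, ∀ z, 0 ≤ f t ρ z) (L : ℝ) :
    ENNReal.ofReal (boxInt L f t) ≤ halfPlaneIntegral f t := by
  rw [ofReal_boxInt hI hf ht h]
  exact lintegral_mono_set fun x hx => hx.1.1

theorem iUnion_box : ⋃ n : ℕ, box n = {x : ℝ × ℝ | 0 < x.1} := by
  ext x
  simp only [mem_iUnion, mem_ofPred_eq]
  refine ⟨fun ⟨n, hn⟩ => hn.1.1, fun hx => ?_⟩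
  obtain ⟨n, hn⟩ := exists_nat_gt (max x.1 |x.2|)
  have h2 := abs_lt.1 ((le_max_right x.1 |x.2|).trans_lt hn)
  exact ⟨n, ⟨hx, (le_max_left _ _).trans_lt hn⟩, h2.1, h2.2⟩

theorem halfPlaneIntegral_le (hI : IsOpen I) (hf : IsSmooth I f) (ht : t ∈ I)
    (h : ∀ ρ > 0, ∀ z, 0 ≤ f t ρ z) {c : ℝ≥0∞}
    (hc : ∀ L > 0, ENNReal.ofReal (boxInt L f t) ≤ c) : halfPlaneIntegral f t ≤ c := by
  have hm : Monotone fun n : ℕ => box (n : ℝ) := fun m n hmn => box_mono (by exact_mod_cast hmn)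
  rw [halfPlaneIntegral, ← iUnion_box, setLIntegral_iUnion_of_directed _ hm.directed_le]
  refine iSup_le fun n => ?_
  calc _ ≤ ∫⁻ x in box ((n : ℝ) + 1), ENNReal.ofReal (f t x.1 x.2) :=
        lintegral_mono_set (box_mono (by linarith))
    _ = _ := (ofReal_boxInt hI hf ht h).symm
    _ ≤ c := hc _ (by positivity)

/-! ### Cutoffs -/

/-- A smooth cutoff equal to `1` where `√(1 + ρ² + z²) + κ (t - s) ≤ R` and to `0` where that
quantity is at least `2 R`. For `κ = ± 1` its level sets move inwards at the speed of light, away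
from the time `s`, in the future or the past. -/
noncomputable def cutoff (R s κ : ℝ) : Field := fun t ρ z =>
  Real.smoothTransition (2 - (√(1 + ρ ^ 2 + z ^ 2) + κ * (t - s)) / R)

theorem contDiff_deriv_smoothTransition :
    ContDiff ℝ ((⊤ : ℕ∞) : WithTop ℕ∞) (deriv Real.smoothTransition) :=
  (contDiff_infty_iff_deriv.1 Real.smoothTransition.contDiff).2

theorem deriv_smoothTransition_of_nonpos {x : ℝ} (hx : x ≤ 0) :
    deriv Real.smoothTransition x = 0 := by
  refine IsLocalMin.deriv_eq_zero (Eventually.of_forall fun y => ?_)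
  rw [Real.smoothTransition.zero_of_nonpos hx]
  exact Real.smoothTransition.nonneg y

theorem deriv_smoothTransition_of_one_le {x : ℝ} (hx : 1 ≤ x) :
    deriv Real.smoothTransition x = 0 := by
  refine IsLocalMax.deriv_eq_zero (Eventually.of_forall fun y => ?_)
  rw [Real.smoothTransition.one_of_one_le hx]
  exact Real.smoothTransition.le_one y

theorem exists_bound_of_zero_off_unit {u : ℝ → ℝ} (hu : Continuous u)
    (h0 : ∀ x < 0, u x = 0) (h1 : ∀ x > 1, u x = 0) : ∃ M, ∀ x, |u x| ≤ M := by
  obtain ⟨M, hM⟩ := (isCompact_Icc (a := (0 : ℝ)) (b := 1)).exists_bound_of_continuousOn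
    hu.continuousOn
  have hM0 : 0 ≤ M := (norm_nonneg _).trans (hM 0 (by simp))
  refine ⟨M, fun x => ?_⟩
  rcases lt_or_ge x 0 with h | h
  · simpa [h0 x h] using hM0
  rcases lt_or_ge 1 x with h' | h'
  · simpa [h1 x h'] using hM0
  · exact hM x ⟨h, h'⟩

theorem exists_bound_smoothTransition :
    ∃ M > 0, (∀ x, |deriv Real.smoothTransition x| ≤ M) ∧
      ∀ x, |deriv (deriv Real.smoothTransition) x| ≤ M := by
  obtain ⟨M₁, h₁⟩ := exists_bound_of_zero_off_unit contDiff_deriv_smoothTransition.continuous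
    (fun x hx => deriv_smoothTransition_of_nonpos hx.le)
    (fun x hx => deriv_smoothTransition_of_one_le (le_of_lt hx))
  obtain ⟨M₂, h₂⟩ := exists_bound_of_zero_off_unit
    (contDiff_infty_iff_deriv.1 contDiff_deriv_smoothTransition).2.continuous
    (fun x hx => by
      have : deriv Real.smoothTransition =ᶠ[𝓝 x] fun _ => 0 :=
        Filter.eventually_of_mem (Iio_mem_nhds hx)
          fun y hy => deriv_smoothTransition_of_nonpos (le_of_lt hy)
      simpa using this.deriv_eq)
    (fun x hx => by
      have : deriv Real.smoothTransition =ᶠ[𝓝 x] fun _ => 0 :=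
        Filter.eventually_of_mem (Ioi_mem_nhds hx)
          fun y hy => deriv_smoothTransition_of_one_le (le_of_lt hy)
      simpa using this.deriv_eq)
  refine ⟨max (max M₁ M₂) 1, by positivity, fun x => (h₁ x).trans ?_, fun x => (h₂ x).trans ?_⟩
  · exact (le_max_left _ _).trans (le_max_left _ _)
  · exact (le_max_right _ _).trans (le_max_left _ _)

theorem bracket_pos (ρ z : ℝ) : 0 < √(1 + ρ ^ 2 + z ^ 2) := Real.sqrt_pos.2 (by positivity)

theorem bracket_sq (ρ z : ℝ) : √(1 + ρ ^ 2 + z ^ 2) ^ 2 = 1 + ρ ^ 2 + z ^ 2 :=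
  Real.sq_sqrt (by positivity)

theorem abs_rho_le_bracket (ρ z : ℝ) : |ρ| ≤ √(1 + ρ ^ 2 + z ^ 2) :=
  Real.abs_le_sqrt (by nlinarith [sq_nonneg z])

theorem abs_z_le_bracket (ρ z : ℝ) : |z| ≤ √(1 + ρ ^ 2 + z ^ 2) :=
  Real.abs_le_sqrt (by nlinarith [sq_nonneg ρ])

theorem bracket_le (ρ z : ℝ) : √(1 + ρ ^ 2 + z ^ 2) ≤ 1 + √(ρ ^ 2 + z ^ 2) := by
  refine Real.sqrt_le_iff.2 ⟨by positivity, ?_⟩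
  nlinarith [Real.sq_sqrt (show 0 ≤ ρ ^ 2 + z ^ 2 by positivity), Real.sqrt_nonneg (ρ ^ 2 + z ^ 2)]

theorem isSmooth_cutoff (R s κ : ℝ) : IsSmooth I (cutoff R s κ) := by
  refine ContDiff.contDiffOn (Real.smoothTransition.contDiff.comp (contDiff_const.sub
    (ContDiff.div_const (ContDiff.add (ContDiff.sqrt (by fun_prop) fun x => ?_) (by fun_prop)) R)))
  positivity

theorem hasDerivAt_bracket_rho (ρ z : ℝ) :
    HasDerivAt (fun ρ => √(1 + ρ ^ 2 + z ^ 2)) (ρ / √(1 + ρ ^ 2 + z ^ 2)) ρ := by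
  have h : HasDerivAt (fun ρ : ℝ => 1 + ρ ^ 2 + z ^ 2) (2 * ρ) ρ := by
    simpa using ((hasDerivAt_pow 2 ρ).const_add 1).add_const (z ^ 2)
  convert h.sqrt (by positivity) using 1
  field_simp

theorem hasDerivAt_bracket_z (ρ z : ℝ) :
    HasDerivAt (fun z => √(1 + ρ ^ 2 + z ^ 2)) (z / √(1 + ρ ^ 2 + z ^ 2)) z := by
  have h : HasDerivAt (fun z : ℝ => 1 + ρ ^ 2 + z ^ 2) (2 * z) z := by
    simpa using (hasDerivAt_pow 2 z).const_add (1 + ρ ^ 2)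
  convert h.sqrt (by positivity) using 1
  field_simp

variable (R s κ : ℝ)

theorem hasDerivAt_smoothTransition (x : ℝ) :
    HasDerivAt Real.smoothTransition (deriv Real.smoothTransition x) x :=
  ((Real.smoothTransition.contDiff (n := 1)).differentiable (by simp) x).hasDerivAt

theorem dt_cutoff (t ρ z : ℝ) : dt (cutoff R s κ) t ρ z =
    -(deriv Real.smoothTransition (2 - (√(1 + ρ ^ 2 + z ^ 2) + κ * (t - s)) / R) * (κ / R)) := by
  have h : HasDerivAt (fun t => 2 - (√(1 + ρ ^ 2 + z ^ 2) + κ * (t - s)) / R) (-(κ * 1 / R)) t :=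
    (((((hasDerivAt_id t).sub_const s).const_mul κ).const_add _).div_const R).const_sub 2
  have := ((hasDerivAt_smoothTransition _).comp t h).deriv
  rw [mul_one] at this
  rw [← mul_neg]; exact this

theorem dρ_cutoff (t ρ z : ℝ) : dρ (cutoff R s κ) t ρ z =
    -(deriv Real.smoothTransition (2 - (√(1 + ρ ^ 2 + z ^ 2) + κ * (t - s)) / R) / R)
      * (ρ / √(1 + ρ ^ 2 + z ^ 2)) := by
  have h : HasDerivAt (fun ρ => 2 - (√(1 + ρ ^ 2 + z ^ 2) + κ * (t - s)) / R)
      (-(ρ / √(1 + ρ ^ 2 + z ^ 2) / R)) ρ :=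
    (((hasDerivAt_bracket_rho ρ z).add_const _).div_const R).const_sub 2
  refine ((hasDerivAt_smoothTransition _).comp ρ h).deriv.trans ?_
  ring

theorem dz_cutoff (t ρ z : ℝ) : dz (cutoff R s κ) t ρ z =
    -(deriv Real.smoothTransition (2 - (√(1 + ρ ^ 2 + z ^ 2) + κ * (t - s)) / R) / R)
      * (z / √(1 + ρ ^ 2 + z ^ 2)) := by
  have h : HasDerivAt (fun z => 2 - (√(1 + ρ ^ 2 + z ^ 2) + κ * (t - s)) / R)
      (-(z / √(1 + ρ ^ 2 + z ^ 2) / R)) z :=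
    (((hasDerivAt_bracket_z ρ z).add_const _).div_const R).const_sub 2
  refine ((hasDerivAt_smoothTransition _).comp z h).deriv.trans ?_
  ring

theorem abs_div_bracket_le_one {x b : ℝ} (hb : 0 < b) (h : |x| ≤ b) : |x / b| ≤ 1 := by
  rw [abs_div, abs_of_pos hb]; exact (div_le_one hb).2 h

theorem abs_second_deriv_bound {M S₁ S₂ R q c : ℝ} (hR : 1 ≤ R) (h₁ : |S₁| ≤ M) (h₂ : |S₂| ≤ M)
    (hq : |q| ≤ 1) (hc : |c| ≤ 1) :
    |-((S₂ * (-(q / R))) / R) * q + -(S₁ / R) * c| ≤ 2 * M / R := by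
  have hR0 : 0 < R := by linarith
  have e : -((S₂ * (-(q / R))) / R) * q + -(S₁ / R) * c = (S₂ * (q * q / R) - S₁ * c) / R := by
    field_simp; ring
  rw [e, abs_div, abs_of_pos hR0]
  refine div_le_div_of_nonneg_right ?_ hR0.le
  have hq2 : |q * q / R| ≤ 1 := by
    rw [abs_div, abs_mul, abs_of_pos hR0, div_le_one hR0]
    nlinarith [abs_nonneg q]
  have hM : 0 ≤ M := (abs_nonneg _).trans h₁
  calc _ ≤ |S₂ * (q * q / R)| + |S₁ * c| := abs_sub _ _
    _ ≤ M * 1 + M * 1 := by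
        rw [abs_mul, abs_mul]
        gcongr
    _ = 2 * M := by ring

theorem hasDerivAt_deriv_smoothTransition (x : ℝ) :
    HasDerivAt (deriv Real.smoothTransition) (deriv (deriv Real.smoothTransition) x) x :=
  (contDiff_deriv_smoothTransition.differentiable (by simp) x).hasDerivAt

/-- The spatial derivatives of the cutoffs are `O(1 / R)`, uniformly in `s`, `κ` and the point,
because `√(1 + ρ² + z²)` has bounded first and second derivatives. -/
theorem exists_cutoff_bounds : ∃ M > 0, ∀ R ≥ 1, ∀ s κ t ρ z : ℝ,
    |dρ (cutoff R s κ) t ρ z| ≤ M / R ∧ |dz (cutoff R s κ) t ρ z| ≤ M / R ∧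
    |dρ (dρ (cutoff R s κ)) t ρ z| ≤ M / R ∧ |dz (dz (cutoff R s κ)) t ρ z| ≤ M / R := by
  obtain ⟨M, hM, h₁, h₂⟩ := exists_bound_smoothTransition
  refine ⟨2 * M, by positivity, fun R hR s κ t ρ z => ?_⟩
  have hR0 : 0 < R := by linarith
  have hρ := abs_div_bracket_le_one (bracket_pos ρ z) (abs_rho_le_bracket ρ z)
  have hz := abs_div_bracket_le_one (bracket_pos ρ z) (abs_z_le_bracket ρ z)
  have first : ∀ x q : ℝ, |q| ≤ 1 → |-(deriv Real.smoothTransition x / R) * q| ≤ 2 * M / R := by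
    intro x q hq
    rw [abs_mul, abs_neg, abs_div, abs_of_pos hR0]
    calc _ ≤ M / R * 1 := by gcongr; exact h₁ x
      _ ≤ 2 * M / R := by rw [mul_one]; gcongr; linarith
  have hb := bracket_pos ρ z
  have hb1 : 1 ≤ √(1 + ρ ^ 2 + z ^ 2) := by
    rw [Real.one_le_sqrt]; nlinarith [sq_nonneg ρ, sq_nonneg z]
  have third : ∀ x : ℝ, x ^ 2 ≤ √(1 + ρ ^ 2 + z ^ 2) ^ 2 →
      |(1 * √(1 + ρ ^ 2 + z ^ 2) - x * (x / √(1 + ρ ^ 2 + z ^ 2))) / √(1 + ρ ^ 2 + z ^ 2) ^ 2| ≤ 1 := by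
    intro x hx
    set b := √(1 + ρ ^ 2 + z ^ 2)
    have hxx : x * (x / b) ≤ b := by
      rw [← mul_div_assoc, div_le_iff₀ hb]; nlinarith
    have hx0 : 0 ≤ x * (x / b) := by rw [← mul_div_assoc]; exact div_nonneg (mul_self_nonneg x) hb.le
    rw [abs_of_nonneg (div_nonneg (by linarith) (by positivity)), div_le_one (by positivity)]
    nlinarith
  refine ⟨?_, ?_, ?_, ?_⟩
  · rw [dρ_cutoff]; exact first _ _ hρ
  · rw [dz_cutoff]; exact first _ _ hz
  · have h : HasDerivAt (fun ρ => 2 - (√(1 + ρ ^ 2 + z ^ 2) + κ * (t - s)) / R)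
        (-(ρ / √(1 + ρ ^ 2 + z ^ 2) / R)) ρ :=
      (((hasDerivAt_bracket_rho ρ z).add_const _).div_const R).const_sub 2
    have h2 := ((((hasDerivAt_deriv_smoothTransition _).comp ρ h).div_const R).neg).mul
      ((hasDerivAt_id ρ).div (hasDerivAt_bracket_rho ρ z) hb.ne')
    have e : dρ (dρ (cutoff R s κ)) t ρ z = _ :=
      (congrArg (fun u => deriv u ρ) (funext fun ρ => dρ_cutoff R s κ t ρ z)).trans h2.deriv
    rw [e]
    exact abs_second_deriv_bound hR (h₁ _) (h₂ _) hρ (third ρ (by rw [bracket_sq]; nlinarith [sq_nonneg z]))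
  · have h : HasDerivAt (fun z => 2 - (√(1 + ρ ^ 2 + z ^ 2) + κ * (t - s)) / R)
        (-(z / √(1 + ρ ^ 2 + z ^ 2) / R)) z :=
      (((hasDerivAt_bracket_z ρ z).add_const _).div_const R).const_sub 2
    have h2 := ((((hasDerivAt_deriv_smoothTransition _).comp z h).div_const R).neg).mul
      ((hasDerivAt_id z).div (hasDerivAt_bracket_z ρ z) hb.ne')
    have e : dz (dz (cutoff R s κ)) t ρ z = _ :=
      (congrArg (fun u => deriv u z) (funext fun z => dz_cutoff R s κ t ρ z)).trans h2.deriv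
    rw [e]
    exact abs_second_deriv_bound hR (h₁ _) (h₂ _) hz (third z (by rw [bracket_sq]; nlinarith [sq_nonneg ρ]))

variable {R s κ}

theorem cutoff_nonneg (t ρ z : ℝ) : 0 ≤ cutoff R s κ t ρ z := Real.smoothTransition.nonneg _

theorem cutoff_le_one (t ρ z : ℝ) : cutoff R s κ t ρ z ≤ 1 := Real.smoothTransition.le_one _

theorem cutoff_eq_one (hR : 0 < R) (h : √(1 + ρ ^ 2 + z ^ 2) + κ * (t - s) ≤ R) :
    cutoff R s κ t ρ z = 1 :=
  Real.smoothTransition.one_of_one_le (by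
    have := (div_le_one hR).2 h
    linarith)

theorem cutoff_arg_nonpos (hR : 0 < R) (h : 2 * R ≤ √(1 + ρ ^ 2 + z ^ 2) + κ * (t - s)) :
    2 - (√(1 + ρ ^ 2 + z ^ 2) + κ * (t - s)) / R ≤ 0 := by
  have := (le_div_iff₀ hR).2 h
  linarith

theorem cutoff_eq_zero (hR : 0 < R) (h : 2 * R ≤ √(1 + ρ ^ 2 + z ^ 2) + κ * (t - s)) :
    cutoff R s κ t ρ z = 0 ∧ dρ (cutoff R s κ) t ρ z = 0 ∧ dz (cutoff R s κ) t ρ z = 0 := by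
  have h0 := cutoff_arg_nonpos hR h
  refine ⟨Real.smoothTransition.zero_of_nonpos h0, ?_, ?_⟩
  · rw [dρ_cutoff, deriv_smoothTransition_of_nonpos h0]; simp
  · rw [dz_cutoff, deriv_smoothTransition_of_nonpos h0]; simp

/-- The gradient of the cutoff vanishes where the cutoff is `1`. -/
theorem cutoff_grad_eq_zero (hR : 0 < R)
    (h : √(1 + ρ ^ 2 + z ^ 2) + κ * (t - s) < R) :
    dρ (cutoff R s κ) t ρ z = 0 ∧ dz (cutoff R s κ) t ρ z = 0 := by
  have h1 : 1 ≤ 2 - (√(1 + ρ ^ 2 + z ^ 2) + κ * (t - s)) / R := by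
    have := (div_le_one hR).2 h.le
    linarith
  constructor
  · rw [dρ_cutoff, deriv_smoothTransition_of_one_le h1]; simp
  · rw [dz_cutoff, deriv_smoothTransition_of_one_le h1]; simp

end LinGrav

namespace LinGrav

variable {I : Set ℝ} {f g : Field} {t ρ z L : ℝ}

/-! ### Energy conservation by finite speed of propagation -/

theorem bracket_le_of_mem_box {x : ℝ × ℝ} (hx : x ∈ box L) :
    √(1 + x.1 ^ 2 + x.2 ^ 2) ≤ 1 + 2 * L := by
  obtain ⟨⟨h1, h2⟩, h3, h4⟩ := hx
  have h5 := abs_lt.2 ⟨h3, h4⟩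
  refine Real.sqrt_le_iff.2 ⟨by linarith, ?_⟩
  nlinarith [sq_abs x.2, abs_nonneg x.2]

/-- Since `|∂√(1 + ρ² + z²)| < 1`, the level sets of the cutoff are spacelike. By Cauchy–Schwarz,
a flux bounded by the energy density only carries energy out of the cutoff region as time moves
away from `s`. -/
theorem cutoff_flux_le {R s κ e F G : ℝ} (hR : 0 < R) (hκ : κ ^ 2 = 1) (he : 0 ≤ e)
    (hFG : F ^ 2 + G ^ 2 ≤ e ^ 2) :
    κ * (dt (cutoff R s κ) t ρ z * e - dρ (cutoff R s κ) t ρ z * F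
      - dz (cutoff R s κ) t ρ z * G) ≤ 0 := by
  rw [dt_cutoff, dρ_cutoff, dz_cutoff]
  set D := deriv Real.smoothTransition (2 - (√(1 + ρ ^ 2 + z ^ 2) + κ * (t - s)) / R)
  have hD : 0 ≤ D / R := div_nonneg Real.smoothTransition.monotone.deriv_nonneg hR.le
  have hb := bracket_pos ρ z
  have hsq := bracket_sq ρ z
  set b := √(1 + ρ ^ 2 + z ^ 2)
  have hab : (ρ / b) ^ 2 + (z / b) ^ 2 ≤ 1 := by
    rw [div_pow, div_pow, ← add_div, div_le_one (by positivity)]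
    linarith
  generalize ρ / b = α at *
  generalize z / b = γ at *
  have hcs : |κ * (α * F + γ * G)| ≤ e := by
    refine abs_le_of_sq_le_sq (le_trans ?_ hFG) he
    rw [mul_pow, hκ, one_mul]
    nlinarith [sq_nonneg (α * G - γ * F), sq_nonneg F, sq_nonneg G]
  have key : κ * (-(D * (κ / R)) * e - -(D / R) * α * F - -(D / R) * γ * G)
      = (D / R) * (κ * (α * F + γ * G) - e) := by
    have : κ * κ = 1 := by rw [← hκ]; ring
    linear_combination (-(D / R * e)) * this
  rw [key]
  exact mul_nonpos_of_nonneg_of_nonpos hD (by linarith [le_abs_self (κ * (α * F + γ * G))])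

/-- The energy inequality with a cutoff moving at the speed of light: the energy weighted by the
cutoff grows at most at the rate `δ` of the part `(F₂, G₂)` of the flux that is not controlled by
the energy density. -/
theorem boxInt_cutoff_le (hI : IsOpen I) (hc : I.OrdConnected) {e F₁ G₁ F₂ G₂ : Field}
    (he : IsSmooth I e) (hF₁ : IsSmooth I F₁) (hG₁ : IsSmooth I G₁) (hF₂ : IsSmooth I F₂)
    (hG₂ : IsSmooth I G₂) (hpos : ∀ t ∈ I, ∀ ρ > 0, ∀ z, 0 ≤ e t ρ z)
    (hdiv : ∀ t ∈ I, ∀ ρ > 0, ∀ z, dt e t ρ z = dρ (fun t ρ z => F₁ t ρ z + F₂ t ρ z) t ρ z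
      + dz (fun t ρ z => G₁ t ρ z + G₂ t ρ z) t ρ z)
    (hax : ∀ t ∈ I, ∀ z, F₁ t 0 z + F₂ t 0 z = 0)
    (hcone : ∀ t ∈ I, ∀ ρ > 0, ∀ z, F₁ t ρ z ^ 2 + G₁ t ρ z ^ 2 ≤ e t ρ z ^ 2)
    {s t R κ δ : ℝ} (hs : s ∈ I) (ht : t ∈ I) (hR : 0 < R) (hκ : κ ^ 2 = 1)
    (hκt : 0 ≤ κ * (t - s))
    (hflux : ∀ τ ∈ uIcc s t, |boxInt (2 * R) (fun t ρ z => dρ (cutoff R s κ) t ρ z * F₂ t ρ z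
      + dz (cutoff R s κ) t ρ z * G₂ t ρ z) τ| ≤ δ) :
    boxInt (2 * R) (fun t ρ z => cutoff R s κ t ρ z * e t ρ z) t
      ≤ boxInt (2 * R) (fun t ρ z => cutoff R s κ t ρ z * e t ρ z) s + δ * |t - s| := by
  set φ := cutoff R s κ with hφdef
  have hφ : IsSmooth I φ := isSmooth_cutoff R s κ
  have hsub : uIcc s t ⊆ I := hc.uIcc_subset hs ht
  have hJs : IsSmooth I (fun t ρ z => φ t ρ z * e t ρ z) := hφ.mul he
  have hκτ : ∀ τ ∈ uIcc s t, 0 ≤ κ * (τ - s) := by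
    intro τ hτ
    rcases sq_eq_one_iff.1 hκ with rfl | rfl
    · rw [uIcc_of_le (by linarith)] at hτ; linarith [hτ.1]
    · rw [uIcc_of_ge (by linarith)] at hτ; linarith [hτ.2]
  have hder : ∀ τ ∈ uIcc s t, κ * boxInt (2 * R) (dt fun t ρ z => φ t ρ z * e t ρ z) τ ≤ δ := by
    intro τ hτ
    have hτI := hsub hτ
    have hF := hF₁.add hF₂
    have hG := hG₁.add hG₂
    have hsplit : boxInt (2 * R) (dt fun t ρ z => φ t ρ z * e t ρ z) τ =
        boxInt (2 * R) (fun t ρ z =>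
          ((dt φ t ρ z * e t ρ z - dρ φ t ρ z * F₁ t ρ z - dz φ t ρ z * G₁ t ρ z)
          - (dρ φ t ρ z * F₂ t ρ z + dz φ t ρ z * G₂ t ρ z))
          + (dρ (fun t ρ z => φ t ρ z * (F₁ t ρ z + F₂ t ρ z)) t ρ z
            + dz (fun t ρ z => φ t ρ z * (G₁ t ρ z + G₂ t ρ z)) t ρ z)) τ := by
      refine boxInt_congr fun x hx => ?_
      have e1 : dt (fun t ρ z => φ t ρ z * e t ρ z) τ x.1 x.2 = _ :=
        ((hφ.hasDerivAt_dt hI hτI x.1 x.2).mul (he.hasDerivAt_dt hI hτI x.1 x.2)).deriv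
      have e2 : dρ (fun t ρ z => φ t ρ z * (F₁ t ρ z + F₂ t ρ z)) τ x.1 x.2 = _ :=
        ((hφ.hasDerivAt_dρ hI hτI x.1 x.2).mul (hF.hasDerivAt_dρ hI hτI x.1 x.2)).deriv
      have e3 : dz (fun t ρ z => φ t ρ z * (G₁ t ρ z + G₂ t ρ z)) τ x.1 x.2 = _ :=
        ((hφ.hasDerivAt_dz hI hτI x.1 x.2).mul (hG.hasDerivAt_dz hI hτI x.1 x.2)).deriv
      rw [e1, e2, e3, hdiv τ hτI x.1 hx.1.1 x.2]
      ring
    have hA : IsSmooth I (fun t ρ z =>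
        dt φ t ρ z * e t ρ z - dρ φ t ρ z * F₁ t ρ z - dz φ t ρ z * G₁ t ρ z) :=
      (((hφ.dt hI).mul he).sub ((hφ.dρ hI).mul hF₁)).sub ((hφ.dz hI).mul hG₁)
    have hB : IsSmooth I (fun t ρ z => dρ φ t ρ z * F₂ t ρ z + dz φ t ρ z * G₂ t ρ z) :=
      ((hφ.dρ hI).mul hF₂).add ((hφ.dz hI).mul hG₂)
    have hz : boxInt (2 * R) (fun t ρ z => dρ (fun t ρ z => φ t ρ z * (F₁ t ρ z + F₂ t ρ z)) t ρ z
        + dz (fun t ρ z => φ t ρ z * (G₁ t ρ z + G₂ t ρ z)) t ρ z) τ = 0 := by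
      have houter : ∀ ρ z : ℝ, 2 * R ≤ √(1 + ρ ^ 2 + z ^ 2) → φ τ ρ z = 0 := fun ρ z h =>
        (cutoff_eq_zero hR (by linarith [hκτ τ hτ])).1
      refine boxInt_div_eq_zero hI (hφ.mul hF) (hφ.mul hG) hτI (by linarith) ?_ ?_ ?_ ?_
      · intro z; simp only [hax τ hτI z, mul_zero]
      · intro z
        simp only [houter (2 * R) z ((le_abs_self _).trans (abs_rho_le_bracket _ _)), zero_mul]
      · intro ρ
        simp only [houter ρ (2 * R) ((le_abs_self _).trans (abs_z_le_bracket _ _)), zero_mul]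
      · intro ρ
        simp only [houter ρ (-(2 * R)) ((le_abs_self _).trans ((abs_neg (2 * R)).symm.le.trans
          (abs_z_le_bracket _ _))), zero_mul]
    rw [hsplit, boxInt_add hI (hA.sub hB) (((hφ.mul hF).dρ hI).add ((hφ.mul hG).dz hI)) hτI, hz,
      boxInt_sub hI hA hB hτI, add_zero, mul_sub]
    have h1 : κ * boxInt (2 * R) (fun t ρ z =>
        dt φ t ρ z * e t ρ z - dρ φ t ρ z * F₁ t ρ z - dz φ t ρ z * G₁ t ρ z) τ ≤ 0 := by
      rw [← boxInt_const_mul]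
      refine setIntegral_nonpos measurableSet_box fun x hx => ?_
      exact cutoff_flux_le hR hκ (hpos τ hτI x.1 hx.1.1 x.2) (hcone τ hτI x.1 hx.1.1 x.2)
    have h2 := hflux τ hτ
    have hκ1 : |κ| = 1 := by rwa [← sq_eq_sq₀ (abs_nonneg _) zero_le_one, sq_abs, one_pow]
    have h3 := neg_abs_le (κ * boxInt (2 * R) (fun t ρ z => dρ φ t ρ z * F₂ t ρ z
      + dz φ t ρ z * G₂ t ρ z) τ)
    rw [abs_mul, hκ1, one_mul] at h3
    linarith
  have hmv := Convex.image_sub_le_mul_sub_of_deriv_le (convex_uIcc s t)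
    (f := fun τ => κ * boxInt (2 * R) (fun t ρ z => φ t ρ z * e t ρ z) τ) (C := δ)
    (fun τ hτ => ((hasDerivAt_boxInt hI hJs (hsub hτ)).const_mul κ).continuousAt.continuousWithinAt)
    (fun τ hτ => ((hasDerivAt_boxInt hI hJs
      (hsub (interior_subset hτ))).const_mul κ).differentiableAt.differentiableWithinAt)
    (fun τ hτ => by
      rw [((hasDerivAt_boxInt hI hJs (hsub (interior_subset hτ))).const_mul κ).deriv]
      exact hder τ (interior_subset hτ))
  rcases sq_eq_one_iff.1 hκ with h | h <;> rw [h] at hκt hmv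
  · have := hmv s left_mem_uIcc t right_mem_uIcc (by linarith)
    rw [abs_of_nonneg (by linarith)]
    linarith
  · have := hmv t right_mem_uIcc s left_mem_uIcc (by linarith)
    rw [abs_of_nonpos (by linarith)]
    linarith

/-- Conservation of an energy that is not assumed to be finite. The part `(F₁, G₁)` of the flux is
bounded by the energy density, the part `(F₂, G₂)` is negligible through the cutoff region.
Running the cutoff argument in both directions of time (`κ = 1` and `κ = -1`) bounds the energy at
either of two times by the energy at the other, also when these are infinite. -/
theorem halfPlaneIntegral_conserved (hI : IsOpen I) (hc : I.OrdConnected) {e F₁ G₁ F₂ G₂ : Field}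
    (he : IsSmooth I e) (hF₁ : IsSmooth I F₁) (hG₁ : IsSmooth I G₁) (hF₂ : IsSmooth I F₂)
    (hG₂ : IsSmooth I G₂) (hpos : ∀ t ∈ I, ∀ ρ > 0, ∀ z, 0 ≤ e t ρ z)
    (hdiv : ∀ t ∈ I, ∀ ρ > 0, ∀ z, dt e t ρ z = dρ (fun t ρ z => F₁ t ρ z + F₂ t ρ z) t ρ z
      + dz (fun t ρ z => G₁ t ρ z + G₂ t ρ z) t ρ z)
    (hax : ∀ t ∈ I, ∀ z, F₁ t 0 z + F₂ t 0 z = 0)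
    (hcone : ∀ t ∈ I, ∀ ρ > 0, ∀ z, F₁ t ρ z ^ 2 + G₁ t ρ z ^ 2 ≤ e t ρ z ^ 2)
    (hflux : ∀ K ⊆ I, IsCompact K → ∀ T > 0, ∀ δ > 0, ∃ R₀, ∀ R ≥ R₀, ∀ s κ, ∀ t ∈ K,
      0 ≤ κ * (t - s) → κ * (t - s) ≤ T →
      |boxInt (2 * R) (fun t ρ z => dρ (cutoff R s κ) t ρ z * F₂ t ρ z
        + dz (cutoff R s κ) t ρ z * G₂ t ρ z) t| ≤ δ) :
    ∀ s ∈ I, ∀ t ∈ I, halfPlaneIntegral e s = halfPlaneIntegral e t := by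
  suffices h : ∀ s ∈ I, ∀ t ∈ I, halfPlaneIntegral e t ≤ halfPlaneIntegral e s from
    fun s hs t ht => le_antisymm (h t ht s hs) (h s hs t ht)
  intro s hs t ht
  refine halfPlaneIntegral_le hI he ht (hpos t ht) fun L hL => ?_
  refine ENNReal.le_of_forall_pos_le_add fun ε hε _ => ?_
  have hsub : uIcc s t ⊆ I := hc.uIcc_subset hs ht
  set T := |t - s| + 1 with hT
  have hT0 : 0 < T := by positivity
  have hε' : (0 : ℝ) < ε := hε
  obtain ⟨κ, hκ, hκτ⟩ : ∃ κ : ℝ, κ ^ 2 = 1 ∧ ∀ τ ∈ uIcc s t, κ * (τ - s) = |τ - s| := by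
    rcases le_total s t with h | h
    · refine ⟨1, by norm_num, fun τ hτ => ?_⟩
      rw [uIcc_of_le h] at hτ
      rw [abs_of_nonneg (by linarith [hτ.1]), one_mul]
    · refine ⟨-1, by norm_num, fun τ hτ => ?_⟩
      rw [uIcc_of_ge h] at hτ
      rw [abs_of_nonpos (by linarith [hτ.2]), neg_one_mul]
  obtain ⟨R₀, hR₀⟩ := hflux (uIcc s t) hsub isCompact_uIcc T hT0 (ε / T) (by positivity)
  set R := max R₀ (1 + 2 * L + T) with hRdef
  have hR1 : 1 + 2 * L + T ≤ R := le_max_right _ _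
  have hR : 0 < R := by linarith
  have hκt : κ * (t - s) = |t - s| := hκτ t right_mem_uIcc
  have hmain := boxInt_cutoff_le hI hc he hF₁ hG₁ hF₂ hG₂ hpos hdiv hax hcone (R := R) (κ := κ)
    (δ := ε / T) hs ht hR hκ (by rw [hκt]; positivity) (fun τ hτ => by
      refine hR₀ R (le_max_left _ _) s κ τ hτ ?_ ?_
      · rw [hκτ τ hτ]; positivity
      · rw [hκτ τ hτ]
        exact (abs_sub_left_of_mem_uIcc hτ).trans (by linarith))
  have h1 : boxInt L e t ≤ boxInt (2 * R) (fun t ρ z => cutoff R s κ t ρ z * e t ρ z) t := by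
    have hcg : boxInt L e t = boxInt L (fun t ρ z => cutoff R s κ t ρ z * e t ρ z) t := by
      refine boxInt_congr fun x hx => ?_
      have := bracket_le_of_mem_box hx
      rw [cutoff_eq_one hR (by rw [hκt]; linarith), one_mul]
    rw [hcg]
    exact boxInt_mono_set hI ((isSmooth_cutoff R s κ).mul he) ht (by linarith) fun x hx =>
      mul_nonneg (cutoff_nonneg _ _ _) (hpos t ht x.1 hx.1.1 x.2)
  have h2 : boxInt (2 * R) (fun t ρ z => cutoff R s κ t ρ z * e t ρ z) s ≤ boxInt (2 * R) e s := by
    refine boxInt_mono hI ((isSmooth_cutoff R s κ).mul he) he hs fun x hx => ?_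
    exact mul_le_of_le_one_left (hpos s hs x.1 hx.1.1 x.2) (cutoff_le_one _ _ _)
  have h3 : ε / T * |t - s| ≤ ε := by
    rw [div_mul_eq_mul_div, div_le_iff₀ hT0]
    exact mul_le_mul_of_nonneg_left (by linarith) hε'.le
  calc ENNReal.ofReal (boxInt L e t) ≤ ENNReal.ofReal (boxInt (2 * R) e s + ε) :=
        ENNReal.ofReal_le_ofReal (by linarith)
    _ ≤ ENNReal.ofReal (boxInt (2 * R) e s) + ENNReal.ofReal ε := ENNReal.ofReal_add_le
    _ ≤ halfPlaneIntegral e s + ε := by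
        rw [ENNReal.ofReal_coe_nnreal]
        gcongr
        exact ofReal_boxInt_le hI he hs (hpos s hs) _

end LinGrav

namespace LinGrav

variable {I : Set ℝ} {f g : Field} {t ρ z L : ℝ}

/-! ### The time derivative of a solution -/

theorem IsSmooth.lap_dt (hI : IsOpen I) (hf : IsSmooth I f) (ht : t ∈ I) (ρ z : ℝ) :
    lap (LinGrav.dt f) t ρ z = LinGrav.dt (lap f) t ρ z := by
  have e1 : LinGrav.dρ (LinGrav.dρ (LinGrav.dt f)) t ρ z
      = LinGrav.dt (LinGrav.dρ (LinGrav.dρ f)) t ρ z := by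
    rw [dρ_congr (g := LinGrav.dt (LinGrav.dρ f)) fun ρ => hf.dρ_dt hI ht ρ z,
      (hf.dρ hI).dρ_dt hI ht]
  have e2 : LinGrav.dz (LinGrav.dz (LinGrav.dt f)) t ρ z
      = LinGrav.dt (LinGrav.dz (LinGrav.dz f)) t ρ z := by
    rw [dz_congr (g := LinGrav.dt (LinGrav.dz f)) fun z => hf.dz_dt hI ht ρ z,
      (hf.dz hI).dz_dt hI ht]
  have e3 : LinGrav.dt (lap f) t ρ z = _ :=
    ((((hf.dρ hI).dρ hI).hasDerivAt_dt hI ht ρ z).add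
      (((hf.dz hI).dz hI).hasDerivAt_dt hI ht ρ z)).deriv
  rw [e3, lap, e1, e2]

theorem IsSmooth.lap (hI : IsOpen I) (hf : IsSmooth I f) : IsSmooth I (lap f) :=
  ((hf.dρ hI).dρ hI).add ((hf.dz hI).dz hI)

theorem IsSmooth.hasDerivAt_lap3 (hI : IsOpen I) (hf : IsSmooth I f) (ht : t ∈ I) (ρ z : ℝ) :
    HasDerivAt (fun t => lap3 f t ρ z) (lap3 (LinGrav.dt f) t ρ z) t := by
  have h := ((hf.lap hI).hasDerivAt_dt hI ht ρ z).add
    (((hf.dρ hI).hasDerivAt_dt hI ht ρ z).div_const ρ)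
  rw [← hf.lap_dt hI ht, ← hf.dρ_dt hI ht] at h
  exact h

/-- An identity between functions of time may be differentiated. -/
theorem deriv_unique_of_eqOn {u v : ℝ → ℝ} {a b : ℝ} (hI : IsOpen I) (ht : t ∈ I)
    (h : ∀ s ∈ I, u s = v s) (hu : HasDerivAt u a t) (hv : HasDerivAt v b t) : a = b :=
  (hu.congr_of_eventuallyEq (Filter.eventually_of_mem (hI.mem_nhds ht)
    fun s hs => (h s hs).symm)).unique hv

namespace Perturbation

/-- The time derivative of a perturbation. -/
noncomputable def tderiv (P : Perturbation) : Perturbation where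
  σ := dt P.σ
  q := dt P.q
  ω := dt P.ω
  βρ := dt P.βρ
  βz := dt P.βz
  χρρ := dt P.χρρ
  χρz := dt P.χρz
  χzz := dt P.χzz

theorem IsSolution.p_tderiv {P : Perturbation} (hP : P.IsSolution I) (hI : IsOpen I) (ht : t ∈ I)
    (ρ z : ℝ) : P.tderiv.p t ρ z = dt P.p t ρ z := by
  have h : dt P.p t ρ z = _ := (((hP.smooth_σ.dt hI).hasDerivAt_dt hI ht ρ z).sub
    (((hP.smooth_βρ.hasDerivAt_dt hI ht ρ z).const_mul 2).div_const ρ)).deriv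
  rw [h]; rfl

/-- The linear equations are invariant under time translations, so that the time derivative of a
solution is a solution. -/
theorem IsSolution.tderiv {P : Perturbation} (hP : P.IsSolution I) (hI : IsOpen I) :
    P.tderiv.IsSolution I where
  smooth_σ := hP.smooth_σ.dt hI
  smooth_q := hP.smooth_q.dt hI
  smooth_ω := hP.smooth_ω.dt hI
  smooth_βρ := hP.smooth_βρ.dt hI
  smooth_βz := hP.smooth_βz.dt hI
  smooth_χρρ := hP.smooth_χρρ.dt hI
  smooth_χρz := hP.smooth_χρz.dt hI
  smooth_χzz := hP.smooth_χzz.dt hI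
  trace_free t ht ρ hρ z := deriv_unique_of_eqOn hI ht (fun s hs => hP.trace_free s hs ρ hρ z)
    ((hP.smooth_χρρ.hasDerivAt_dt hI ht ρ z).add (hP.smooth_χzz.hasDerivAt_dt hI ht ρ z))
    (hasDerivAt_const t 0)
  evol_σ t ht ρ hρ z := by
    have h1 : dt P.tderiv.p t ρ z = dt (dt P.p) t ρ z :=
      dt_congr hI (fun s hs => hP.p_tderiv hI hs ρ z) ht
    have h2 : dt (dt P.p) t ρ z = dt (lap3 P.σ) t ρ z :=
      dt_congr hI (fun s hs => by linarith [hP.evol_σ s hs ρ hρ z]) ht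
    have h3 : dt (lap3 P.σ) t ρ z = lap3 P.tderiv.σ t ρ z :=
      (hP.smooth_σ.hasDerivAt_lap3 hI ht ρ z).deriv
    rw [h1, h2, h3]; ring
  evol_ω t ht ρ hρ z := by
    have h := deriv_unique_of_eqOn hI ht (fun s hs => hP.evol_ω s hs ρ hρ z)
      ((((hP.smooth_ω.dt hI).dt hI).hasDerivAt_dt hI ht ρ z).neg.add
        (hP.smooth_ω.hasDerivAt_lap3 hI ht ρ z))
      ((((hP.smooth_ω.dρ hI).hasDerivAt_dt hI ht ρ z).const_mul 4).div_const ρ)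
    rw [← hP.smooth_ω.dρ_dt hI ht] at h
    exact h
  evol_u t ht ρ hρ z := by
    have hu : dt P.tderiv.u t ρ z = dt (dt P.u) t ρ z := by
      refine dt_congr hI (fun s hs => ?_) ht
      exact ((hP.smooth_σ.hasDerivAt_dt hI hs ρ z).add
        (hP.smooth_q.hasDerivAt_dt hI hs ρ z)).deriv.symm
    have h := deriv_unique_of_eqOn hI ht (fun s hs => hP.evol_u s hs ρ hρ z)
      (((((hP.smooth_σ.add hP.smooth_q).dt hI).hasDerivAt_dt hI ht ρ z)).const_mul 2)
      ((((hP.smooth_βρ.dρ hI).hasDerivAt_dt hI ht ρ z).add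
        ((hP.smooth_βz.dz hI).hasDerivAt_dt hI ht ρ z)).add
        (((hP.smooth_βρ.hasDerivAt_dt hI ht ρ z).const_mul 2).div_const ρ))
    rw [← hP.smooth_βρ.dρ_dt hI ht, ← hP.smooth_βz.dz_dt hI ht] at h
    rw [hu]
    exact h
  evol_χρρ t ht ρ hρ z := by
    have h := deriv_unique_of_eqOn hI ht (fun s hs => hP.evol_χρρ s hs ρ hρ z)
      ((hP.smooth_χρρ.dt hI).hasDerivAt_dt hI ht ρ z)
      ((((hP.smooth_q.dρ hI).hasDerivAt_dt hI ht ρ z).const_mul 2).sub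
        ((hP.smooth_q.dρ hI).hasDerivAt_dt hI ht ρ z))
    rw [← hP.smooth_q.dρ_dt hI ht] at h
    exact h
  evol_χρz t ht ρ hρ z := by
    have h := deriv_unique_of_eqOn hI ht (fun s hs => hP.evol_χρz s hs ρ hρ z)
      ((hP.smooth_χρz.dt hI).hasDerivAt_dt hI ht ρ z)
      ((hP.smooth_q.dz hI).hasDerivAt_dt hI ht ρ z)
    rw [← hP.smooth_q.dz_dt hI ht] at h
    exact h
  evol_χzz t ht ρ hρ z := by
    have h := deriv_unique_of_eqOn hI ht (fun s hs => hP.evol_χzz s hs ρ hρ z)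
      ((hP.smooth_χzz.dt hI).hasDerivAt_dt hI ht ρ z)
      ((hP.smooth_q.dρ hI).hasDerivAt_dt hI ht ρ z).neg
    rw [← hP.smooth_q.dρ_dt hI ht] at h
    exact h
  momentum_ρ t ht ρ hρ z := by
    have hp : HasDerivAt (fun s => P.p s ρ z) (P.tderiv.p t ρ z) t :=
      ((hP.smooth_σ.dt hI).hasDerivAt_dt hI ht ρ z).sub
        (((hP.smooth_βρ.hasDerivAt_dt hI ht ρ z).const_mul 2).div_const ρ)
    have h := deriv_unique_of_eqOn hI ht (fun s hs => hP.momentum_ρ s hs ρ hρ z)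
      (((hP.smooth_χρρ.dρ hI).hasDerivAt_dt hI ht ρ z).add
        ((hP.smooth_χρz.dz hI).hasDerivAt_dt hI ht ρ z)) hp.neg
    rw [← hP.smooth_χρρ.dρ_dt hI ht, ← hP.smooth_χρz.dz_dt hI ht] at h
    exact h
  momentum_z t ht ρ hρ z := by
    have h := deriv_unique_of_eqOn hI ht (fun s hs => hP.momentum_z s hs ρ hρ z)
      (((hP.smooth_χρz.dρ hI).hasDerivAt_dt hI ht ρ z).add
        ((hP.smooth_χzz.dz hI).hasDerivAt_dt hI ht ρ z)) (hasDerivAt_const t 0)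
    rw [← hP.smooth_χρz.dρ_dt hI ht, ← hP.smooth_χzz.dz_dt hI ht] at h
    exact h
  hamiltonian t ht ρ hρ z := by
    have h := deriv_unique_of_eqOn hI ht (fun s hs => hP.hamiltonian s hs ρ hρ z)
      (((hP.smooth_q.lap hI).hasDerivAt_dt hI ht ρ z).add
        (hP.smooth_σ.hasDerivAt_lap3 hI ht ρ z)) (hasDerivAt_const t 0)
    rw [← hP.smooth_q.lap_dt hI ht] at h
    exact h
  shift_ρρ t ht ρ hρ z := by
    have h := deriv_unique_of_eqOn hI ht (fun s hs => hP.shift_ρρ s hs ρ hρ z)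
      ((((hP.smooth_βρ.dρ hI).hasDerivAt_dt hI ht ρ z).const_mul 2).sub
        (((hP.smooth_βρ.dρ hI).hasDerivAt_dt hI ht ρ z).add
          ((hP.smooth_βz.dz hI).hasDerivAt_dt hI ht ρ z)))
      ((hP.smooth_χρρ.hasDerivAt_dt hI ht ρ z).const_mul (2 / ρ))
    rw [← hP.smooth_βρ.dρ_dt hI ht, ← hP.smooth_βz.dz_dt hI ht] at h
    exact h
  shift_ρz t ht ρ hρ z := by
    have h := deriv_unique_of_eqOn hI ht (fun s hs => hP.shift_ρz s hs ρ hρ z)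
      (((hP.smooth_βz.dρ hI).hasDerivAt_dt hI ht ρ z).add
        ((hP.smooth_βρ.dz hI).hasDerivAt_dt hI ht ρ z))
      ((hP.smooth_χρz.hasDerivAt_dt hI ht ρ z).const_mul (2 / ρ))
    rw [← hP.smooth_βz.dρ_dt hI ht, ← hP.smooth_βρ.dz_dt hI ht] at h
    exact h
  shift_zz t ht ρ hρ z := by
    have h := deriv_unique_of_eqOn hI ht (fun s hs => hP.shift_zz s hs ρ hρ z)
      ((((hP.smooth_βz.dz hI).hasDerivAt_dt hI ht ρ z).const_mul 2).sub
        (((hP.smooth_βρ.dρ hI).hasDerivAt_dt hI ht ρ z).add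
          ((hP.smooth_βz.dz hI).hasDerivAt_dt hI ht ρ z)))
      ((hP.smooth_χzz.hasDerivAt_dt hI ht ρ z).const_mul (2 / ρ))
    rw [← hP.smooth_βρ.dρ_dt hI ht, ← hP.smooth_βz.dz_dt hI ht] at h
    exact h

theorem AxisRegular.tderiv {P : Perturbation} (hP : P.AxisRegular I) (hI : IsOpen I) :
    P.tderiv.AxisRegular I where
  even_σ := hP.even_σ.dt hI
  even_q := hP.even_q.dt hI
  even_ω := hP.even_ω.dt hI
  even_βz := hP.even_βz.dt hI
  odd_βρ := hP.odd_βρ.dt hI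

theorem IsSolution.iterate_tderiv {P : Perturbation} (hP : P.IsSolution I) (hI : IsOpen I) (n : ℕ) :
    (Perturbation.tderiv^[n] P).IsSolution I := by
  induction n with
  | zero => exact hP
  | succ n ih => rw [Function.iterate_succ_apply']; exact ih.tderiv hI

theorem AxisRegular.iterate_tderiv {P : Perturbation} (hP : P.AxisRegular I) (hI : IsOpen I)
    (n : ℕ) : (Perturbation.tderiv^[n] P).AxisRegular I := by
  induction n with
  | zero => exact hP
  | succ n ih => rw [Function.iterate_succ_apply']; exact ih.tderiv hI

theorem iterate_tderiv_eq (P : Perturbation) (n : ℕ) : Perturbation.tderiv^[n] P =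
    ⟨dt^[n] P.σ, dt^[n] P.q, dt^[n] P.ω, dt^[n] P.βρ, dt^[n] P.βz, dt^[n] P.χρρ, dt^[n] P.χρz,
      dt^[n] P.χzz⟩ := by
  induction n with
  | zero => rfl
  | succ n ih => simp only [Function.iterate_succ_apply', ih]; rfl

theorem FallsOff.iterate_tderiv {P : Perturbation} {n k : ℕ} (h : P.FallsOff I (k + n)) :
    (Perturbation.tderiv^[n] P).FallsOff I k := by
  rw [iterate_tderiv_eq]
  constructor <;> simp only [← Function.iterate_add_apply]
  exacts [h.σ, h.βρ, h.βz, h.χρρ, h.χρz, h.χzz]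

theorem IsSolution.p_iterate_tderiv {P : Perturbation} (hP : P.IsSolution I) (hI : IsOpen I)
    (n : ℕ) (ht : t ∈ I) (ρ z : ℝ) :
    (Perturbation.tderiv^[n] P).p t ρ z = dt^[n] P.p t ρ z := by
  induction n generalizing t with
  | zero => rfl
  | succ n ih =>
    rw [Function.iterate_succ_apply', Function.iterate_succ_apply',
      (hP.iterate_tderiv hI n).p_tderiv hI ht]
    exact dt_congr hI (fun s hs => ih hs) ht

theorem IsSolution.massσ_add {P : Perturbation} (hP : P.IsSolution I) (hI : IsOpen I) (n k : ℕ)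
    (ht : t ∈ I) : P.massσ (k + n) t = (Perturbation.tderiv^[n] P).massσ k t := by
  unfold Perturbation.massσ LinGrav.massσ
  refine halfPlaneIntegral_congr fun ρ _ z => ?_
  have hp : dt^[k] (Perturbation.tderiv^[n] P).p t ρ z = dt^[k + n] P.p t ρ z := by
    rw [Function.iterate_add_apply]
    exact iterate_dt_congr hI (fun s hs => hP.p_iterate_tderiv hI n hs ρ z) k ht
  rw [hp, iterate_tderiv_eq]
  simp only [Function.iterate_add_apply]

end Perturbation

/-! ### The twist -/

/-- A smooth field that is `O(ρⁿ)` at the axis is `ρⁿ` times a smooth field. -/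
theorem IsSmooth.exists_eq_rho_pow_mul (hI : IsOpen I) (n : ℕ) (hf : IsSmooth I f)
    (h : ∀ t ∈ I, ∀ z, (fun ρ => f t ρ z / ρ ^ n) =O[𝓝[>] 0] (fun _ => (1 : ℝ))) :
    ∃ g : Field, IsSmooth I g ∧ ∀ t ∈ I, ∀ ρ z, f t ρ z = ρ ^ n * g t ρ z := by
  induction n generalizing f with
  | zero => exact ⟨f, hf, by simp⟩
  | succ n ih =>
    have h0 : ∀ t ∈ I, ∀ z, f t 0 z = 0 := by
      intro t ht z
      have hpow : Tendsto (fun ρ : ℝ => ρ ^ (n + 1)) (𝓝[>] 0) (𝓝 0) := by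
        have : Tendsto (fun ρ : ℝ => ρ ^ (n + 1)) (𝓝 0) (𝓝 (0 ^ (n + 1))) :=
          (continuous_pow (n + 1)).tendsto 0
        rw [zero_pow (by omega)] at this
        exact this.mono_left nhdsWithin_le_nhds
      have h1 := (h t ht z).mul_isLittleO ((Asymptotics.isLittleO_one_iff ℝ).2 hpow)
      simp only [mul_one] at h1
      have h2 := (Asymptotics.isLittleO_one_iff ℝ).1 h1
      have h3 : Tendsto (fun ρ => f t ρ z) (𝓝[>] 0) (𝓝 (f t 0 z)) :=
        ((hf.hasDerivAt_dρ hI ht 0 z).continuousAt.tendsto).mono_left nhdsWithin_le_nhds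
      refine tendsto_nhds_unique h3 (h2.congr' ?_)
      filter_upwards [self_mem_nhdsWithin] with ρ hρ
      exact div_mul_cancel₀ _ (pow_pos hρ _).ne'
    obtain ⟨g, hg, hfg⟩ := hf.exists_eq_rho_mul hI h0
    obtain ⟨k, hk, hgk⟩ := ih hg (fun t ht z => by
      refine (h t ht z).congr' ?_ (EventuallyEq.refl _ _)
      filter_upwards [self_mem_nhdsWithin] with ρ hρ
      rw [hfg t ht, pow_succ']
      exact mul_div_mul_left _ _ (ne_of_gt hρ))
    refine ⟨k, hk, fun t ht ρ z => ?_⟩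
    rw [hfg t ht, hgk t ht]; ring

/-- By axis regularity of the twist, `ω / ρ⁴` is smooth across the axis and even. -/
theorem exists_smooth_twist {P : Perturbation} (hI : IsOpen I) (hP : P.IsSolution I)
    (hA : P.AxisRegular I) (hT : P.TwistConditions I) :
    ∃ v : Field, IsSmooth I v ∧ IsEven I v ∧ ∀ t ∈ I, ∀ ρ z, P.ω t ρ z = ρ ^ 4 * v t ρ z := by
  obtain ⟨v, hv, h⟩ := hP.smooth_ω.exists_eq_rho_pow_mul hI 4 (fun t ht z => (hT.axis t ht z).1)
  refine ⟨v, hv, fun t ht ρ z => ?_, h⟩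
  rcases eq_or_ne ρ 0 with rfl | hρ
  · rw [neg_zero]
  · have h1 := hA.even_ω t ht ρ z
    rw [h t ht, h t ht, Even.neg_pow (by decide)] at h1
    exact mul_left_cancel₀ (pow_ne_zero 4 hρ) h1

section Twist

variable {w v : Field}

theorem dt_twist (hI : IsOpen I) (hv : IsSmooth I v)
    (h : ∀ t ∈ I, ∀ ρ z, w t ρ z = ρ ^ 4 * v t ρ z) (ht : t ∈ I) (ρ z : ℝ) :
    dt w t ρ z = ρ ^ 4 * dt v t ρ z :=
  (dt_congr (g := fun t ρ z => ρ ^ 4 * v t ρ z) hI (fun t ht => h t ht ρ z) ht).trans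
    ((hv.hasDerivAt_dt hI ht ρ z).const_mul (ρ ^ 4)).deriv

theorem iterate_dt_twist (hI : IsOpen I) (hv : IsSmooth I v)
    (h : ∀ t ∈ I, ∀ ρ z, w t ρ z = ρ ^ 4 * v t ρ z) (n : ℕ) :
    ∀ t ∈ I, ∀ ρ z, dt^[n] w t ρ z = ρ ^ 4 * dt^[n] v t ρ z := by
  induction n with
  | zero => exact h
  | succ n ih =>
    simp only [Function.iterate_succ_apply']
    exact fun t ht ρ z => dt_twist hI (hv.iterate_dt hI n) ih ht ρ z

theorem dz_twist (hI : IsOpen I) (hv : IsSmooth I v)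
    (h : ∀ t ∈ I, ∀ ρ z, w t ρ z = ρ ^ 4 * v t ρ z) (ht : t ∈ I) (ρ z : ℝ) :
    dz w t ρ z = ρ ^ 4 * dz v t ρ z :=
  (dz_congr (g := fun t ρ z => ρ ^ 4 * v t ρ z) (fun z => h t ht ρ z)).trans
    ((hv.hasDerivAt_dz hI ht ρ z).const_mul (ρ ^ 4)).deriv

theorem dρ_twist (hI : IsOpen I) (hv : IsSmooth I v)
    (h : ∀ t ∈ I, ∀ ρ z, w t ρ z = ρ ^ 4 * v t ρ z) (ht : t ∈ I) (ρ z : ℝ) :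
    dρ w t ρ z = ρ ^ 3 * (4 * v t ρ z + ρ * dρ v t ρ z) := by
  refine ((dρ_congr (g := fun t ρ z => ρ ^ 4 * v t ρ z) (fun ρ => h t ht ρ z)).trans
    ((hasDerivAt_pow 4 ρ).mul (hv.hasDerivAt_dρ hI ht ρ z)).deriv).trans ?_
  norm_num; ring

/-- `ω / ρ⁴` satisfies the axisymmetric wave equation in seven space dimensions. -/
theorem twist_wave (hI : IsOpen I) (hv : IsSmooth I v)
    (h : ∀ t ∈ I, ∀ ρ z, w t ρ z = ρ ^ 4 * v t ρ z)
    (hw : ∀ t ∈ I, ∀ ρ > 0, ∀ z, -dt (dt w) t ρ z + lap3 w t ρ z = 4 * dρ w t ρ z / ρ)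
    (ht : t ∈ I) (hρ : 0 < ρ) (z : ℝ) :
    dt (dt v) t ρ z = dρ (dρ v) t ρ z + dz (dz v) t ρ z + 5 * dρ v t ρ z / ρ := by
  have e1 := dt_twist hI (hv.dt hI) (fun t ht ρ z => dt_twist hI hv h ht ρ z) ht ρ z
  have e2 : dz (dz w) t ρ z = ρ ^ 4 * dz (dz v) t ρ z :=
    dz_twist hI (hv.dz hI) (fun t ht ρ z => dz_twist hI hv h ht ρ z) ht ρ z
  have e3 : dρ (dρ w) t ρ z = _ :=
    (dρ_congr (g := fun t ρ z => ρ ^ 3 * (4 * v t ρ z + ρ * dρ v t ρ z))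
      (fun ρ => dρ_twist hI hv h ht ρ z)).trans
    ((hasDerivAt_pow 3 ρ).mul (((hv.hasDerivAt_dρ hI ht ρ z).const_mul 4).add
      ((hasDerivAt_id ρ).mul ((hv.dρ hI).hasDerivAt_dρ hI ht ρ z)))).deriv
  have hw' := hw t ht ρ hρ z
  rw [lap3, lap, e1, e2, e3, dρ_twist hI hv h ht] at hw'
  have hρ' : ρ ≠ 0 := hρ.ne'
  simp only [Nat.cast_ofNat, Nat.reduceSub, id, one_mul, Pi.add_apply, Pi.mul_apply] at hw'
  field_simp at hw' ⊢
  refine mul_left_cancel₀ hρ' ?_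
  linear_combination -hw'

/-- The energy density of `ω / ρ⁴` with respect to the seven-dimensional flat measure. -/
noncomputable def barDensity (v : Field) : Field := fun t ρ z =>
  2 * (dt v t ρ z ^ 2 + gradSq v t ρ z) * ρ ^ 5

/-- The energy density of `ω` in terms of `v = ω / ρ⁴`. -/
noncomputable def twistDensity (v : Field) : Field := fun t ρ z =>
  2 * ρ ^ 5 * dt v t ρ z ^ 2 + 2 * ρ ^ 3 * (4 * v t ρ z + ρ * dρ v t ρ z) ^ 2
    + 2 * ρ ^ 5 * dz v t ρ z ^ 2

theorem isSmooth_barDensity (hI : IsOpen I) (hv : IsSmooth I v) : IsSmooth I (barDensity v) :=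
  (((isSmooth_const 2).mul (((hv.dt hI).pow 2).add (((hv.dρ hI).pow 2).add ((hv.dz hI).pow 2)))).mul
    (isSmooth_rho.pow 5))

theorem isSmooth_rho_pow_mul (c : ℝ) (n : ℕ) : IsSmooth I (fun _ ρ _ => c * ρ ^ n) :=
  (isSmooth_const c).mul (isSmooth_rho.pow n)

theorem isSmooth_twist_dρ (hI : IsOpen I) (hv : IsSmooth I v) :
    IsSmooth I (fun t ρ z => 4 * v t ρ z + ρ * dρ v t ρ z) :=
  ((isSmooth_const 4).mul hv).add (isSmooth_rho.mul (hv.dρ hI))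

theorem isSmooth_twistDensity (hI : IsOpen I) (hv : IsSmooth I v) : IsSmooth I (twistDensity v) :=
  (((isSmooth_rho_pow_mul 2 5).mul ((hv.dt hI).pow 2)).add
    ((isSmooth_rho_pow_mul 2 3).mul ((isSmooth_twist_dρ hI hv).pow 2))).add
    ((isSmooth_rho_pow_mul 2 5).mul ((hv.dz hI).pow 2))

theorem barDensity_nonneg (hρ : 0 < ρ) : 0 ≤ barDensity v t ρ z := by
  unfold barDensity gradSq; positivity

theorem twistDensity_nonneg (hρ : 0 < ρ) : 0 ≤ twistDensity v t ρ z := by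
  unfold twistDensity; positivity

/-- The weight `ρ⁻³` in `m_ω` is singular on the axis; in terms of `v = ω / ρ⁴` the density is
smooth. -/
theorem massω_eq_twist (hI : IsOpen I) (hv : IsSmooth I v)
    (h : ∀ t ∈ I, ∀ ρ z, w t ρ z = ρ ^ 4 * v t ρ z) (ht : t ∈ I) :
    massω w t = halfPlaneIntegral (twistDensity v) t := by
  refine halfPlaneIntegral_congr fun ρ hρ z => ?_
  rw [gradSq, dt_twist hI hv h ht, dρ_twist hI hv h ht, dz_twist hI hv h ht, twistDensity]
  field_simp
  ring

theorem massωbar_eq (hI : IsOpen I) {u : Field} (h : ∀ t ∈ I, ∀ ρ > 0, ∀ z, u t ρ z = v t ρ z)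
    (ht : t ∈ I) : massωbar u t = halfPlaneIntegral (barDensity v) t := by
  refine halfPlaneIntegral_congr fun ρ hρ z => ?_
  rw [barDensity, gradSq, gradSq, dt_congr hI (fun t ht => h t ht ρ hρ z) ht,
    dρ_congr_pos (fun ρ hρ => h t ht ρ hρ z) hρ, dz_congr (fun z => h t ht ρ hρ z)]

/-- The energy flux of `v` is `4 ρ⁵ ∂ₜv ∂v`, bounded by the density. -/
theorem barDensity_conserved (hI : IsOpen I) (hc : I.OrdConnected) (hv : IsSmooth I v)
    (hw : ∀ t ∈ I, ∀ ρ > 0, ∀ z,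
      dt (dt v) t ρ z = dρ (dρ v) t ρ z + dz (dz v) t ρ z + 5 * dρ v t ρ z / ρ) :
    ∀ s ∈ I, ∀ t ∈ I, halfPlaneIntegral (barDensity v) s = halfPlaneIntegral (barDensity v) t := by
  have hF : IsSmooth I (fun t ρ z => 4 * ρ ^ 5 * (dt v t ρ z * dρ v t ρ z)) :=
    (isSmooth_rho_pow_mul 4 5).mul ((hv.dt hI).mul (hv.dρ hI))
  have hG : IsSmooth I (fun t ρ z => 4 * ρ ^ 5 * (dt v t ρ z * dz v t ρ z)) :=
    (isSmooth_rho_pow_mul 4 5).mul ((hv.dt hI).mul (hv.dz hI))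
  refine halfPlaneIntegral_conserved hI hc (isSmooth_barDensity hI hv) hF hG
    (isSmooth_const 0) (isSmooth_const 0) (fun t _ ρ hρ z => barDensity_nonneg hρ) ?_ ?_ ?_ ?_
  · intro t ht ρ hρ z
    have e1 : dt (barDensity v) t ρ z = _ :=
      (((((((hv.dt hI).hasDerivAt_dt hI ht ρ z).pow 2).add
        ((((hv.dρ hI).hasDerivAt_dt hI ht ρ z).pow 2).add
        (((hv.dz hI).hasDerivAt_dt hI ht ρ z).pow 2)))).const_mul 2).mul_const (ρ ^ 5)).deriv
    have e2 : dρ (fun t ρ z => 4 * ρ ^ 5 * (dt v t ρ z * dρ v t ρ z) + 0) t ρ z = _ :=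
      ((((hasDerivAt_pow 5 ρ).const_mul 4).mul (((hv.dt hI).hasDerivAt_dρ hI ht ρ z).mul
        ((hv.dρ hI).hasDerivAt_dρ hI ht ρ z))).add_const 0).deriv
    have e3 : dz (fun t ρ z => 4 * ρ ^ 5 * (dt v t ρ z * dz v t ρ z) + 0) t ρ z = _ :=
      (((((hv.dt hI).hasDerivAt_dz hI ht ρ z).mul
        ((hv.dz hI).hasDerivAt_dz hI ht ρ z)).const_mul (4 * ρ ^ 5)).add_const 0).deriv
    rw [e1, e2, e3, hw t ht ρ hρ z, hv.dρ_dt hI ht, hv.dz_dt hI ht]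
    simp only [Pi.mul_apply]
    field_simp
    push_cast
    ring
  · intro t ht z; simp
  · intro t ht ρ hρ z
    have := sq_nonneg (dt v t ρ z ^ 2 - (dρ v t ρ z ^ 2 + dz v t ρ z ^ 2))
    have h2 := mul_nonneg (by positivity : (0 : ℝ) ≤ 4 * ρ ^ 10) this
    unfold barDensity gradSq
    nlinarith
  · intro K _ _ T _ δ hδ
    exact ⟨0, fun R _ s κ t _ _ _ => by simpa [boxInt] using hδ.le⟩

/-- Conservation of the energy of `ω`, with flux `4 ρ⁻³ ∂ₜω ∂ω` written in terms of `v`. This does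
not follow from `barDensity_conserved`, since no decay is assumed for `∂ₜⁿv` with
`n ≥ 2`, so that the two energies of such a derivative are not known to agree. -/
theorem twistDensity_conserved (hI : IsOpen I) (hc : I.OrdConnected) (hv : IsSmooth I v)
    (hw : ∀ t ∈ I, ∀ ρ > 0, ∀ z,
      dt (dt v) t ρ z = dρ (dρ v) t ρ z + dz (dz v) t ρ z + 5 * dρ v t ρ z / ρ) :
    ∀ s ∈ I, ∀ t ∈ I,
      halfPlaneIntegral (twistDensity v) s = halfPlaneIntegral (twistDensity v) t := by
  have hF : IsSmooth I (fun t ρ z =>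
      4 * ρ ^ 4 * (dt v t ρ z * (4 * v t ρ z + ρ * dρ v t ρ z))) :=
    (isSmooth_rho_pow_mul 4 4).mul ((hv.dt hI).mul (isSmooth_twist_dρ hI hv))
  have hG : IsSmooth I (fun t ρ z => 4 * ρ ^ 5 * (dt v t ρ z * dz v t ρ z)) :=
    (isSmooth_rho_pow_mul 4 5).mul ((hv.dt hI).mul (hv.dz hI))
  refine halfPlaneIntegral_conserved hI hc (isSmooth_twistDensity hI hv) hF hG
    (isSmooth_const 0) (isSmooth_const 0) (fun t _ ρ hρ z => twistDensity_nonneg hρ) ?_ ?_ ?_ ?_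
  · intro t ht ρ hρ z
    have e1 : dt (twistDensity v) t ρ z = _ :=
      (((((((hv.dt hI).hasDerivAt_dt hI ht ρ z).pow 2)).const_mul (2 * ρ ^ 5)).add
        ((((((hv.hasDerivAt_dt hI ht ρ z).const_mul 4).add
          (((hv.dρ hI).hasDerivAt_dt hI ht ρ z).const_mul ρ)).pow 2)).const_mul (2 * ρ ^ 3))).add
        ((((hv.dz hI).hasDerivAt_dt hI ht ρ z).pow 2).const_mul (2 * ρ ^ 5))).deriv
    have e2 : dρ (fun t ρ z => 4 * ρ ^ 4 * (dt v t ρ z * (4 * v t ρ z + ρ * dρ v t ρ z)) + 0) t ρ z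
        = _ :=
      ((((hasDerivAt_pow 4 ρ).const_mul 4).mul (((hv.dt hI).hasDerivAt_dρ hI ht ρ z).mul
        (((hv.hasDerivAt_dρ hI ht ρ z).const_mul 4).add
          ((hasDerivAt_id ρ).mul ((hv.dρ hI).hasDerivAt_dρ hI ht ρ z))))).add_const 0).deriv
    have e3 : dz (fun t ρ z => 4 * ρ ^ 5 * (dt v t ρ z * dz v t ρ z) + 0) t ρ z = _ :=
      (((((hv.dt hI).hasDerivAt_dz hI ht ρ z).mul
        ((hv.dz hI).hasDerivAt_dz hI ht ρ z)).const_mul (4 * ρ ^ 5)).add_const 0).deriv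
    rw [e1, e2, e3, hw t ht ρ hρ z, hv.dρ_dt hI ht, hv.dz_dt hI ht]
    simp only [id, Pi.add_apply, Pi.mul_apply]
    field_simp
    push_cast
    ring
  · intro t ht z; simp
  · intro t ht ρ hρ z
    unfold twistDensity
    generalize 4 * v t ρ z + ρ * dρ v t ρ z = y
    have := sq_nonneg (ρ ^ 2 * dt v t ρ z ^ 2 - (y ^ 2 + ρ ^ 2 * dz v t ρ z ^ 2))
    have h2 := mul_nonneg (by positivity : (0 : ℝ) ≤ 4 * ρ ^ 6) this
    nlinarith
  · intro K _ _ T _ δ hδ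
    exact ⟨0, fun R _ s κ t _ _ _ => by simpa [boxInt] using hδ.le⟩

/-- The two energy densities of the twist differ by an exact `ρ`-derivative. -/
theorem boxInt_twistDensity (hI : IsOpen I) (hv : IsSmooth I v) (ht : t ∈ I) (hL : 0 ≤ L) :
    boxInt L (twistDensity v) t =
      boxInt L (barDensity v) t + ∫ z in (-L)..L, 8 * L ^ 4 * v t L z ^ 2 := by
  have hX : IsSmooth I (fun t ρ z => 8 * ρ ^ 4 * v t ρ z ^ 2) :=
    (isSmooth_rho_pow_mul 8 4).mul (hv.pow 2)
  have h0 := boxInt_div_eq hI hX (isSmooth_const 0) ht hL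
  have h1 : boxInt L (twistDensity v) t = boxInt L (fun t ρ z => barDensity v t ρ z
      + (dρ (fun t ρ z => 8 * ρ ^ 4 * v t ρ z ^ 2) t ρ z + dz (fun _ _ _ => 0) t ρ z)) t := by
    refine boxInt_congr fun x hx => ?_
    have e1 : dρ (fun t ρ z => 8 * ρ ^ 4 * v t ρ z ^ 2) t x.1 x.2 = _ :=
      (((hasDerivAt_pow 4 x.1).const_mul 8).mul ((hv.hasDerivAt_dρ hI ht x.1 x.2).pow 2)).deriv
    have e2 : dz (fun _ _ _ => (0 : ℝ)) t x.1 x.2 = 0 := deriv_const _ _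
    rw [e1, e2, twistDensity, barDensity, gradSq]
    simp only [Pi.pow_apply]
    push_cast
    ring
  rw [h1, boxInt_add hI (isSmooth_barDensity hI hv) ((hX.dρ hI).add ((isSmooth_const 0).dz hI)) ht,
    h0]
  simp

/-- Hardy's inequality in the form needed here: the boundary term has a sign. -/
theorem barIntegral_le_twistIntegral (hI : IsOpen I) (hv : IsSmooth I v) (ht : t ∈ I) :
    halfPlaneIntegral (barDensity v) t ≤ halfPlaneIntegral (twistDensity v) t := by
  refine halfPlaneIntegral_le hI (isSmooth_barDensity hI hv) ht
    (fun ρ hρ z => barDensity_nonneg hρ) fun L hL => ?_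
  refine le_trans (ENNReal.ofReal_le_ofReal ?_) (ofReal_boxInt_le hI (isSmooth_twistDensity hI hv)
    ht (fun ρ hρ z => twistDensity_nonneg hρ) L)
  rw [boxInt_twistDensity hI hv ht hL.le]
  have : 0 ≤ ∫ z in (-L)..L, 8 * L ^ 4 * v t L z ^ 2 :=
    intervalIntegral.integral_nonneg (by linarith) fun z _ => by positivity
  linarith

/-- The boundary term `∫ 8 L⁴ v²` over `|z| ≤ L` is `L⁵ o(L⁻⁵)`, hence the energies agree. -/
theorem twistIntegral_eq_barIntegral (hI : IsOpen I) (hv : IsSmooth I v) (ht : t ∈ I)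
    (hdecay : ∀ ε > 0, ∃ R : ℝ, ∀ ρ > 0, ∀ z, R ≤ √(ρ ^ 2 + z ^ 2) →
      |v t ρ z| ≤ ε * √(ρ ^ 2 + z ^ 2) ^ (-5 / 2 : ℝ)) :
    halfPlaneIntegral (twistDensity v) t = halfPlaneIntegral (barDensity v) t := by
  refine le_antisymm ?_ (barIntegral_le_twistIntegral hI hv ht)
  refine halfPlaneIntegral_le hI (isSmooth_twistDensity hI hv) ht
    (fun ρ hρ z => twistDensity_nonneg hρ) fun L hL => ?_
  refine ENNReal.le_of_forall_pos_le_add fun ε hε _ => ?_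
  have hε' : (0 : ℝ) < ε := hε
  -- with this constant the boundary integral is at most `2 L' * 8 L'⁴ * (ε / 16) L'⁻⁵ = ε`
  obtain ⟨R, hR⟩ := hdecay (√(ε / 16)) (by positivity)
  set L' := max L R
  have hL' : 0 < L' := hL.trans_le (le_max_left _ _)
  have hb : ∫ z in (-L')..L', 8 * L' ^ 4 * v t L' z ^ 2 ≤ (ε : ℝ) := by
    have hpt : ∀ z ∈ Icc (-L') L', 8 * L' ^ 4 * v t L' z ^ 2 ≤ ε / (2 * L') := by
      intro z _
      have hr : L' ≤ √(L' ^ 2 + z ^ 2) := Real.le_sqrt_of_sq_le (by nlinarith [sq_nonneg z])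
      have h1 := hR L' hL' z ((le_max_right _ _).trans hr)
      have h2 : √(L' ^ 2 + z ^ 2) ^ (-5 / 2 : ℝ) ≤ L' ^ (-5 / 2 : ℝ) :=
        Real.rpow_le_rpow_of_nonpos hL' hr (by norm_num)
      have h3 : |v t L' z| ≤ √(ε / 16) * L' ^ (-5 / 2 : ℝ) := h1.trans (by gcongr)
      have h4 : v t L' z ^ 2 ≤ ε / 16 * (L' ^ 5)⁻¹ := by
        rw [← sq_abs]
        calc |v t L' z| ^ 2 ≤ (√(ε / 16) * L' ^ (-5 / 2 : ℝ)) ^ 2 := by gcongr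
          _ = ε / 16 * (L' ^ 5)⁻¹ := by
            rw [mul_pow, Real.sq_sqrt (by positivity), ← Real.rpow_natCast (L' ^ (-5 / 2 : ℝ)),
              ← Real.rpow_mul hL'.le, ← Real.rpow_natCast L' 5, ← Real.rpow_neg hL'.le]
            norm_num
      calc 8 * L' ^ 4 * v t L' z ^ 2 ≤ 8 * L' ^ 4 * (ε / 16 * (L' ^ 5)⁻¹) := by gcongr
        _ = ε / (2 * L') := by field_simp; ring
    have hcont : Continuous fun z => 8 * L' ^ 4 * v t L' z ^ 2 :=
      continuous_const.mul (((hv.continuous_space hI ht).comp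
        (by fun_prop : Continuous fun z : ℝ => (L', z))).pow 2)
    calc _ ≤ ∫ _ in (-L')..L', ε / (2 * L') :=
          intervalIntegral.integral_mono_on (by linarith) (hcont.intervalIntegrable _ _)
            (by simp) hpt
      _ = ε := by
          rw [intervalIntegral.integral_const, smul_eq_mul]; field_simp; ring
  have h1 : boxInt L (twistDensity v) t ≤ boxInt L' (barDensity v) t + ε := by
    refine (boxInt_mono_set hI (isSmooth_twistDensity hI hv) ht (le_max_left L R)
      (fun x hx => twistDensity_nonneg hx.1.1)).trans ?_
    rw [boxInt_twistDensity hI hv ht hL'.le]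
    linarith
  calc ENNReal.ofReal (boxInt L (twistDensity v) t)
      ≤ ENNReal.ofReal (boxInt L' (barDensity v) t + ε) := ENNReal.ofReal_le_ofReal h1
    _ ≤ ENNReal.ofReal (boxInt L' (barDensity v) t) + ENNReal.ofReal ε := ENNReal.ofReal_add_le
    _ ≤ _ := by
        rw [ENNReal.ofReal_coe_nnreal]
        gcongr
        exact ofReal_boxInt_le hI (isSmooth_barDensity hI hv) ht
          (fun ρ hρ z => barDensity_nonneg hρ) _

end Twist

end LinGrav

namespace LinGrav

variable {I : Set ℝ} {f g : Field} {t ρ z L : ℝ}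

/-! ### Decay at infinity -/

/-- The filter of points of the closed half plane going to infinity, with times in `K`. -/
noncomputable def farFilter (K : Set ℝ) : Filter (ℝ × ℝ × ℝ) :=
  comap (fun x => √(x.2.1 ^ 2 + x.2.2 ^ 2)) atTop ⊓ 𝓟 {x | x.1 ∈ K ∧ 0 ≤ x.2.1}

theorem eventually_farFilter {K : Set ℝ} {p : ℝ × ℝ × ℝ → Prop} :
    (∀ᶠ x in farFilter K, p x) ↔ ∃ R : ℝ, ∀ t ∈ K, ∀ ρ ≥ 0, ∀ z,
      R ≤ √(ρ ^ 2 + z ^ 2) → p (t, ρ, z) := by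
  rw [farFilter, eventually_inf_principal, eventually_comap, eventually_atTop]
  constructor
  · rintro ⟨R, hR⟩
    exact ⟨R, fun t ht ρ hρ z h => hR _ h (t, ρ, z) rfl ⟨ht, hρ⟩⟩
  · rintro ⟨R, hR⟩
    exact ⟨R, fun r hr x hx h => hR x.1 h.1 x.2.1 h.2 x.2.2 (hx ▸ hr)⟩

/-- The weight `r ^ (-1/2)`. -/
noncomputable def farWeight (x : ℝ × ℝ × ℝ) : ℝ := √(x.2.1 ^ 2 + x.2.2 ^ 2) ^ (-1 / 2 : ℝ)

theorem farWeight_nonneg (x : ℝ × ℝ × ℝ) : 0 ≤ farWeight x := Real.rpow_nonneg (Real.sqrt_nonneg _) _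

theorem farWeight_mul_self (t ρ z : ℝ) (h : 0 < √(ρ ^ 2 + z ^ 2)) :
    farWeight (t, ρ, z) * farWeight (t, ρ, z) = (√(ρ ^ 2 + z ^ 2))⁻¹ := by
  rw [farWeight, ← Real.rpow_add h, ← Real.rpow_neg_one]
  norm_num

/-- `f = o(r ^ (-1/2))` on the closed half plane, locally uniformly in time. -/
def Decays (I : Set ℝ) (f : Field) : Prop :=
  ∀ K ⊆ I, IsCompact K → unc f =o[farFilter K] farWeight

/-- `f = o(r⁻¹)` on the closed half plane, locally uniformly in time. -/
def Decays2 (I : Set ℝ) (f : Field) : Prop :=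
  ∀ K ⊆ I, IsCompact K → unc f =o[farFilter K] fun x => farWeight x * farWeight x

theorem Decays.mul (hf : Decays I f) (hg : Decays I g) :
    Decays2 I (fun t ρ z => f t ρ z * g t ρ z) := fun K hK hc =>
  (hf K hK hc).mul (hg K hK hc)

theorem Decays2.add (hf : Decays2 I f) (hg : Decays2 I g) :
    Decays2 I (fun t ρ z => f t ρ z + g t ρ z) := fun K hK hc =>
  (hf K hK hc).add (hg K hK hc)

theorem Decays2.const_mul (hf : Decays2 I f) (c : ℝ) :
    Decays2 I (fun t ρ z => c * f t ρ z) := fun K hK hc =>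
  (hf K hK hc).const_mul_left c

theorem Decays.add (hf : Decays I f) (hg : Decays I g) :
    Decays I (fun t ρ z => f t ρ z + g t ρ z) := fun K hK hc =>
  (hf K hK hc).add (hg K hK hc)

theorem Decays.sub (hf : Decays I f) (hg : Decays I g) :
    Decays I (fun t ρ z => f t ρ z - g t ρ z) := fun K hK hc =>
  (hf K hK hc).sub (hg K hK hc)

theorem Decays.const_mul (hf : Decays I f) (c : ℝ) :
    Decays I (fun t ρ z => c * f t ρ z) := fun K hK hc =>
  (hf K hK hc).const_mul_left c

theorem Decays.congr (hf : Decays I f) (h : ∀ t ∈ I, ∀ ρ ≥ 0, ∀ z, g t ρ z = f t ρ z) :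
    Decays I g := fun K hK hc => by
  refine (hf K hK hc).congr' ?_ (EventuallyEq.refl _ _)
  exact eventually_farFilter.2 ⟨0, fun t ht ρ hρ z _ => (h t (hK ht) ρ hρ z).symm⟩

/-- By continuity it suffices to estimate a smooth field off the axis. -/
theorem IsSmooth.decays_of_pos (hI : IsOpen I) (hf : IsSmooth I f)
    (h : ∀ K ⊆ I, IsCompact K → ∀ ε > 0, ∃ R : ℝ, ∀ t ∈ K, ∀ ρ > 0, ∀ z, R ≤ √(ρ ^ 2 + z ^ 2) →
      |f t ρ z| ≤ ε * √(ρ ^ 2 + z ^ 2) ^ (-1 / 2 : ℝ)) : Decays I f := by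
  intro K hK hc
  refine Asymptotics.isLittleO_iff.2 fun ε hε => ?_
  obtain ⟨R, hR⟩ := h K hK hc ε hε
  refine eventually_farFilter.2 ⟨max R 1, fun t ht ρ hρ z hr => ?_⟩
  rw [Real.norm_eq_abs, Real.norm_of_nonneg (farWeight_nonneg _)]
  rcases hρ.lt_or_eq with hρ | rfl
  · exact hR t ht ρ hρ z ((le_max_left _ _).trans hr)
  have hr1 : 1 ≤ √((0 : ℝ) ^ 2 + z ^ 2) := (le_max_right _ _).trans hr
  have hlim : Tendsto (fun ρ => |f t ρ z|) (𝓝[>] 0) (𝓝 |f t 0 z|) :=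
    (((hf.hasDerivAt_dρ hI (hK ht) 0 z).continuousAt.abs).tendsto).mono_left nhdsWithin_le_nhds
  have hlim2 : Tendsto (fun ρ : ℝ => ε * √(ρ ^ 2 + z ^ 2) ^ (-1 / 2 : ℝ)) (𝓝[>] 0)
      (𝓝 (ε * √((0 : ℝ) ^ 2 + z ^ 2) ^ (-1 / 2 : ℝ))) := by
    have : ContinuousAt (fun ρ : ℝ => ε * √(ρ ^ 2 + z ^ 2) ^ (-1 / 2 : ℝ)) 0 := by
      refine continuousAt_const.mul (ContinuousAt.rpow_const (by fun_prop) (Or.inl ?_))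
      positivity
    exact this.tendsto.mono_left nhdsWithin_le_nhds
  refine le_of_tendsto_of_tendsto hlim hlim2 ?_
  filter_upwards [self_mem_nhdsWithin] with ρ hρ
  refine hR t ht ρ hρ z (((le_max_left _ _).trans hr).trans (Real.sqrt_le_sqrt ?_))
  nlinarith [sq_nonneg ρ]

theorem rpow_le_farWeight {r : ℝ} (hr : 1 ≤ r) : r ^ (-1 / 2 - 1 : ℝ) ≤ r ^ (-1 / 2 : ℝ) :=
  Real.rpow_le_rpow_of_exponent_le hr (by norm_num)

theorem LittleO1.decays (hI : IsOpen I) (hf : IsSmooth I f) (h : LittleO1 I (-1 / 2) f) :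
    Decays I f :=
  hf.decays_of_pos hI fun K hK hc ε hε => by
    obtain ⟨R, hR⟩ := h K hK hc ε hε
    exact ⟨R, fun t ht ρ hρ z hr => (hR t ht ρ hρ z hr).1⟩

theorem LittleO1.decays_dρ (hI : IsOpen I) (hf : IsSmooth I f) (h : LittleO1 I (-1 / 2) f) :
    Decays I (dρ f) :=
  (hf.dρ hI).decays_of_pos hI fun K hK hc ε hε => by
    obtain ⟨R, hR⟩ := h K hK hc ε hε
    refine ⟨max R 1, fun t ht ρ hρ z hr => ?_⟩
    refine (hR t ht ρ hρ z ((le_max_left _ _).trans hr)).2.1.trans ?_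
    exact mul_le_mul_of_nonneg_left (rpow_le_farWeight ((le_max_right _ _).trans hr)) hε.le

theorem LittleO1.decays_dz (hI : IsOpen I) (hf : IsSmooth I f) (h : LittleO1 I (-1 / 2) f) :
    Decays I (dz f) :=
  (hf.dz hI).decays_of_pos hI fun K hK hc ε hε => by
    obtain ⟨R, hR⟩ := h K hK hc ε hε
    refine ⟨max R 1, fun t ht ρ hρ z hr => ?_⟩
    refine (hR t ht ρ hρ z ((le_max_left _ _).trans hr)).2.2.trans ?_
    exact mul_le_mul_of_nonneg_left (rpow_le_farWeight ((le_max_right _ _).trans hr)) hε.le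

/-- If `f = ρ g` falls off then so does `g`: away from the axis `g` is smaller than `f`, and near
the axis it is a mean value of `∂ρ f`. -/
theorem LittleO1.decays_div_rho (hI : IsOpen I) (hf : IsSmooth I f) (hg : IsSmooth I g)
    (hfg : ∀ t ∈ I, ∀ ρ z, f t ρ z = ρ * g t ρ z) (h : LittleO1 I (-1 / 2) f) : Decays I g :=
  hg.decays_of_pos hI fun K hK hc ε hε => by
    obtain ⟨R, hR⟩ := h K hK hc (ε / 2) (by positivity)
    refine ⟨max (4 * R) 4, fun t ht ρ hρ z hr => ?_⟩
    have hr4 : 4 ≤ √(ρ ^ 2 + z ^ 2) := (le_max_right _ _).trans hr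
    have hrR : 4 * R ≤ √(ρ ^ 2 + z ^ 2) := (le_max_left _ _).trans hr
    set r := √(ρ ^ 2 + z ^ 2) with hrdef
    have hg' : |g t ρ z| = |f t ρ z| / ρ := by
      rw [hfg t (hK ht), abs_mul, abs_of_pos hρ, mul_div_cancel_left₀ _ hρ.ne']
    rw [hg', div_le_iff₀ hρ]
    have hw : 0 ≤ r ^ (-1 / 2 : ℝ) := Real.rpow_nonneg (Real.sqrt_nonneg _) _
    rcases le_or_gt 1 ρ with h1 | h1
    · calc |f t ρ z| ≤ ε / 2 * r ^ (-1 / 2 : ℝ) := (hR t ht ρ hρ z (by linarith)).1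
        _ ≤ ε * r ^ (-1 / 2 : ℝ) * 1 := by rw [mul_one]; gcongr; linarith
        _ ≤ ε * r ^ (-1 / 2 : ℝ) * ρ := by gcongr
    · have hzr : r / 4 ≤ |z| := by
        have : r ≤ ρ + |z| := by
          refine Real.sqrt_le_iff.2 ⟨by positivity, ?_⟩
          nlinarith [sq_abs z, abs_nonneg z]
        linarith
      obtain ⟨ξ, hξ, hd⟩ := exists_hasDerivAt_eq_slope (fun s => f t s z) (fun s => dρ f t s z) hρ
        (fun s _ => (hf.hasDerivAt_dρ hI (hK ht) s z).continuousAt.continuousWithinAt)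
        (fun s _ => hf.hasDerivAt_dρ hI (hK ht) s z)
      have hf0 : f t 0 z = 0 := by rw [hfg t (hK ht), zero_mul]
      rw [hf0, sub_zero, sub_zero, eq_div_iff hρ.ne'] at hd
      rw [← hd, abs_mul, abs_of_pos hρ]
      refine mul_le_mul_of_nonneg_right ?_ hρ.le
      have hrξ : r / 4 ≤ √(ξ ^ 2 + z ^ 2) := hzr.trans (Real.abs_le_sqrt (by nlinarith [sq_nonneg ξ]))
      have e4 : (r / 4) ^ (-1 / 2 : ℝ) = 2 * r ^ (-1 / 2 : ℝ) := by
        rw [Real.div_rpow (by linarith) (by norm_num), show (4 : ℝ) = 2 ^ (2 : ℝ) by norm_num,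
          ← Real.rpow_mul (by norm_num)]
        norm_num [Real.rpow_neg_one]
        ring
      calc |dρ f t ξ z| ≤ ε / 2 * √(ξ ^ 2 + z ^ 2) ^ (-1 / 2 - 1 : ℝ) :=
            (hR t ht ξ hξ.1 z (by linarith)).2.1
        _ ≤ ε / 2 * √(ξ ^ 2 + z ^ 2) ^ (-1 / 2 : ℝ) :=
            mul_le_mul_of_nonneg_left (rpow_le_farWeight (by linarith)) (by positivity)
        _ ≤ ε / 2 * (r / 4) ^ (-1 / 2 : ℝ) :=
            mul_le_mul_of_nonneg_left
              (Real.rpow_le_rpow_of_nonpos (by linarith) hrξ (by norm_num)) (by positivity)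
        _ = ε * r ^ (-1 / 2 : ℝ) := by rw [e4]; ring

/-! ### Negligible fluxes through the cutoff region -/

/-- A family of fields, indexed by the parameters `R s κ` of a cutoff, of the size of its
derivatives: at most `M / R`, and zero where the cutoff is `1`. -/
def IsCutoffDeriv (M : ℝ) (A : ℝ → ℝ → ℝ → Field) : Prop :=
  ∀ R ≥ 1, ∀ s κ t ρ z, |A R s κ t ρ z| ≤ M / R ∧
    (√(1 + ρ ^ 2 + z ^ 2) + κ * (t - s) < R → A R s κ t ρ z = 0)

theorem exists_isCutoffDeriv : ∃ M > 0,
    IsCutoffDeriv M (fun R s κ => dρ (cutoff R s κ)) ∧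
    IsCutoffDeriv M (fun R s κ => dz (cutoff R s κ)) ∧
    IsCutoffDeriv M (fun R s κ => dρ (dρ (cutoff R s κ))) ∧
    IsCutoffDeriv M (fun R s κ => dz (dz (cutoff R s κ))) := by
  obtain ⟨M, hM, h⟩ := exists_cutoff_bounds
  refine ⟨M, hM, fun R hR s κ t ρ z => ⟨(h R hR s κ t ρ z).1, fun hlt => ?_⟩,
    fun R hR s κ t ρ z => ⟨(h R hR s κ t ρ z).2.1, fun hlt => ?_⟩,
    fun R hR s κ t ρ z => ⟨(h R hR s κ t ρ z).2.2.1, fun hlt => ?_⟩,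
    fun R hR s κ t ρ z => ⟨(h R hR s κ t ρ z).2.2.2, fun hlt => ?_⟩⟩
  · exact (cutoff_grad_eq_zero (by linarith) hlt).1
  · exact (cutoff_grad_eq_zero (by linarith) hlt).2
  · have hev : (fun ρ => dρ (cutoff R s κ) t ρ z) =ᶠ[𝓝 ρ] fun _ => 0 := by
      have hc : ContinuousAt (fun ρ : ℝ => √(1 + ρ ^ 2 + z ^ 2) + κ * (t - s)) ρ := by fun_prop
      filter_upwards [hc.eventually_lt_const hlt] with ρ' h'
      exact (cutoff_grad_eq_zero (by linarith) h').1
    exact hev.deriv_eq.trans (deriv_const _ _)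
  · have hev : (fun z => dz (cutoff R s κ) t ρ z) =ᶠ[𝓝 z] fun _ => 0 := by
      have hc : ContinuousAt (fun z : ℝ => √(1 + ρ ^ 2 + z ^ 2) + κ * (t - s)) z := by fun_prop
      filter_upwards [hc.eventually_lt_const hlt] with z' h'
      exact (cutoff_grad_eq_zero (by linarith) h').2
    exact hev.deriv_eq.trans (deriv_const _ _)

theorem IsCutoffDeriv.mul_le {M : ℝ} (hM : 0 < M) {A : ℝ → ℝ → ℝ → Field} (hA : IsCutoffDeriv M A)
    (hf : Decays2 I f) {K : Set ℝ} (hK : K ⊆ I) (hc : IsCompact K) (T : ℝ) {δ : ℝ} (hδ : 0 < δ) :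
    ∃ R₀ ≥ 1, ∀ R ≥ R₀, ∀ s κ, ∀ t ∈ K, κ * (t - s) ≤ T → ∀ ρ ≥ 0, ∀ z,
      |A R s κ t ρ z * f t ρ z| ≤ δ / R ^ 2 := by
  obtain ⟨R₁, hR₁⟩ := eventually_farFilter.1
    (Asymptotics.isLittleO_iff.1 (hf K hK hc) (c := δ / (2 * M)) (by positivity))
  refine ⟨max 1 (max (2 * R₁) (2 * (T + 1))), le_max_left _ _, fun R hR s κ t ht hT ρ hρ z => ?_⟩
  have h1 : 1 ≤ R := (le_max_left _ _).trans hR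
  have h2 : 2 * R₁ ≤ R := (le_max_left _ _).trans ((le_max_right _ _).trans hR)
  have h3 : 2 * (T + 1) ≤ R := (le_max_right _ _).trans ((le_max_right _ _).trans hR)
  obtain ⟨hb, h0⟩ := hA R h1 s κ t ρ z
  rcases lt_or_ge (√(1 + ρ ^ 2 + z ^ 2) + κ * (t - s)) R with h | h
  · rw [h0 h, zero_mul, abs_zero]; positivity
  have hr : R / 2 ≤ √(ρ ^ 2 + z ^ 2) := by linarith [bracket_le ρ z]
  have hfb := hR₁ t ht ρ hρ z (by linarith)
  rw [farWeight_mul_self t ρ z (by linarith), norm_inv, Real.norm_of_nonneg (Real.sqrt_nonneg _)]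
    at hfb
  have hfb' : |f t ρ z| ≤ δ / (2 * M) * (R / 2)⁻¹ :=
    hfb.trans (by gcongr)
  calc |A R s κ t ρ z * f t ρ z| ≤ M / R * (δ / (2 * M) * (R / 2)⁻¹) := by
        rw [abs_mul]
        exact mul_le_mul hb hfb' (abs_nonneg _) (by positivity)
    _ = δ / R ^ 2 := by field_simp

theorem IsCutoffDeriv.boxInt_le {M : ℝ} (hM : 0 < M) {A : ℝ → ℝ → ℝ → Field}
    (hA : IsCutoffDeriv M A) (hf : Decays2 I f) {K : Set ℝ} (hK : K ⊆ I) (hc : IsCompact K) (T : ℝ)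
    {δ : ℝ} (hδ : 0 < δ) :
    ∃ R₀, ∀ R ≥ R₀, ∀ s κ, ∀ t ∈ K, κ * (t - s) ≤ T →
      |boxInt (2 * R) (fun t ρ z => A R s κ t ρ z * f t ρ z) t| ≤ δ := by
  obtain ⟨R₀, hR₀1, hR₀⟩ := hA.mul_le hM hf hK hc T (δ := δ / 8) (by positivity)
  refine ⟨R₀, fun R hR s κ t ht hT => ?_⟩
  have hR1 : 1 ≤ R := hR₀1.trans hR
  refine (abs_boxInt_le (by linarith) (c := δ / 8 / R ^ 2) fun x hx => ?_).trans (le_of_eq ?_)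
  · exact hR₀ R hR s κ t ht hT x.1 hx.1.1.le x.2
  · field_simp; ring

/-- A flux that is `o(r⁻¹)` is negligible. -/
theorem flux_negligible {F G : Field} (hI : IsOpen I) (hFs : IsSmooth I F) (hGs : IsSmooth I G)
    (hF : Decays2 I F) (hG : Decays2 I G) {K : Set ℝ}
    (hK : K ⊆ I) (hc : IsCompact K) (T : ℝ) {δ : ℝ} (hδ : 0 < δ) :
    ∃ R₀, ∀ R ≥ R₀, ∀ s κ, ∀ t ∈ K, κ * (t - s) ≤ T →
      |boxInt (2 * R) (fun t ρ z => dρ (cutoff R s κ) t ρ z * F t ρ z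
        + dz (cutoff R s κ) t ρ z * G t ρ z) t| ≤ δ := by
  obtain ⟨M, hM, h1, h2, -, -⟩ := exists_isCutoffDeriv
  obtain ⟨R₁, hR₁⟩ := h1.boxInt_le hM hF hK hc T (half_pos hδ)
  obtain ⟨R₂, hR₂⟩ := h2.boxInt_le hM hG hK hc T (half_pos hδ)
  refine ⟨max R₁ R₂, fun R hR s κ t ht hT => ?_⟩
  rw [boxInt_add hI (((isSmooth_cutoff R s κ).dρ hI).mul hFs)
    (((isSmooth_cutoff R s κ).dz hI).mul hGs) (hK ht)]
  have e1 := hR₁ R ((le_max_left _ _).trans hR) s κ t ht hT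
  have e2 := hR₂ R ((le_max_right _ _).trans hR) s κ t ht hT
  exact (abs_add_le _ _).trans (by linarith)

/-- A flux `(bρ ∂ρk + bz ∂zk, bρ ∂zk - bz ∂ρk)` is negligible as soon as `b`, `k` and `∂b` fall
off, although nothing is assumed on `∂k`: the derivatives of `k` can be moved to the cutoff. -/
theorem gradient_flux_negligible {bρ bz k : Field} (hI : IsOpen I) (hbρ : IsSmooth I bρ)
    (hbz : IsSmooth I bz) (hk : IsSmooth I k) (h0 : ∀ t ∈ I, ∀ z, bρ t 0 z = 0)
    (dbρ : Decays I bρ) (dbz : Decays I bz) (dk : Decays I k) (dbρρ : Decays I (dρ bρ))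
    (dbρz : Decays I (dz bρ)) (dbzρ : Decays I (dρ bz)) (dbzz : Decays I (dz bz))
    {K : Set ℝ} (hK : K ⊆ I) (hc : IsCompact K) (T : ℝ) {δ : ℝ} (hδ : 0 < δ) :
    ∃ R₀, ∀ R ≥ R₀, ∀ s κ, ∀ t ∈ K, 0 ≤ κ * (t - s) → κ * (t - s) ≤ T →
      |boxInt (2 * R) (fun t ρ z =>
        dρ (cutoff R s κ) t ρ z * (bρ t ρ z * dρ k t ρ z + bz t ρ z * dz k t ρ z)
        + dz (cutoff R s κ) t ρ z * (bρ t ρ z * dz k t ρ z - bz t ρ z * dρ k t ρ z)) t| ≤ δ := by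
  obtain ⟨M, hM, h1, h2, h3, h4⟩ := exists_isCutoffDeriv
  have hδ8 : 0 < δ / 8 := by positivity
  obtain ⟨R₁, hR₁⟩ := h1.boxInt_le hM (dk.mul (dbρρ.add dbzz)) hK hc T hδ8
  obtain ⟨R₂, hR₂⟩ := h2.boxInt_le hM (dk.mul (dbρz.sub dbzρ)) hK hc T hδ8
  obtain ⟨R₃, hR₃⟩ := h3.boxInt_le hM (dk.mul dbρ) hK hc T hδ8
  obtain ⟨R₄, hR₄⟩ := h4.boxInt_le hM (dk.mul dbρ) hK hc T hδ8
  obtain ⟨R₅, hR₅1, hR₅⟩ := h2.mul_le hM (dk.mul dbz) hK hc T hδ8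
  refine ⟨max R₁ (max R₂ (max R₃ (max R₄ R₅))), fun R hR s κ t ht hκ hT => ?_⟩
  simp only [ge_iff_le, max_le_iff] at hR
  obtain ⟨g1, g2, g3, g4, g5⟩ := hR
  have hR1 : 1 ≤ R := hR₅1.trans g5
  have hR0 : 0 < R := by linarith
  have htI := hK ht
  set φ := cutoff R s κ with hφdef
  have hφ : IsSmooth I φ := isSmooth_cutoff R s κ
  have hX : IsSmooth I (fun t ρ z => k t ρ z * (dρ φ t ρ z * bρ t ρ z - dz φ t ρ z * bz t ρ z)) :=
    hk.mul (((hφ.dρ hI).mul hbρ).sub ((hφ.dz hI).mul hbz))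
  have hY : IsSmooth I (fun t ρ z => k t ρ z * (dρ φ t ρ z * bz t ρ z + dz φ t ρ z * bρ t ρ z)) :=
    hk.mul (((hφ.dρ hI).mul hbz).add ((hφ.dz hI).mul hbρ))
  have sA : IsSmooth I fun t ρ z => dρ φ t ρ z * (k t ρ z * (dρ bρ t ρ z + dz bz t ρ z)) :=
    (hφ.dρ hI).mul (hk.mul ((hbρ.dρ hI).add (hbz.dz hI)))
  have sB : IsSmooth I fun t ρ z => dz φ t ρ z * (k t ρ z * (dz bρ t ρ z - dρ bz t ρ z)) :=
    (hφ.dz hI).mul (hk.mul ((hbρ.dz hI).sub (hbz.dρ hI)))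
  have sC : IsSmooth I fun t ρ z => dρ (dρ φ) t ρ z * (k t ρ z * bρ t ρ z) :=
    ((hφ.dρ hI).dρ hI).mul (hk.mul hbρ)
  have sD : IsSmooth I fun t ρ z => dz (dz φ) t ρ z * (k t ρ z * bρ t ρ z) :=
    ((hφ.dz hI).dz hI).mul (hk.mul hbρ)
  -- `bρ (∂ρφ ∂ρk + ∂zφ ∂zk) + bz (∂ρφ ∂zk - ∂zφ ∂ρk)` is a divergence minus terms without `∂k`;
  -- the second derivatives of `φ` multiplying `bz` cancel
  have hsplit : boxInt (2 * R) (fun t ρ z =>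
        dρ φ t ρ z * (bρ t ρ z * dρ k t ρ z + bz t ρ z * dz k t ρ z)
        + dz φ t ρ z * (bρ t ρ z * dz k t ρ z - bz t ρ z * dρ k t ρ z)) t =
      boxInt (2 * R) (fun t ρ z =>
        (dρ (fun t ρ z => k t ρ z * (dρ φ t ρ z * bρ t ρ z - dz φ t ρ z * bz t ρ z)) t ρ z
          + dz (fun t ρ z => k t ρ z * (dρ φ t ρ z * bz t ρ z + dz φ t ρ z * bρ t ρ z)) t ρ z)
        - ((dρ φ t ρ z * (k t ρ z * (dρ bρ t ρ z + dz bz t ρ z))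
            + dz φ t ρ z * (k t ρ z * (dz bρ t ρ z - dρ bz t ρ z)))
          + (dρ (dρ φ) t ρ z * (k t ρ z * bρ t ρ z) + dz (dz φ) t ρ z * (k t ρ z * bρ t ρ z)))) t := by
    refine boxInt_congr fun x _ => ?_
    have e1 : dρ (fun t ρ z => k t ρ z * (dρ φ t ρ z * bρ t ρ z - dz φ t ρ z * bz t ρ z)) t x.1 x.2
        = _ := ((hk.hasDerivAt_dρ hI htI x.1 x.2).mul
      ((((hφ.dρ hI).hasDerivAt_dρ hI htI x.1 x.2).mul (hbρ.hasDerivAt_dρ hI htI x.1 x.2)).sub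
        (((hφ.dz hI).hasDerivAt_dρ hI htI x.1 x.2).mul (hbz.hasDerivAt_dρ hI htI x.1 x.2)))).deriv
    have e2 : dz (fun t ρ z => k t ρ z * (dρ φ t ρ z * bz t ρ z + dz φ t ρ z * bρ t ρ z)) t x.1 x.2
        = _ := ((hk.hasDerivAt_dz hI htI x.1 x.2).mul
      ((((hφ.dρ hI).hasDerivAt_dz hI htI x.1 x.2).mul (hbz.hasDerivAt_dz hI htI x.1 x.2)).add
        (((hφ.dz hI).hasDerivAt_dz hI htI x.1 x.2).mul (hbρ.hasDerivAt_dz hI htI x.1 x.2)))).deriv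
    rw [e1, e2, hφ.dρ_dz hI htI]
    simp only [Pi.mul_apply, Pi.sub_apply, Pi.add_apply]
    ring
  have houter : ∀ ρ z : ℝ, 2 * R ≤ √(1 + ρ ^ 2 + z ^ 2) →
      dρ φ t ρ z = 0 ∧ dz φ t ρ z = 0 := fun ρ z h => (cutoff_eq_zero hR0 (by linarith)).2
  have hdiv : |boxInt (2 * R) (fun t ρ z =>
        dρ (fun t ρ z => k t ρ z * (dρ φ t ρ z * bρ t ρ z - dz φ t ρ z * bz t ρ z)) t ρ z
        + dz (fun t ρ z => k t ρ z * (dρ φ t ρ z * bz t ρ z + dz φ t ρ z * bρ t ρ z)) t ρ z) t|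
      ≤ δ / 2 := by
    -- the only boundary term is `∫ k ∂zφ bz` along the axis, of length `4 R`
    rw [boxInt_div_eq hI hX hY htI (by linarith)]
    have i1 : ∀ ρ, 2 * R ≤ √(1 + ρ ^ 2 + (2 * R) ^ 2) := fun ρ =>
      (le_abs_self _).trans (abs_z_le_bracket _ _)
    have i2 : ∀ z, 2 * R ≤ √(1 + (2 * R) ^ 2 + z ^ 2) := fun z =>
      (le_abs_self _).trans (abs_rho_le_bracket _ _)
    have i3 : ∀ ρ, 2 * R ≤ √(1 + ρ ^ 2 + (-(2 * R)) ^ 2) := fun ρ => by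
      rw [neg_sq]; exact i1 ρ
    simp only [(houter _ _ (i1 _)).1, (houter _ _ (i1 _)).2, (houter _ _ (i2 _)).1,
      (houter _ _ (i2 _)).2, (houter _ _ (i3 _)).1, (houter _ _ (i3 _)).2, zero_mul, add_zero,
      sub_zero, mul_zero, intervalIntegral.integral_zero, zero_sub, abs_neg]
    have hbd := intervalIntegral.norm_integral_le_of_norm_le_const (a := -(2 * R)) (b := 2 * R)
      (C := δ / 8 / R ^ 2)
      (f := fun z => k t 0 z * (dρ φ t 0 z * bρ t 0 z - dz φ t 0 z * bz t 0 z)) (fun z _ => by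
        have := hR₅ R g5 s κ t ht hT 0 le_rfl z
        rw [h0 t htI, mul_zero, zero_sub, mul_neg, norm_neg, Real.norm_eq_abs]
        rw [show k t 0 z * (dz φ t 0 z * bz t 0 z) = dz φ t 0 z * (k t 0 z * bz t 0 z) by ring]
        exact this)
    refine hbd.trans ?_
    rw [abs_of_pos (by linarith)]
    have : δ / 8 / R ^ 2 * (2 * R - -(2 * R)) = δ / 2 / R := by field_simp; ring
    rw [this]
    exact div_le_self (by positivity) hR1
  have b1 := hR₁ R g1 s κ t ht hT
  have b2 := hR₂ R g2 s κ t ht hT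
  have b3 := hR₃ R g3 s κ t ht hT
  have b4 := hR₄ R g4 s κ t ht hT
  rw [hsplit, boxInt_sub hI ((hX.dρ hI).add (hY.dz hI)) ((sA.add sB).add (sC.add sD)) htI,
    boxInt_add hI (sA.add sB) (sC.add sD) htI, boxInt_add hI sA sB htI, boxInt_add hI sC sD htI]
  rw [abs_le] at *
  constructor <;> linarith [hdiv.1, hdiv.2, b1.1, b1.2, b2.1, b2.2, b3.1, b3.2, b4.1, b4.2]

end LinGrav

namespace LinGrav

variable {I : Set ℝ} {f g : Field} {t ρ z L : ℝ}

namespace Perturbation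

variable {P : Perturbation} {B : Field}

/-! ### The energy of the conformal factor -/

/-- `χρρ / ρ`, expressed through the shift. -/
noncomputable def shearρρ (P : Perturbation) : Field := fun t ρ z =>
  (dρ P.βρ t ρ z - dz P.βz t ρ z) / 2

/-- `χρz / ρ`, expressed through the shift. -/
noncomputable def shearρz (P : Perturbation) : Field := fun t ρ z =>
  (dρ P.βz t ρ z + dz P.βρ t ρ z) / 2

/-- The density of `m_σ` as a field that is smooth up to the axis; `B` stands for `β^ρ / ρ`. -/
noncomputable def σDensity (P : Perturbation) (B : Field) : Field := fun t ρ z =>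
  (2 * (dt P.σ t ρ z - 2 * B t ρ z) ^ 2 + 2 * gradSq P.σ t ρ z
    + 8 * (P.shearρρ t ρ z ^ 2 + P.shearρz t ρ z ^ 2)) * ρ

theorem IsSolution.χρρ_eq (hP : P.IsSolution I) (ht : t ∈ I) (hρ : 0 < ρ) (z : ℝ) :
    P.χρρ t ρ z = ρ * P.shearρρ t ρ z := by
  have h := hP.shift_ρρ t ht ρ hρ z
  rw [shearρρ]
  field_simp at h
  linarith

theorem IsSolution.χρz_eq (hP : P.IsSolution I) (ht : t ∈ I) (hρ : 0 < ρ) (z : ℝ) :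
    P.χρz t ρ z = ρ * P.shearρz t ρ z := by
  have h := hP.shift_ρz t ht ρ hρ z
  rw [shearρz]
  field_simp at h
  linarith

theorem IsSolution.smooth_shearρρ (hP : P.IsSolution I) (hI : IsOpen I) : IsSmooth I P.shearρρ :=
  ((hP.smooth_βρ.dρ hI).sub (hP.smooth_βz.dz hI)).div_const 2

theorem IsSolution.smooth_shearρz (hP : P.IsSolution I) (hI : IsOpen I) : IsSmooth I P.shearρz :=
  ((hP.smooth_βz.dρ hI).add (hP.smooth_βρ.dz hI)).div_const 2

theorem isSmooth_gradSq (hI : IsOpen I) (hf : IsSmooth I f) : IsSmooth I (gradSq f) :=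
  ((hf.dρ hI).pow 2).add ((hf.dz hI).pow 2)

theorem IsSolution.smooth_σDensity (hP : P.IsSolution I) (hI : IsOpen I) (hB : IsSmooth I B) :
    IsSmooth I (P.σDensity B) :=
  (((((isSmooth_const 2).mul (((hP.smooth_σ.dt hI).sub ((isSmooth_const 2).mul hB)).pow 2)).add
    ((isSmooth_const 2).mul (isSmooth_gradSq hI hP.smooth_σ))).add
    ((isSmooth_const 8).mul (((hP.smooth_shearρρ hI).pow 2).add
      ((hP.smooth_shearρz hI).pow 2)))).mul isSmooth_rho)

theorem σDensity_nonneg (hρ : 0 < ρ) : 0 ≤ P.σDensity B t ρ z := by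
  unfold σDensity gradSq; positivity

theorem p_eq (hB : ∀ t ∈ I, ∀ ρ z, P.βρ t ρ z = ρ * B t ρ z) (ht : t ∈ I) (hρ : 0 < ρ) (z : ℝ) :
    P.p t ρ z = dt P.σ t ρ z - 2 * B t ρ z := by
  rw [p, hB t ht]
  field_simp

theorem IsSolution.massσ_zero_eq (hP : P.IsSolution I)
    (hB : ∀ t ∈ I, ∀ ρ z, P.βρ t ρ z = ρ * B t ρ z) (ht : t ∈ I) :
    P.massσ 0 t = halfPlaneIntegral (P.σDensity B) t := by
  unfold Perturbation.massσ LinGrav.massσ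
  refine halfPlaneIntegral_congr fun ρ hρ z => ?_
  have hzz : P.χzz t ρ z = -(ρ * P.shearρρ t ρ z) := by
    linarith [hP.trace_free t ht ρ hρ z, hP.χρρ_eq ht hρ z]
  simp only [Function.iterate_zero, id]
  rw [p_eq hB ht hρ, hP.χρρ_eq ht hρ, hP.χρz_eq ht hρ, hzz, σDensity]
  field_simp
  ring

/-- The energy flux `4 ρ ∂ₜσ ∂σ + 8 β^A ∂ₜχ_A` splits into `4 ρ p ∂σ`, which is bounded by the
density, and `8 (β^ρ ∂σ + β^A ∂ₜχ_A)`, since `ρ ∂ₜσ = ρ p + 2 β^ρ`. If the second part is negligible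
at infinity, the energy is conserved. -/
theorem IsSolution.massσ_conserved_of_flux (hI : IsOpen I) (hc : I.OrdConnected)
    (hP : P.IsSolution I) (hA : P.AxisRegular I)
    (hflux : ∀ K ⊆ I, IsCompact K → ∀ T > 0, ∀ δ > 0, ∃ R₀, ∀ R ≥ R₀, ∀ s κ, ∀ t ∈ K,
      0 ≤ κ * (t - s) → κ * (t - s) ≤ T →
      |boxInt (2 * R) (fun t ρ z => dρ (cutoff R s κ) t ρ z * (8 * (P.βρ t ρ z * dρ P.σ t ρ z
          + (P.βρ t ρ z * dt P.χρρ t ρ z + P.βz t ρ z * dt P.χρz t ρ z)))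
        + dz (cutoff R s κ) t ρ z * (8 * (P.βρ t ρ z * dz P.σ t ρ z
          + (P.βρ t ρ z * dt P.χρz t ρ z + P.βz t ρ z * dt P.χzz t ρ z)))) t| ≤ δ) :
    ∀ s ∈ I, ∀ t ∈ I, P.massσ 0 s = P.massσ 0 t := by
  obtain ⟨B, hBs, hB⟩ := hP.smooth_βρ.exists_eq_rho_mul hI (fun t ht z => hA.odd_βρ.axis ht z)
  have hσ := hP.smooth_σ
  have hβρ := hP.smooth_βρ
  have hβz := hP.smooth_βz
  have hπ : IsSmooth I (fun t ρ z => dt P.σ t ρ z - 2 * B t ρ z) :=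
    (hσ.dt hI).sub ((isSmooth_const 2).mul hBs)
  have hF₁ : IsSmooth I fun t ρ z => 4 * ρ ^ 1 * ((dt P.σ t ρ z - 2 * B t ρ z) * dρ P.σ t ρ z) :=
    (isSmooth_rho_pow_mul 4 1).mul (hπ.mul (hσ.dρ hI))
  have hG₁ : IsSmooth I fun t ρ z => 4 * ρ ^ 1 * ((dt P.σ t ρ z - 2 * B t ρ z) * dz P.σ t ρ z) :=
    (isSmooth_rho_pow_mul 4 1).mul (hπ.mul (hσ.dz hI))
  have hF₂ : IsSmooth I fun t ρ z => 8 * (P.βρ t ρ z * dρ P.σ t ρ z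
      + (P.βρ t ρ z * dt P.χρρ t ρ z + P.βz t ρ z * dt P.χρz t ρ z)) :=
    (isSmooth_const 8).mul ((hβρ.mul (hσ.dρ hI)).add
      ((hβρ.mul (hP.smooth_χρρ.dt hI)).add (hβz.mul (hP.smooth_χρz.dt hI))))
  have hG₂ : IsSmooth I fun t ρ z => 8 * (P.βρ t ρ z * dz P.σ t ρ z
      + (P.βρ t ρ z * dt P.χρz t ρ z + P.βz t ρ z * dt P.χzz t ρ z)) :=
    (isSmooth_const 8).mul ((hβρ.mul (hσ.dz hI)).add
      ((hβρ.mul (hP.smooth_χρz.dt hI)).add (hβz.mul (hP.smooth_χzz.dt hI))))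
  have hcons := halfPlaneIntegral_conserved hI hc (hP.smooth_σDensity hI hBs) hF₁ hG₁ hF₂ hG₂
    (fun t _ ρ hρ z => σDensity_nonneg hρ) ?_ ?_ ?_ hflux
  · intro s hs t ht
    rw [hP.massσ_zero_eq hB hs, hP.massσ_zero_eq hB ht]
    exact hcons s hs t ht
  · intro t ht ρ hρ z
    have hP' := hP.tderiv hI
    -- the time derivatives of the quantities in the density
    have hX : dt P.χρρ t ρ z = ρ * dt P.shearρρ t ρ z :=
      (dt_congr (g := fun t ρ z => ρ * P.shearρρ t ρ z) hI (fun t ht => hP.χρρ_eq ht hρ z) ht).trans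
        (((hP.smooth_shearρρ hI).hasDerivAt_dt hI ht ρ z).const_mul ρ).deriv
    have hY : dt P.χρz t ρ z = ρ * dt P.shearρz t ρ z :=
      (dt_congr (g := fun t ρ z => ρ * P.shearρz t ρ z) hI (fun t ht => hP.χρz_eq ht hρ z) ht).trans
        (((hP.smooth_shearρz hI).hasDerivAt_dt hI ht ρ z).const_mul ρ).deriv
    have hZ : dt P.χzz t ρ z = -dt P.χρρ t ρ z := by
      have := hP'.trace_free t ht ρ hρ z
      simp only [Perturbation.tderiv] at this
      linarith
    have hp1 : dt P.p t ρ z = lap3 P.σ t ρ z := by linarith [hP.evol_σ t ht ρ hρ z]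
    have hp2 : dt (fun t ρ z => dt P.σ t ρ z - 2 * B t ρ z) t ρ z = lap3 P.σ t ρ z := by
      rw [← hp1]
      exact (dt_congr hI (fun t ht => p_eq hB ht hρ z) ht).symm
    have hm1 : dρ (dt P.χρρ) t ρ z + dz (dt P.χρz) t ρ z = -lap3 P.σ t ρ z := by
      rw [← hp1, ← hP.p_tderiv hI ht]
      exact hP'.momentum_ρ t ht ρ hρ z
    have hm2 : dρ (dt P.χρz) t ρ z + dz (dt P.χzz) t ρ z = 0 := hP'.momentum_z t ht ρ hρ z
    have e1 : dt (P.σDensity B) t ρ z = _ :=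
      (((((((hπ.hasDerivAt_dt hI ht ρ z).pow 2).const_mul 2).add
        (((((hσ.dρ hI).hasDerivAt_dt hI ht ρ z).pow 2).add
          (((hσ.dz hI).hasDerivAt_dt hI ht ρ z).pow 2)).const_mul 2)).add
        (((((hP.smooth_shearρρ hI).hasDerivAt_dt hI ht ρ z).pow 2).add
          (((hP.smooth_shearρz hI).hasDerivAt_dt hI ht ρ z).pow 2)).const_mul 8))).mul_const ρ).deriv
    have e2 : dρ (fun t ρ z => 4 * ρ ^ 1 * ((dt P.σ t ρ z - 2 * B t ρ z) * dρ P.σ t ρ z)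
        + 8 * (P.βρ t ρ z * dρ P.σ t ρ z
          + (P.βρ t ρ z * dt P.χρρ t ρ z + P.βz t ρ z * dt P.χρz t ρ z))) t ρ z = _ :=
      (dρ_congr (g := fun t ρ z => 4 * (ρ * (dt P.σ t ρ z * dρ P.σ t ρ z))
        + 8 * (P.βρ t ρ z * dt P.χρρ t ρ z + P.βz t ρ z * dt P.χρz t ρ z))
        (fun ρ => by rw [hB t ht]; ring)).trans
      ((((hasDerivAt_id ρ).mul (((hσ.dt hI).hasDerivAt_dρ hI ht ρ z).mul
        ((hσ.dρ hI).hasDerivAt_dρ hI ht ρ z))).const_mul 4).add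
        ((((hβρ.hasDerivAt_dρ hI ht ρ z).mul
            ((hP.smooth_χρρ.dt hI).hasDerivAt_dρ hI ht ρ z)).add
          ((hβz.hasDerivAt_dρ hI ht ρ z).mul
            ((hP.smooth_χρz.dt hI).hasDerivAt_dρ hI ht ρ z))).const_mul 8)).deriv
    have e3 : dz (fun t ρ z => 4 * ρ ^ 1 * ((dt P.σ t ρ z - 2 * B t ρ z) * dz P.σ t ρ z)
        + 8 * (P.βρ t ρ z * dz P.σ t ρ z
          + (P.βρ t ρ z * dt P.χρz t ρ z + P.βz t ρ z * dt P.χzz t ρ z))) t ρ z = _ :=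
      (dz_congr (g := fun t ρ z => 4 * (ρ * (dt P.σ t ρ z * dz P.σ t ρ z))
        + 8 * (P.βρ t ρ z * dt P.χρz t ρ z + P.βz t ρ z * dt P.χzz t ρ z))
        (fun z => by rw [hB t ht]; ring)).trans
      (((((((hσ.dt hI).hasDerivAt_dz hI ht ρ z).mul
        ((hσ.dz hI).hasDerivAt_dz hI ht ρ z))).const_mul ρ).const_mul 4).add
        ((((hβρ.hasDerivAt_dz hI ht ρ z).mul
            ((hP.smooth_χρz.dt hI).hasDerivAt_dz hI ht ρ z)).add
          ((hβz.hasDerivAt_dz hI ht ρ z).mul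
            ((hP.smooth_χzz.dt hI).hasDerivAt_dz hI ht ρ z))).const_mul 8)).deriv
    rw [e1, e2, e3, hp2, ← hσ.dρ_dt hI ht, ← hσ.dz_dt hI ht]
    simp only [Pi.mul_apply, id]
    have hl : dρ (dρ P.σ) t ρ z + dz (dz P.σ) t ρ z + dρ P.σ t ρ z / ρ = lap3 P.σ t ρ z := rfl
    have hl' : ρ * lap3 P.σ t ρ z
        = ρ * (dρ (dρ P.σ) t ρ z + dz (dz P.σ) t ρ z) + dρ P.σ t ρ z := by
      rw [← hl]; field_simp
    have hβB := hB t ht ρ z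
    rw [hX] at hZ ⊢
    rw [hY, hZ]
    have sX : 2 * P.shearρρ t ρ z = dρ P.βρ t ρ z - dz P.βz t ρ z := by rw [shearρρ]; ring
    have sY : 2 * P.shearρz t ρ z = dρ P.βz t ρ z + dz P.βρ t ρ z := by rw [shearρz]; ring
    simp only [Nat.cast_ofNat]
    -- the gradient terms cancel; what is left uses the equation for `p`, the shift equation and the
    -- time derivative of the momentum constraint
    linear_combination 4 * dt P.σ t ρ z * hl' + 8 * ρ * dt P.shearρρ t ρ z * sX
      + 8 * ρ * dt P.shearρz t ρ z * sY - 8 * P.βρ t ρ z * hm1 - 8 * P.βz t ρ z * hm2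
      + 8 * lap3 P.σ t ρ z * hβB
  · intro t ht z
    have h0 : dt P.χρz t 0 z = 0 := by
      have : ∀ s ∈ I, P.χρz s 0 z = 0 := fun s hs => by
        have := hP.smooth_χρz.eq_on_axis hI (isSmooth_rho.mul (hP.smooth_shearρz hI)) hs
          (fun ρ hρ => hP.χρz_eq hs hρ z)
        simpa using this
      exact (dt_congr (g := fun _ _ _ => 0) hI this ht).trans (deriv_const _ _)
    simp [hA.odd_βρ.axis ht z, h0]
  · intro t ht ρ hρ z
    unfold σDensity gradSq
    generalize dt P.σ t ρ z - 2 * B t ρ z = a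
    have h1 : 0 ≤ 8 * (P.shearρρ t ρ z ^ 2 + P.shearρz t ρ z ^ 2) := by positivity
    generalize 8 * (P.shearρρ t ρ z ^ 2 + P.shearρz t ρ z ^ 2) = b at h1
    have h2 : 0 ≤ 2 * a ^ 2 + 2 * (dρ P.σ t ρ z ^ 2 + dz P.σ t ρ z ^ 2) := by positivity
    have h3 : (2 * a ^ 2 + 2 * (dρ P.σ t ρ z ^ 2 + dz P.σ t ρ z ^ 2)) ^ 2
        ≤ (2 * a ^ 2 + 2 * (dρ P.σ t ρ z ^ 2 + dz P.σ t ρ z ^ 2) + b) ^ 2 :=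
      pow_le_pow_left₀ h2 (by linarith) 2
    have h4 := sq_nonneg (a ^ 2 - (dρ P.σ t ρ z ^ 2 + dz P.σ t ρ z ^ 2))
    have h5 : 16 * a ^ 2 * (dρ P.σ t ρ z ^ 2 + dz P.σ t ρ z ^ 2)
        ≤ (2 * a ^ 2 + 2 * (dρ P.σ t ρ z ^ 2 + dz P.σ t ρ z ^ 2) + b) ^ 2 := by linarith
    have h6 := mul_le_mul_of_nonneg_left h5 (sq_nonneg ρ)
    linarith

theorem IsSolution.massσ_zero_conserved (hI : IsOpen I) (hc : I.OrdConnected)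
    (hP : P.IsSolution I) (hA : P.AxisRegular I) (h0 : P.FallsOff I 0) (h1 : P.FallsOff I 1) :
    ∀ s ∈ I, ∀ t ∈ I, P.massσ 0 s = P.massσ 0 t := by
  refine hP.massσ_conserved_of_flux hI hc hA fun K hK hKc T _ δ hδ => ?_
  have hβρ := hP.smooth_βρ
  have hβz := hP.smooth_βz
  have dβρ : Decays I P.βρ := h0.βρ.decays hI hβρ
  have dβz : Decays I P.βz := h0.βz.decays hI hβz
  have dχρρ : Decays I (dt P.χρρ) := h1.χρρ.decays hI (hP.smooth_χρρ.dt hI)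
  have dχρz : Decays I (dt P.χρz) := h1.χρz.decays hI (hP.smooth_χρz.dt hI)
  have dχzz : Decays I (dt P.χzz) := h1.χzz.decays hI (hP.smooth_χzz.dt hI)
  have dσρ : Decays I (dρ P.σ) := h0.σ.decays_dρ hI hP.smooth_σ
  have dσz : Decays I (dz P.σ) := h0.σ.decays_dz hI hP.smooth_σ
  obtain ⟨R₀, hR₀⟩ := flux_negligible hI
    ((isSmooth_const 8).mul ((hβρ.mul (hP.smooth_σ.dρ hI)).add
      ((hβρ.mul (hP.smooth_χρρ.dt hI)).add (hβz.mul (hP.smooth_χρz.dt hI)))))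
    ((isSmooth_const 8).mul ((hβρ.mul (hP.smooth_σ.dz hI)).add
      ((hβρ.mul (hP.smooth_χρz.dt hI)).add (hβz.mul (hP.smooth_χzz.dt hI)))))
    (((dβρ.mul dσρ).add ((dβρ.mul dχρρ).add (dβz.mul dχρz))).const_mul 8)
    (((dβρ.mul dσz).add ((dβρ.mul dχρz).add (dβz.mul dχzz))).const_mul 8) hK hKc T hδ
  exact ⟨R₀, fun R hR s κ t ht _ hT => hR₀ R hR s κ t ht hT⟩

/-- Conservation of the energy of the time derivative of a solution. Nothing is assumed on the
second time derivatives: `∂ₜ² χ` is the gradient of `∂ₜ q`, and `∂ₜ q` falls off since it is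
determined by `β` and `∂ₜ σ`. -/
theorem IsSolution.massσ_one_conserved (hI : IsOpen I) (hc : I.OrdConnected)
    (hP : P.IsSolution I) (hA : P.AxisRegular I) (h0 : P.FallsOff I 0) (h1 : P.FallsOff I 1) :
    ∀ s ∈ I, ∀ t ∈ I, P.massσ 1 s = P.massσ 1 t := by
  have hP' := hP.tderiv hI
  have hA' := hA.tderiv hI
  have key : ∀ s ∈ I, ∀ t ∈ I, P.tderiv.massσ 0 s = P.tderiv.massσ 0 t := by
    refine hP'.massσ_conserved_of_flux hI hc hA' fun K hK hKc T _ δ hδ => ?_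
    have hbρ : IsSmooth I (dt P.βρ) := hP'.smooth_βρ
    have hbz : IsSmooth I (dt P.βz) := hP'.smooth_βz
    have hs : IsSmooth I (dt P.σ) := hP'.smooth_σ
    have hk : IsSmooth I (dt P.q) := hP'.smooth_q
    have lβρ : LittleO1 I (-1 / 2) P.βρ := h0.βρ
    have lβz : LittleO1 I (-1 / 2) P.βz := h0.βz
    have lbρ : LittleO1 I (-1 / 2) (dt P.βρ) := h1.βρ
    have lbz : LittleO1 I (-1 / 2) (dt P.βz) := h1.βz
    have ls : LittleO1 I (-1 / 2) (dt P.σ) := h1.σ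
    obtain ⟨B, hBs, hB⟩ := hP.smooth_βρ.exists_eq_rho_mul hI (fun t ht z => hA.odd_βρ.axis ht z)
    have hkeq : ∀ t ∈ I, ∀ ρ > 0, ∀ z, dt P.q t ρ z =
        1 / 2 * (dρ P.βρ t ρ z + dz P.βz t ρ z) + B t ρ z - dt P.σ t ρ z := by
      intro t ht ρ hρ z
      have hu : dt P.u t ρ z = dt P.σ t ρ z + dt P.q t ρ z :=
        ((hP.smooth_σ.hasDerivAt_dt hI ht ρ z).add (hP.smooth_q.hasDerivAt_dt hI ht ρ z)).deriv
      have h := hP.evol_u t ht ρ hρ z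
      rw [hu, hB t ht, ← mul_assoc, mul_comm 2 ρ, mul_assoc, mul_div_cancel_left₀ _ hρ.ne'] at h
      linarith
    have hksm : IsSmooth I (fun t ρ z =>
        1 / 2 * (dρ P.βρ t ρ z + dz P.βz t ρ z) + B t ρ z - dt P.σ t ρ z) :=
      (((isSmooth_const _).mul ((hP.smooth_βρ.dρ hI).add (hP.smooth_βz.dz hI))).add hBs).sub hs
    have dk : Decays I (dt P.q) := by
      refine Decays.congr (((((lβρ.decays_dρ hI hP.smooth_βρ).add
        (lβz.decays_dz hI hP.smooth_βz)).const_mul (1 / 2)).add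
        (lβρ.decays_div_rho hI hP.smooth_βρ hBs hB)).sub (ls.decays hI hs)) ?_
      intro t ht ρ hρ z
      rcases hρ.lt_or_eq with hρ | rfl
      · exact hkeq t ht ρ hρ z
      · exact hk.eq_on_axis hI hksm ht (fun ρ hρ => hkeq t ht ρ hρ z)
    have dbρ := lbρ.decays hI hbρ
    have hF : IsSmooth I (fun t ρ z => 8 * (dt P.βρ t ρ z * dρ (dt P.σ) t ρ z)) :=
      (isSmooth_const 8).mul (hbρ.mul (hs.dρ hI))
    have hG : IsSmooth I (fun t ρ z => 8 * (dt P.βρ t ρ z * dz (dt P.σ) t ρ z)) :=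
      (isSmooth_const 8).mul (hbρ.mul (hs.dz hI))
    obtain ⟨R₁, hR₁⟩ := flux_negligible hI hF hG
      ((dbρ.mul (ls.decays_dρ hI hs)).const_mul 8) ((dbρ.mul (ls.decays_dz hI hs)).const_mul 8)
      hK hKc T (half_pos hδ)
    obtain ⟨R₂, hR₂⟩ := gradient_flux_negligible hI hbρ hbz hk
      (fun t ht z => hA'.odd_βρ.axis ht z) dbρ (lbz.decays hI hbz) dk (lbρ.decays_dρ hI hbρ)
      (lbρ.decays_dz hI hbρ) (lbz.decays_dρ hI hbz) (lbz.decays_dz hI hbz) hK hKc T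
      (δ := δ / 16) (by positivity)
    refine ⟨max R₁ R₂, fun R hR s κ t ht hκ hT => ?_⟩
    have htI := hK ht
    have hφ : IsSmooth I (cutoff R s κ) := isSmooth_cutoff R s κ
    have e1 := hR₁ R ((le_max_left _ _).trans hR) s κ t ht hT
    have e2 := hR₂ R ((le_max_right _ _).trans hR) s κ t ht hκ hT
    have hsplit : boxInt (2 * R) (fun t ρ z => dρ (cutoff R s κ) t ρ z *
          (8 * (P.tderiv.βρ t ρ z * dρ P.tderiv.σ t ρ z
          + (P.tderiv.βρ t ρ z * dt P.tderiv.χρρ t ρ z + P.tderiv.βz t ρ z * dt P.tderiv.χρz t ρ z)))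
        + dz (cutoff R s κ) t ρ z * (8 * (P.tderiv.βρ t ρ z * dz P.tderiv.σ t ρ z
          + (P.tderiv.βρ t ρ z * dt P.tderiv.χρz t ρ z
            + P.tderiv.βz t ρ z * dt P.tderiv.χzz t ρ z)))) t =
        boxInt (2 * R) (fun t ρ z =>
          (dρ (cutoff R s κ) t ρ z * (8 * (dt P.βρ t ρ z * dρ (dt P.σ) t ρ z))
            + dz (cutoff R s κ) t ρ z * (8 * (dt P.βρ t ρ z * dz (dt P.σ) t ρ z)))
          + 8 * (dρ (cutoff R s κ) t ρ z * (dt P.βρ t ρ z * dρ (dt P.q) t ρ z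
              + dt P.βz t ρ z * dz (dt P.q) t ρ z)
            + dz (cutoff R s κ) t ρ z * (dt P.βρ t ρ z * dz (dt P.q) t ρ z
              - dt P.βz t ρ z * dρ (dt P.q) t ρ z))) t := by
      refine boxInt_congr fun x hx => ?_
      rw [hP'.evol_χρρ t htI x.1 hx.1.1, hP'.evol_χρz t htI x.1 hx.1.1,
        hP'.evol_χzz t htI x.1 hx.1.1]
      simp only [Perturbation.tderiv]
      ring
    rw [hsplit, boxInt_add hI (((hφ.dρ hI).mul hF).add ((hφ.dz hI).mul hG)) ?_ htI,
      boxInt_const_mul]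
    · rw [abs_le] at *
      constructor <;> linarith [e1.1, e1.2, e2.1, e2.2]
    · exact (isSmooth_const 8).mul (((hφ.dρ hI).mul ((hbρ.mul (hk.dρ hI)).add
        (hbz.mul (hk.dz hI)))).add ((hφ.dz hI).mul ((hbρ.mul (hk.dz hI)).sub
        (hbz.mul (hk.dρ hI)))))
  intro s hs t ht
  have h := fun {t : ℝ} (ht : t ∈ I) => hP.massσ_add hI 1 0 ht
  simp only [zero_add, Function.iterate_one] at h
  rw [h hs, h ht]
  exact key s hs t ht

end Perturbation

end LinGrav

namespace LinGrav

variable {I : Set ℝ} {f g : Field} {t ρ z L : ℝ}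

/-! ### Weighted square integrals -/

/-- The integral of `ρ ^ a f²` over a box. -/
noncomputable def sqInt (a : ℕ) (L : ℝ) (f : Field) (t : ℝ) : ℝ :=
  boxInt L (fun t ρ z => ρ ^ a * f t ρ z ^ 2) t

/-- `∫ ρ ^ a f² ≤ N` on the half plane, at time `t`. -/
def SqBdd (a : ℕ) (t : ℝ) (f : Field) (N : ℝ) : Prop := ∀ L > 0, sqInt a L f t ≤ N

/-- The integral of `ρ ^ a f²` over a box of size `L` is `o(L²)`. This is what cutoff errors of the
form `|∂φ|² f²` can absorb, as `|∂φ|² = O(L⁻²)`. -/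
def SqSub (a : ℕ) (t : ℝ) (f : Field) : Prop :=
  ∀ ε > 0, ∃ L₀ : ℝ, ∀ L ≥ L₀, sqInt a L f t ≤ ε * L ^ 2

theorem isSmooth_sq_weight (a : ℕ) (hf : IsSmooth I f) :
    IsSmooth I (fun t ρ z => ρ ^ a * f t ρ z ^ 2) := (isSmooth_rho.pow a).mul (hf.pow 2)

theorem sq_weight_nonneg {a : ℕ} {x : ℝ × ℝ} (hx : x ∈ box L) (c : ℝ) : 0 ≤ x.1 ^ a * c ^ 2 :=
  mul_nonneg (pow_nonneg hx.1.1.le a) (sq_nonneg c)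

theorem sqInt_nonneg (a : ℕ) (L : ℝ) (f : Field) (t : ℝ) : 0 ≤ sqInt a L f t :=
  boxInt_nonneg fun _ hx => sq_weight_nonneg hx _

theorem sqInt_mono (a : ℕ) (hI : IsOpen I) (hf : IsSmooth I f) (ht : t ∈ I) {L' : ℝ} (h : L ≤ L') :
    sqInt a L f t ≤ sqInt a L' f t :=
  boxInt_mono_set hI (isSmooth_sq_weight a hf) ht h fun _ hx => sq_weight_nonneg hx _

theorem SqBdd.mono {a : ℕ} {N N' : ℝ} (h : SqBdd a t f N) (hN : N ≤ N') : SqBdd a t f N' :=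
  fun L hL => (h L hL).trans hN

theorem SqBdd.congr {a b : ℕ} {N : ℝ} (h : SqBdd a t f N)
    (hfg : ∀ ρ > 0, ∀ z, ρ ^ b * g t ρ z ^ 2 = ρ ^ a * f t ρ z ^ 2) : SqBdd b t g N := fun L hL =>
  (boxInt_congr fun x hx => hfg x.1 hx.1.1 x.2).trans_le (h L hL)

theorem SqSub.congr {a b : ℕ} (h : SqSub a t f)
    (hfg : ∀ ρ > 0, ∀ z, ρ ^ b * g t ρ z ^ 2 = ρ ^ a * f t ρ z ^ 2) : SqSub b t g := by
  intro ε hε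
  obtain ⟨L₀, h₀⟩ := h ε hε
  exact ⟨L₀, fun L hL => (boxInt_congr fun x hx => hfg x.1 hx.1.1 x.2).trans_le (h₀ L hL)⟩

theorem SqBdd.sqSub {a : ℕ} {N : ℝ} (h : SqBdd a t f N) : SqSub a t f := by
  intro ε hε
  refine ⟨max 1 (N / ε), fun L hL => ?_⟩
  have h1 : 1 ≤ L := (le_max_left _ _).trans hL
  have h2 : N / ε ≤ L := (le_max_right _ _).trans hL
  rw [div_le_iff₀ hε] at h2
  have h3 := h L (by linarith)
  nlinarith [mul_le_mul_of_nonneg_left h1 (by positivity : 0 ≤ L * ε)]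

theorem sqInt_comb_le (a : ℕ) (hI : IsOpen I) (hf : IsSmooth I f) (hg : IsSmooth I g) (ht : t ∈ I)
    (c L : ℝ) : sqInt a L (fun t ρ z => f t ρ z - c * g t ρ z) t
      ≤ 2 * sqInt a L f t + 2 * c ^ 2 * sqInt a L g t := by
  unfold sqInt
  rw [← boxInt_const_mul, ← boxInt_const_mul,
    ← boxInt_add hI ((isSmooth_const 2).mul (isSmooth_sq_weight a hf))
      ((isSmooth_const (2 * c ^ 2)).mul (isSmooth_sq_weight a hg)) ht]
  refine boxInt_mono hI (isSmooth_sq_weight a (hf.sub ((isSmooth_const c).mul hg)))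
    (((isSmooth_const 2).mul (isSmooth_sq_weight a hf)).add
      ((isSmooth_const (2 * c ^ 2)).mul (isSmooth_sq_weight a hg))) ht fun x hx => ?_
  have h := sq_weight_nonneg (a := a) hx (f t x.1 x.2 + c * g t x.1 x.2)
  linarith

theorem SqBdd.comb {a : ℕ} {N N' : ℝ} (hI : IsOpen I) (hf : IsSmooth I f) (hg : IsSmooth I g)
    (ht : t ∈ I) (bf : SqBdd a t f N) (bg : SqBdd a t g N') (c : ℝ) :
    SqBdd a t (fun t ρ z => f t ρ z - c * g t ρ z) (2 * N + 2 * c ^ 2 * N') := fun L hL => by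
  refine (sqInt_comb_le a hI hf hg ht c L).trans ?_
  have h1 := bf L hL
  have h2 := mul_le_mul_of_nonneg_left (bg L hL) (by positivity : 0 ≤ 2 * c ^ 2)
  linarith

theorem SqSub.comb {a : ℕ} (hI : IsOpen I) (hf : IsSmooth I f) (hg : IsSmooth I g)
    (ht : t ∈ I) (bf : SqSub a t f) (bg : SqSub a t g) (c : ℝ) :
    SqSub a t (fun t ρ z => f t ρ z - c * g t ρ z) := by
  intro ε hε
  obtain ⟨L₁, h₁⟩ := bf (ε / 4) (by positivity)
  obtain ⟨L₂, h₂⟩ := bg (ε / (4 * (c ^ 2 + 1))) (by positivity)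
  refine ⟨max L₁ L₂, fun L hL => (sqInt_comb_le a hI hf hg ht c L).trans ?_⟩
  have e1 := h₁ L ((le_max_left _ _).trans hL)
  have e2 := mul_le_mul_of_nonneg_left (h₂ L ((le_max_right _ _).trans hL))
    (by positivity : 0 ≤ 2 * c ^ 2)
  have e3 : 2 * c ^ 2 * (ε / (4 * (c ^ 2 + 1)) * L ^ 2) ≤ ε / 2 * L ^ 2 := by
    rw [← mul_assoc]
    refine mul_le_mul_of_nonneg_right ?_ (sq_nonneg L)
    rw [← mul_div_assoc, div_le_div_iff₀ (by positivity) (by norm_num)]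
    nlinarith [sq_nonneg c]
  linarith

/-- Pointwise decay faster than `ρ ^ (-a/2)` makes the square integrals `o(L²)`. -/
theorem sqSub_of_decay (a : ℕ) (hI : IsOpen I) (hf : IsSmooth I f) (ht : t ∈ I)
    (h : ∀ ε > 0, ∃ R : ℝ, ∀ ρ > 0, ∀ z, R ≤ √(ρ ^ 2 + z ^ 2) → ρ ^ a * f t ρ z ^ 2 ≤ ε) :
    SqSub a t f := by
  intro ε hε
  obtain ⟨R, hR⟩ := h (ε / 4) (by positivity)
  set A := sqInt a R f t
  have hA : 0 ≤ A := sqInt_nonneg a R f t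
  refine ⟨max (max R 1) (2 * A / ε), fun L hL => ?_⟩
  have h1 : 1 ≤ L := ((le_max_right _ _).trans (le_max_left _ _)).trans hL
  have hRL : R ≤ L := ((le_max_left _ _).trans (le_max_left _ _)).trans hL
  have h2 : 2 * A / ε ≤ L := (le_max_right _ _).trans hL
  rw [div_le_iff₀ hε] at h2
  have hint := (isSmooth_sq_weight a hf).integrableOn_box hI ht (L := L)
  have hsplit := integral_inter_add_sdiff (measurableSet_box (L := R)) hint
  have hdiff : ∫ x in box L \ box R, x.1 ^ a * f t x.1 x.2 ^ 2 ≤ ε / 4 * (2 * L ^ 2) := by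
    have hb : ∀ x ∈ box L \ box R, ‖x.1 ^ a * f t x.1 x.2 ^ 2‖ ≤ ε / 4 := by
      intro x hx
      rw [Real.norm_of_nonneg (sq_weight_nonneg hx.1 _)]
      refine hR x.1 hx.1.1.1 x.2 ?_
      by_contra hlt
      push Not at hlt
      refine hx.2 ⟨⟨hx.1.1.1, lt_of_le_of_lt ?_ hlt⟩, abs_lt.1 (lt_of_le_of_lt ?_ hlt)⟩
      · exact Real.le_sqrt_of_sq_le (by nlinarith [sq_nonneg x.2])
      · exact Real.abs_le_sqrt (by nlinarith [sq_nonneg x.1])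
    have hv : volume (box L \ box R) < ∞ := (measure_mono sdiff_subset).trans_lt volume_box_lt_top
    refine (le_abs_self _).trans ((norm_setIntegral_le_of_norm_le_const hv hb).trans ?_)
    rw [← volume_box (by linarith : 0 ≤ L)]
    exact mul_le_mul_of_nonneg_left (measureReal_mono sdiff_subset volume_box_lt_top.ne)
      (by positivity)
  rw [inter_eq_self_of_subset_right (box_mono hRL)] at hsplit
  have e : sqInt a L f t = A + ∫ x in box L \ box R, x.1 ^ a * f t x.1 x.2 ^ 2 := hsplit.symm
  rw [e]
  nlinarith [mul_le_mul_of_nonneg_left h1 (by positivity : 0 ≤ L * ε)]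

/-! ### Functions of one variable with power bounds on their derivatives -/

/-- A comparison form of the mean value inequality. -/
theorem abs_sub_le_of_abs_deriv_le {u u' G G' : ℝ → ℝ} {x y : ℝ} (hxy : x ≤ y)
    (hu : ContinuousOn u (Icc x y)) (hG : ContinuousOn G (Icc x y))
    (hu' : ∀ s ∈ Ioo x y, HasDerivAt u (u' s) s) (hG' : ∀ s ∈ Ioo x y, HasDerivAt G (G' s) s)
    (h : ∀ s ∈ Ioo x y, |u' s| ≤ G' s) : |u y - u x| ≤ G y - G x := by
  have h1 : MonotoneOn (fun s => G s - u s) (Icc x y) := by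
    refine monotoneOn_of_hasDerivWithinAt_nonneg (convex_Icc x y) (hG.sub hu)
      (f' := fun s => G' s - u' s) ?_ ?_
    · intro s hs
      rw [interior_Icc] at hs ⊢
      exact ((hG' s hs).sub (hu' s hs)).hasDerivWithinAt
    · intro s hs
      rw [interior_Icc] at hs
      linarith [(abs_le.1 (h s hs)).2]
  have h2 : MonotoneOn (fun s => G s + u s) (Icc x y) := by
    refine monotoneOn_of_hasDerivWithinAt_nonneg (convex_Icc x y) (hG.add hu)
      (f' := fun s => G' s + u' s) ?_ ?_
    · intro s hs
      rw [interior_Icc] at hs ⊢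
      exact ((hG' s hs).add (hu' s hs)).hasDerivWithinAt
    · intro s hs
      rw [interior_Icc] at hs
      linarith [(abs_le.1 (h s hs)).1]
  have e1 := h1 (left_mem_Icc.2 hxy) (right_mem_Icc.2 hxy) hxy
  have e2 := h2 (left_mem_Icc.2 hxy) (right_mem_Icc.2 hxy) hxy
  simp only at e1 e2
  rw [abs_le]
  constructor <;> linarith

theorem abs_sub_le_rpow {u u' : ℝ → ℝ} {K α : ℝ} (hα : 0 < α) {x y : ℝ} (hx : 0 < x) (hxy : x ≤ y)
    (hu : ∀ s > 0, HasDerivAt u (u' s) s) (h : ∀ s ∈ Ioo x y, |u' s| ≤ K * s ^ (-α - 1)) :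
    |u y - u x| ≤ K / α * x ^ (-α) - K / α * y ^ (-α) := by
  have hG : ∀ s > 0, HasDerivAt (fun s : ℝ => -(K / α * s ^ (-α))) (K * s ^ (-α - 1)) s := by
    intro s hs
    have := ((Real.hasDerivAt_rpow_const (x := s) (p := -α) (Or.inl hs.ne')).const_mul (K / α)).neg
    refine this.congr_deriv ?_
    have e : K / α * (-α) = -K := by field_simp
    rw [← mul_assoc, e, neg_mul, neg_neg]
  have := abs_sub_le_of_abs_deriv_le hxy (u := u) (u' := u')
    (G := fun s : ℝ => -(K / α * s ^ (-α))) (G' := fun s => K * s ^ (-α - 1))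
    (fun s hs => (hu s (hx.trans_le hs.1)).continuousAt.continuousWithinAt)
    (fun s hs => (hG s (hx.trans_le hs.1)).continuousAt.continuousWithinAt)
    (fun s hs => hu s (hx.trans hs.1)) (fun s hs => hG s (hx.trans hs.1)) h
  linarith

theorem abs_le_rpow_of_tendsto {u u' : ℝ → ℝ} {K α : ℝ} (hα : 0 < α)
    (hu : ∀ s > 0, HasDerivAt u (u' s) s) (h : ∀ s > 0, |u' s| ≤ K * s ^ (-α - 1))
    (hlim : Tendsto u atTop (𝓝 0)) {x : ℝ} (hx : 0 < x) : |u x| ≤ K / α * x ^ (-α) := by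
  have hK : 0 ≤ K := by
    have := (abs_nonneg _).trans (h 1 one_pos)
    rwa [Real.one_rpow, mul_one] at this
  have h1 : ∀ y ≥ x, |u y - u x| ≤ K / α * x ^ (-α) := by
    intro y hy
    refine (abs_sub_le_rpow hα hx hy hu (fun s hs => h s (hx.trans hs.1))).trans ?_
    have : 0 ≤ K / α * y ^ (-α) :=
      mul_nonneg (div_nonneg hK hα.le) (Real.rpow_nonneg (hx.le.trans hy) _)
    linarith
  have h2 : Tendsto (fun y => |u y - u x|) atTop (𝓝 |0 - u x|) := (hlim.sub_const _).abs
  rw [zero_sub, abs_neg] at h2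
  exact le_of_tendsto h2 (eventually_atTop.2 ⟨x, h1⟩)

theorem abs_le_rpow_near_zero {u u' : ℝ → ℝ} {K α A : ℝ} (hα : 0 < α) (hK : 0 ≤ K)
    (hu : ∀ s > 0, HasDerivAt u (u' s) s) (h : ∀ s ∈ Ioc (0 : ℝ) 1, |u' s| ≤ K * s ^ (-α - 1))
    (hA : |u 1| ≤ A) {x : ℝ} (hx : x ∈ Ioc (0 : ℝ) 1) : |u x| ≤ (A + K / α) * x ^ (-α) := by
  have h1 := abs_sub_le_rpow hα hx.1 hx.2 hu (fun s hs => h s ⟨hx.1.trans hs.1, hs.2.le⟩)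
  rw [Real.one_rpow] at h1
  have h2 : 1 ≤ x ^ (-α) := Real.one_le_rpow_of_pos_of_le_one_of_nonpos hx.1 hx.2 (by linarith)
  have h3 : |u x| ≤ |u 1| + |u 1 - u x| := by
    have := abs_sub_abs_le_abs_sub (u x) (u 1)
    rw [abs_sub_comm] at this
    linarith
  have h4 : 0 ≤ K / α := div_nonneg hK hα.le
  have h5 : 0 ≤ A := (abs_nonneg _).trans hA
  nlinarith

theorem abs_zero_le {u u' : ℝ → ℝ} {K A : ℝ} (hc : Continuous u)
    (hu : ∀ s > 0, HasDerivAt u (u' s) s)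
    (h : ∀ s ∈ Ioc (0 : ℝ) 1, |u' s| ≤ K * s ^ (-(1 / 2) : ℝ)) (hA : |u 1| ≤ A) :
    |u 0| ≤ A + 2 * K := by
  have hG : ∀ s > 0, HasDerivAt (fun s : ℝ => 2 * K * s ^ (1 / 2 : ℝ)) (K * s ^ (-(1 / 2) : ℝ)) s := by
    intro s hs
    have := (Real.hasDerivAt_rpow_const (x := s) (p := 1 / 2) (Or.inl hs.ne')).const_mul (2 * K)
    refine this.congr_deriv ?_
    rw [show (1 / 2 - 1 : ℝ) = -(1 / 2) by norm_num]
    ring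
  have h1 := abs_sub_le_of_abs_deriv_le zero_le_one (u := u) (u' := u')
    (G := fun s : ℝ => 2 * K * s ^ (1 / 2 : ℝ)) (G' := fun s => K * s ^ (-(1 / 2) : ℝ))
    hc.continuousOn
    (continuousOn_const.mul (continuousOn_id.rpow_const fun s _ => Or.inr (by norm_num)))
    (fun s hs => hu s hs.1) (fun s hs => hG s hs.1) (fun s hs => h s ⟨hs.1, hs.2.le⟩)
  rw [Real.one_rpow, Real.zero_rpow (by norm_num), mul_zero, sub_zero, mul_one] at h1
  have h3 := abs_sub_abs_le_abs_sub (u 0) (u 1)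
  rw [abs_sub_comm] at h3
  linarith

/-- In each interval `[s, s + 1]` the derivative takes the value `u (s + 1) - u s`, which tends to
`0`, and the bound on `u''` limits its variation. -/
theorem tendsto_deriv_zero {u u' u'' : ℝ → ℝ} {K α : ℝ} (hα : 0 < α)
    (hu : ∀ s > 0, HasDerivAt u (u' s) s) (hu' : ∀ s > 0, HasDerivAt u' (u'' s) s)
    (h : ∀ s > 0, |u'' s| ≤ K * s ^ (-α - 1)) (hlim : Tendsto u atTop (𝓝 0)) :
    Tendsto u' atTop (𝓝 0) := by
  have hb : ∀ s > 0, |u' s| ≤ |u (s + 1) - u s| + K / α * s ^ (-α) := by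
    intro s hs
    have hK : 0 ≤ K := by
      have := (abs_nonneg _).trans (h 1 one_pos)
      rwa [Real.one_rpow, mul_one] at this
    obtain ⟨ξ, hξ, hd⟩ := exists_hasDerivAt_eq_slope u u' (by linarith : s < s + 1)
      (fun x hx => (hu x (hs.trans_le hx.1)).continuousAt.continuousWithinAt)
      (fun x hx => hu x (hs.trans hx.1))
    have h1 := abs_sub_le_rpow hα hs hξ.1.le hu' (fun x hx => h x (hs.trans hx.1))
    have h2 : 0 ≤ K / α * ξ ^ (-α) :=
      mul_nonneg (div_nonneg hK hα.le) (Real.rpow_nonneg (hs.le.trans hξ.1.le) _)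
    rw [add_sub_cancel_left, div_one] at hd
    rw [← hd]
    have h3 := abs_sub_abs_le_abs_sub (u' s) (u' ξ)
    rw [abs_sub_comm] at h3
    linarith
  have hl : Tendsto (fun s => |u (s + 1) - u s| + K / α * s ^ (-α)) atTop (𝓝 0) := by
    have h1 : Tendsto (fun s => u (s + 1)) atTop (𝓝 0) :=
      hlim.comp (tendsto_atTop_add_const_right atTop 1 tendsto_id)
    have h2 := (h1.sub hlim).abs.add ((tendsto_rpow_neg_atTop hα).const_mul (K / α))
    simpa using h2
  exact squeeze_zero_norm' (eventually_atTop.2 ⟨1, fun s hs => hb s (by linarith)⟩) hl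

/-- Integrating the bound on `u₁` from infinity controls `u 1`; integrating the one on `u₂` from `1`
towards `0` makes `u₁` integrable there and controls `u 0`. -/
theorem abs_zero_le_of_two {u u₁ u₂ : ℝ → ℝ} {K : ℝ} (hc : Continuous u)
    (h0 : ∀ s > 0, HasDerivAt u (u₁ s) s) (h1 : ∀ s > 0, HasDerivAt u₁ (u₂ s) s)
    (b1 : ∀ s > 0, |u₁ s| ≤ K * s ^ (-(3 / 2) : ℝ)) (b2 : ∀ s > 0, |u₂ s| ≤ K * s ^ (-(3 / 2) : ℝ))
    (hlim : Tendsto u atTop (𝓝 0)) : |u 0| ≤ 8 * K := by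
  have hK : 0 ≤ K := by
    have := (abs_nonneg _).trans (b1 1 one_pos)
    rwa [Real.one_rpow, mul_one] at this
  have e : (-(1 / 2) - 1 : ℝ) = -(3 / 2) := by norm_num
  have hu1 : |u 1| ≤ 2 * K := by
    have := abs_le_rpow_of_tendsto (α := 1 / 2) (by norm_num) h0 (by rwa [e]) hlim one_pos
    rw [Real.one_rpow] at this
    linarith
  have hu11 : |u₁ 1| ≤ K := by simpa using b1 1 one_pos
  have hn := abs_zero_le hc h0 (K := 3 * K) (fun s hs => by
    have := abs_le_rpow_near_zero (α := 1 / 2) (by norm_num) hK h1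
      (fun s hs => by rw [e]; exact b2 s hs.1) hu11 hs
    refine this.trans (le_of_eq ?_)
    ring) hu1
  linarith

/-- The analogue of `abs_zero_le_of_two` for the third and fourth derivatives. The bound on `u₃`
suffices near infinity, and the one on `u₄` near `0`. -/
theorem abs_zero_le_of_four {u u₁ u₂ u₃ u₄ : ℝ → ℝ} {K : ℝ} (hc : Continuous u)
    (h0 : ∀ s > 0, HasDerivAt u (u₁ s) s) (h1 : ∀ s > 0, HasDerivAt u₁ (u₂ s) s)
    (h2 : ∀ s > 0, HasDerivAt u₂ (u₃ s) s) (h3 : ∀ s > 0, HasDerivAt u₃ (u₄ s) s)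
    (b3 : ∀ s > 0, |u₃ s| ≤ K * s ^ (-(7 / 2) : ℝ)) (b4 : ∀ s > 0, |u₄ s| ≤ K * s ^ (-(7 / 2) : ℝ))
    (hlim : Tendsto u atTop (𝓝 0)) (hlim1 : Tendsto u₁ atTop (𝓝 0)) : |u 0| ≤ 16 * K := by
  have hK : 0 ≤ K := by
    have := (abs_nonneg _).trans (b3 1 one_pos)
    rwa [Real.one_rpow, mul_one] at this
  have e5 : (-(5 / 2) - 1 : ℝ) = -(7 / 2) := by norm_num
  have e3 : (-(3 / 2) - 1 : ℝ) = -(5 / 2) := by norm_num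
  have e1 : (-(1 / 2) - 1 : ℝ) = -(3 / 2) := by norm_num
  have hlim2 : Tendsto u₂ atTop (𝓝 0) :=
    tendsto_deriv_zero (α := 5 / 2) (by norm_num) h1 h2 (by rwa [e5]) hlim1
  -- integrate from infinity
  have c2 : ∀ s > 0, |u₂ s| ≤ K * s ^ (-(5 / 2) : ℝ) := fun s hs => by
    refine (abs_le_rpow_of_tendsto (α := 5 / 2) (by norm_num) h2 (by rwa [e5]) hlim2 hs).trans ?_
    refine mul_le_mul_of_nonneg_right ?_ (Real.rpow_nonneg hs.le _)
    linarith
  have c1 : ∀ s > 0, |u₁ s| ≤ K * s ^ (-(3 / 2) : ℝ) := fun s hs => by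
    refine (abs_le_rpow_of_tendsto (α := 3 / 2) (by norm_num) h1 (by rwa [e3]) hlim1 hs).trans ?_
    refine mul_le_mul_of_nonneg_right ?_ (Real.rpow_nonneg hs.le _)
    linarith
  have hu1 : |u 1| ≤ 2 * K := by
    have := abs_le_rpow_of_tendsto (α := 1 / 2) (by norm_num) h0 (by rwa [e1]) hlim one_pos
    rw [Real.one_rpow] at this
    linarith
  have a1 : |u₁ 1| ≤ K := by simpa using c1 1 one_pos
  have a2 : |u₂ 1| ≤ K := by simpa using c2 1 one_pos
  have a3 : |u₃ 1| ≤ K := by simpa using b3 1 one_pos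
  -- integrate towards the origin
  have d3 : ∀ s ∈ Ioc (0 : ℝ) 1, |u₃ s| ≤ 2 * K * s ^ (-(5 / 2) : ℝ) := fun s hs => by
    refine (abs_le_rpow_near_zero (α := 5 / 2) (by norm_num) hK h3
      (fun s hs => by rw [e5]; exact b4 s hs.1) a3 hs).trans ?_
    refine mul_le_mul_of_nonneg_right ?_ (Real.rpow_nonneg hs.1.le _)
    linarith
  have d2 : ∀ s ∈ Ioc (0 : ℝ) 1, |u₂ s| ≤ 3 * K * s ^ (-(3 / 2) : ℝ) := fun s hs => by
    refine (abs_le_rpow_near_zero (K := 2 * K) (α := 3 / 2) (by norm_num) (by positivity) h2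
      (fun s hs => by rw [e3]; exact d3 s hs) a2 hs).trans ?_
    refine mul_le_mul_of_nonneg_right ?_ (Real.rpow_nonneg hs.1.le _)
    linarith
  have hn := abs_zero_le hc h0 (K := 7 * K) (fun s hs => by
    refine (abs_le_rpow_near_zero (K := 3 * K) (α := 1 / 2) (by norm_num) (by positivity) h1
      (fun s hs => by rw [e1]; exact d2 s hs) a1 hs).trans (le_of_eq ?_)
    ring) hu1
  linarith

/-! ### Means over squares with a vertex direction pointing away from the axis -/

/-- The square `[1, 2] × [0, 1]`. -/
def refSquare : Set (ℝ × ℝ) := Icc 1 2 ×ˢ Icc 0 1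

theorem isCompact_refSquare : IsCompact refSquare := isCompact_Icc.prod isCompact_Icc

theorem measurableSet_refSquare : MeasurableSet refSquare := isCompact_refSquare.measurableSet

theorem volume_refSquare : volume.real refSquare = 1 := by
  rw [refSquare, Measure.real, Measure.volume_eq_prod, Measure.prod_prod, Real.volume_Icc,
    Real.volume_Icc]
  norm_num

/-- The moment `∫ aⁱ bʲ f(ρ + λ a, z + λ b) da db` over the reference square, as a function of the
scale `λ`. The points `(ρ + λ a, z + λ b)` stay at distance at least `λ` from the axis. -/
noncomputable def moment (f : Field) (t ρ z : ℝ) (i j : ℕ) (l : ℝ) : ℝ :=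
  ∫ x in refSquare, x.1 ^ i * x.2 ^ j * f t (ρ + l * x.1) (z + l * x.2)

theorem isSmooth_momentIntegrand (hI : IsOpen I) (hf : IsSmooth I f) (ht : t ∈ I) (ρ z : ℝ)
    (i j : ℕ) :
    IsSmooth univ (fun l a b => a ^ i * b ^ j * f t (ρ + l * a) (z + l * b)) := by
  refine ((isSmooth_rho.pow i).mul (isSmooth_z.pow j)).mul ?_
  refine ContDiff.contDiffOn (contDiff_iff_contDiffAt.2 fun x => ?_)
  exact (hf.contDiffAt hI ht (ρ + x.1 * x.2.1) (z + x.1 * x.2.2)).comp x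
    (f := fun x : ℝ × ℝ × ℝ => (t, ρ + x.1 * x.2.1, z + x.1 * x.2.2))
    (ContDiff.contDiffAt (by fun_prop))

theorem integrableOn_moment (hI : IsOpen I) (hf : IsSmooth I f) (ht : t ∈ I) (ρ z : ℝ)
    (i j : ℕ) (l : ℝ) :
    IntegrableOn (fun x : ℝ × ℝ => x.1 ^ i * x.2 ^ j * f t (ρ + l * x.1) (z + l * x.2)) refSquare :=
  (((isSmooth_momentIntegrand hI hf ht ρ z i j).continuous_space isOpen_univ
    (mem_univ l)).continuousOn).integrableOn_compact isCompact_refSquare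

theorem hasDerivAt_moment (hI : IsOpen I) (hf : IsSmooth I f) (ht : t ∈ I) (ρ z : ℝ)
    (i j : ℕ) (l : ℝ) :
    HasDerivAt (moment f t ρ z i j)
      (moment (dρ f) t ρ z (i + 1) j l + moment (dz f) t ρ z i (j + 1) l) l := by
  have h := hasDerivAt_setIntegral_of_compact isCompact_refSquare subset_rfl
    measurableSet_refSquare isOpen_univ (isSmooth_momentIntegrand hI hf ht ρ z i j) (mem_univ l)
  have e : ∫ x in refSquare, dt (fun l a b => a ^ i * b ^ j * f t (ρ + l * a) (z + l * b)) l x.1 x.2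
      = moment (dρ f) t ρ z (i + 1) j l + moment (dz f) t ρ z i (j + 1) l := by
    rw [moment, moment, ← integral_add (integrableOn_moment hI (hf.dρ hI) ht ρ z (i + 1) j l)
      (integrableOn_moment hI (hf.dz hI) ht ρ z i (j + 1) l)]
    refine integral_congr_ae (ae_of_all _ fun x => ?_)
    have hin : HasDerivAt (fun s : ℝ => (t, ρ + s * x.1, z + s * x.2)) (0, 1 * x.1, 1 * x.2) l :=
      (hasDerivAt_const l t).prodMk ((((hasDerivAt_id l).mul_const x.1).const_add ρ).prodMk
        (((hasDerivAt_id l).mul_const x.2).const_add z))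
    have h1 := ((hf.hasFDerivAt hI ht (ρ + l * x.1) (z + l * x.2)).comp_hasDerivAt l hin).const_mul
      (x.1 ^ i * x.2 ^ j)
    have h2 : dt (fun l a b => a ^ i * b ^ j * f t (ρ + l * a) (z + l * b)) l x.1 x.2 = _ := h1.deriv
    simp only [h2]
    have h3 : ((0 : ℝ), 1 * x.1, 1 * x.2) = x.1 • ((0 : ℝ), (1 : ℝ), (0 : ℝ))
        + x.2 • ((0 : ℝ), (0 : ℝ), (1 : ℝ)) := by simp
    rw [h3, map_add, map_smul, map_smul, ← hf.dρ_eq hI ht, ← hf.dz_eq hI ht]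
    simp only [smul_eq_mul]
    ring
  rw [← e]
  exact h

theorem moment_zero (f : Field) (t ρ z : ℝ) : moment f t ρ z 0 0 0 = f t ρ z := by
  simp [moment, volume_refSquare]

/-- On the square, `l ^ a` is a lower bound for the weight `(ρ + l x) ^ a`, and the scaling
contributes `l ^ 2`. -/
theorem sq_integral_refSquare_le (hI : IsOpen I) (hf : IsSmooth I f) (ht : t ∈ I) {ρ : ℝ}
    (hρ : 0 ≤ ρ) (z : ℝ) {a : ℕ} {N : ℝ} (h : SqBdd a t f N) {l : ℝ} (hl : 0 < l) :
    ∫ x in refSquare, f t (ρ + l * x.1) (z + l * x.2) ^ 2 ≤ (l ^ (a + 2))⁻¹ * N := by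
  set F : ℝ × ℝ → ℝ := fun x => x.1 ^ a * f t x.1 x.2 ^ 2 with hF
  have hFc : Continuous F := (isSmooth_sq_weight a hf).continuous_space hI ht
  set L := ρ + |z| + 2 * l + 1 with hL
  have hL0 : 0 < L := by positivity
  have hmem : ∀ x ∈ refSquare, (ρ, z) + l • x ∈ box L := by
    rintro ⟨x, y⟩ ⟨⟨hx1, hx2⟩, hy1, hy2⟩
    simp only at hx1 hx2 hy1 hy2
    have := abs_le.1 (le_refl |z|)
    refine ⟨⟨?_, ?_⟩, ?_, ?_⟩ <;> simp only [Prod.fst_add, Prod.snd_add, Prod.smul_fst,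
      Prod.smul_snd, smul_eq_mul] <;> nlinarith
  have step1 : ∫ x in refSquare, f t (ρ + l * x.1) (z + l * x.2) ^ 2
      ≤ ∫ x in refSquare, (l ^ a)⁻¹ * F ((ρ, z) + l • x) := by
    refine setIntegral_mono_on ?_ ?_ measurableSet_refSquare fun x hx => ?_
    · have hc : Continuous fun x : ℝ × ℝ => f t (ρ + l * x.1) (z + l * x.2) ^ 2 :=
        ((hf.continuous_space hI ht).comp (by fun_prop :
          Continuous fun x : ℝ × ℝ => (ρ + l * x.1, z + l * x.2))).pow 2
      exact hc.continuousOn.integrableOn_compact isCompact_refSquare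
    · exact (continuous_const.mul (hFc.comp (by fun_prop))).continuousOn.integrableOn_compact
        isCompact_refSquare
    · simp only [hF, Prod.fst_add, Prod.snd_add, Prod.smul_fst, Prod.smul_snd, smul_eq_mul]
      rw [← mul_assoc]
      refine le_mul_of_one_le_left (sq_nonneg _) ?_
      rw [inv_mul_eq_div, one_le_div (by positivity)]
      refine pow_le_pow_left₀ hl.le ?_ a
      nlinarith [hx.1.1]
  have step2 : ∫ x in refSquare, F ((ρ, z) + l • x) ≤ (l ^ 2)⁻¹ * N := by
    have hs := Measure.setIntegral_comp_smul_of_pos (volume : Measure (ℝ × ℝ))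
      (fun y => F ((ρ, z) + y)) refSquare hl
    have hfr : Module.finrank ℝ (ℝ × ℝ) = 2 := by simp
    rw [hfr, smul_eq_mul] at hs
    rw [hs]
    refine mul_le_mul_of_nonneg_left ?_ (by positivity)
    have hmp := measurePreserving_add_left (volume : Measure (ℝ × ℝ)) (ρ, z)
    have hemb := measurableEmbedding_addLeft ((ρ, z) : ℝ × ℝ)
    have hpre := hmp.setIntegral_preimage_emb hemb F (box L)
    have hsub : (fun x => l • x) '' refSquare ⊆ (fun y => (ρ, z) + y) ⁻¹' box L := by
      rintro _ ⟨x, hx, rfl⟩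
      exact hmem x hx
    refine le_trans ?_ (hpre.trans_le (h L hL0))
    refine setIntegral_mono_set ?_ ?_ (LE.le.eventuallyLE hsub)
    · exact (hmp.integrableOn_comp_preimage hemb).2 (integrableOn_box hFc)
    · refine (ae_restrict_iff' (hemb.measurable measurableSet_box)).2 (ae_of_all _ fun y hy => ?_)
      exact sq_weight_nonneg hy _
  rw [integral_const_mul] at step1
  refine step1.trans ((mul_le_mul_of_nonneg_left step2 (by positivity)).trans (le_of_eq ?_))
  rw [pow_add, mul_inv, mul_assoc]

/-- The Cauchy–Schwarz inequality on the square. -/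
theorem abs_moment_le (hI : IsOpen I) (hf : IsSmooth I f) (ht : t ∈ I) {ρ : ℝ}
    (hρ : 0 ≤ ρ) (z : ℝ) {a : ℕ} {N : ℝ} (hN : 0 < N) (h : SqBdd a t f N) {l : ℝ} (hl : 0 < l)
    (i j : ℕ) : |moment f t ρ z i j l| ≤ 2 ^ i * √N * l ^ (-((a + 2) / 2) : ℝ) := by
  have hE := sq_integral_refSquare_le hI hf ht hρ z h hl
  set E := (l ^ (a + 2))⁻¹ * N with hEdef
  have hE0 : 0 < E := by positivity
  have hsq : √E = √N * l ^ (-((a + 2) / 2) : ℝ) := by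
    rw [hEdef, mul_comm, Real.sqrt_mul hN.le, ← Real.rpow_natCast, ← Real.rpow_neg hl.le,
      Real.sqrt_eq_rpow (l ^ _), ← Real.rpow_mul hl.le]
    congr 2
    push_cast
    ring
  rw [mul_assoc, ← hsq]
  have hc : Continuous fun x : ℝ × ℝ => f t (ρ + l * x.1) (z + l * x.2) :=
    (hf.continuous_space hI ht).comp (by fun_prop :
          Continuous fun x : ℝ × ℝ => (ρ + l * x.1, z + l * x.2))
  have hint : ∀ {h : ℝ × ℝ → ℝ}, Continuous h → IntegrableOn h refSquare := fun hh =>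
    hh.continuousOn.integrableOn_compact isCompact_refSquare
  have hs0 : 0 < √E := Real.sqrt_pos.2 hE0
  have hc3 : Continuous fun x : ℝ × ℝ => (2 * √E)⁻¹ * f t (ρ + l * x.1) (z + l * x.2) ^ 2 :=
    continuous_const.mul (hc.pow 2)
  have hc2 : Continuous fun x : ℝ × ℝ =>
      (2 : ℝ) ^ i * ((2 * √E)⁻¹ * f t (ρ + l * x.1) (z + l * x.2) ^ 2 + √E / 2) :=
    continuous_const.mul ((continuous_const.mul (hc.pow 2)).add continuous_const)
  have h1 : |moment f t ρ z i j l| ≤ ∫ x in refSquare,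
      2 ^ i * ((2 * √E)⁻¹ * f t (ρ + l * x.1) (z + l * x.2) ^ 2 + √E / 2) := by
    refine (abs_integral_le_integral_abs).trans ?_
    refine setIntegral_mono_on (integrableOn_moment hI hf ht ρ z i j l).norm
      (hint hc2) measurableSet_refSquare fun x hx => ?_
    obtain ⟨⟨hx1, hx2⟩, hx3, hx4⟩ := hx
    rw [abs_mul, abs_mul, abs_pow, abs_pow, abs_of_nonneg (by linarith : 0 ≤ x.1),
      abs_of_nonneg hx3]
    have e1 : x.1 ^ i * x.2 ^ j ≤ 2 ^ i * 1 :=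
      mul_le_mul (pow_le_pow_left₀ (by linarith) hx2 i) (pow_le_one₀ hx3 hx4)
        (pow_nonneg hx3 j) (by positivity)
    rw [mul_one] at e1
    refine mul_le_mul e1 ?_ (abs_nonneg _) (by positivity)
    rw [← sq_abs]
    generalize |f t (ρ + l * x.1) (z + l * x.2)| = y
    have : (2 * √E)⁻¹ * y ^ 2 + √E / 2 - y = (2 * √E)⁻¹ * (y - √E) ^ 2 := by field_simp; ring
    have h2 : 0 ≤ (2 * √E)⁻¹ * (y - √E) ^ 2 := by positivity
    linarith
  refine h1.trans ?_
  rw [integral_const_mul, integral_add (hint hc3) (hint continuous_const),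
    integral_const_mul, setIntegral_const, volume_refSquare, one_smul]
  refine mul_le_mul_of_nonneg_left ?_ (by positivity)
  have h3 : (2 * √E)⁻¹ * ∫ x in refSquare, f t (ρ + l * x.1) (z + l * x.2) ^ 2
      ≤ (2 * √E)⁻¹ * E := mul_le_mul_of_nonneg_left hE (by positivity)
  have h4 : (2 * √E)⁻¹ * E = √E / 2 := by
    nth_rewrite 2 [← Real.mul_self_sqrt hE0.le]
    field_simp
  linarith

theorem tendsto_moment_zero {ρ : ℝ} (hρ : 0 ≤ ρ) (z : ℝ)
    (h : ∀ ε > 0, ∃ R : ℝ, ∀ ρ > 0, ∀ z, R ≤ √(ρ ^ 2 + z ^ 2) → |f t ρ z| ≤ ε) (i j : ℕ) :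
    Tendsto (moment f t ρ z i j) atTop (𝓝 0) := by
  refine Metric.tendsto_atTop.2 fun ε hε => ?_
  obtain ⟨R, hR⟩ := h (ε / (2 * 2 ^ i)) (by positivity)
  refine ⟨max R 1, fun l hl => ?_⟩
  have h1 : 1 ≤ l := (le_max_right _ _).trans hl
  rw [dist_zero_right]
  have hb : ∀ x ∈ refSquare,
      ‖x.1 ^ i * x.2 ^ j * f t (ρ + l * x.1) (z + l * x.2)‖ ≤ ε / 2 := by
    rintro x ⟨⟨hx1, hx2⟩, hx3, hx4⟩
    have hpos : l ≤ ρ + l * x.1 := by nlinarith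
    have hf := hR (ρ + l * x.1) (by linarith) (z + l * x.2)
      (((le_max_left _ _).trans hl).trans (hpos.trans
        (Real.le_sqrt_of_sq_le (by nlinarith [sq_nonneg (z + l * x.2)]))))
    rw [norm_mul, norm_mul, norm_pow, norm_pow, Real.norm_of_nonneg (by linarith),
      Real.norm_of_nonneg hx3, Real.norm_eq_abs]
    have e1 : x.1 ^ i * x.2 ^ j ≤ 2 ^ i * 1 :=
      mul_le_mul (pow_le_pow_left₀ (by linarith) hx2 i) (pow_le_one₀ hx3 hx4)
        (pow_nonneg hx3 j) (by positivity)
    rw [mul_one] at e1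
    calc _ ≤ 2 ^ i * (ε / (2 * 2 ^ i)) := mul_le_mul e1 hf (abs_nonneg _) (by positivity)
      _ = ε / 2 := by field_simp
  have := norm_setIntegral_le_of_norm_le_const (μ := volume) isCompact_refSquare.measure_lt_top hb
  rw [volume_refSquare, mul_one] at this
  exact this.trans_lt (by linarith)

end LinGrav

namespace LinGrav

variable {I : Set ℝ} {f g : Field} {t ρ z L : ℝ}

/-! ### Caccioppoli estimates -/

/-- The density `U` is bounded by `V` up to a divergence, when localized with the square of a
cutoff `φ`, at the cost of a multiple `W` of `|∂φ|²`. -/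
def LocalEstimate (I : Set ℝ) (t : ℝ) (U V W : Field) : Prop :=
  ∃ X Y : Field, IsSmooth I X ∧ IsSmooth I Y ∧ (∀ z, X t 0 z = 0) ∧
    ∀ φ : Field, IsSmooth I φ → ∀ ρ > 0, ∀ z,
      φ t ρ z ^ 2 * U t ρ z ≤ φ t ρ z ^ 2 * V t ρ z
        + (dρ φ t ρ z ^ 2 + dz φ t ρ z ^ 2) * W t ρ z
        + (dρ (fun t ρ z => φ t ρ z ^ 2 * X t ρ z) t ρ z
          + dz (fun t ρ z => φ t ρ z ^ 2 * Y t ρ z) t ρ z)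

/-- A local estimate with a cutoff of scale `R`: the divergence integrates to zero. -/
theorem LocalEstimate.exists_bound (hI : IsOpen I) {U V W : Field} (hU : IsSmooth I U)
    (hV : IsSmooth I V) (hW : IsSmooth I W) (ht : t ∈ I) (pU : ∀ ρ > 0, ∀ z, 0 ≤ U t ρ z)
    (pV : ∀ ρ > 0, ∀ z, 0 ≤ V t ρ z) (pW : ∀ ρ > 0, ∀ z, 0 ≤ W t ρ z)
    (h : LocalEstimate I t U V W) :
    ∃ M > 0, ∀ R ≥ 2, boxInt (R / 4) U t ≤
      boxInt (2 * R) V t + M / R ^ 2 * boxInt (2 * R) W t := by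
  obtain ⟨X, Y, hX, hY, hX0, hest⟩ := h
  obtain ⟨M, hM, hb⟩ := exists_cutoff_bounds
  refine ⟨2 * M ^ 2, by positivity, fun R hR => ?_⟩
  have hR0 : 0 < R := by linarith
  set φ := cutoff R 0 0 with hφdef
  have hφ : IsSmooth I φ := isSmooth_cutoff R 0 0
  have sφ : ∀ {F : Field}, IsSmooth I F → IsSmooth I (fun t ρ z => φ t ρ z ^ 2 * F t ρ z) :=
    fun hF => (hφ.pow 2).mul hF
  have hgr : IsSmooth I (fun t ρ z => dρ φ t ρ z ^ 2 + dz φ t ρ z ^ 2) :=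
    ((hφ.dρ hI).pow 2).add ((hφ.dz hI).pow 2)
  have hdiv : boxInt (2 * R) (fun t ρ z => dρ (fun t ρ z => φ t ρ z ^ 2 * X t ρ z) t ρ z
      + dz (fun t ρ z => φ t ρ z ^ 2 * Y t ρ z) t ρ z) t = 0 := by
    have hz : ∀ ρ z : ℝ, 2 * R ≤ √(1 + ρ ^ 2 + z ^ 2) → φ t ρ z = 0 := fun ρ z h =>
      (cutoff_eq_zero (R := R) (s := 0) (κ := 0) (t := t) hR0 (by simpa using h)).1
    refine boxInt_div_eq_zero hI (sφ hX) (sφ hY) ht (by linarith) ?_ ?_ ?_ ?_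
    · intro z
      simp only [hX0, mul_zero]
    · intro z
      simp only [hz (2 * R) z ((le_abs_self _).trans (abs_rho_le_bracket _ _))]
      ring
    · intro ρ
      simp only [hz ρ (2 * R) ((le_abs_self _).trans (abs_z_le_bracket _ _))]
      ring
    · intro ρ
      simp only [hz ρ (-(2 * R)) ((neg_le_abs _).trans' (by simp) |>.trans (abs_z_le_bracket _ _))]
      ring
  have h1 : boxInt (R / 4) U t ≤ boxInt (2 * R) (fun t ρ z => φ t ρ z ^ 2 * U t ρ z) t := by
    have e : boxInt (R / 4) U t = boxInt (R / 4) (fun t ρ z => φ t ρ z ^ 2 * U t ρ z) t := by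
      refine boxInt_congr fun x hx => ?_
      have := bracket_le_of_mem_box hx
      have hone : φ t x.1 x.2 = 1 := cutoff_eq_one hR0 (by
        rw [zero_mul, add_zero]; linarith)
      rw [hone, one_pow, one_mul]
    rw [e]
    exact boxInt_mono_set hI (sφ hU) ht (by linarith) fun x hx =>
      mul_nonneg (sq_nonneg _) (pU x.1 hx.1.1 x.2)
  have h2 : boxInt (2 * R) (fun t ρ z => φ t ρ z ^ 2 * U t ρ z) t ≤
      boxInt (2 * R) (fun t ρ z => φ t ρ z ^ 2 * V t ρ z
        + (dρ φ t ρ z ^ 2 + dz φ t ρ z ^ 2) * W t ρ z) t := by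
    refine (boxInt_mono hI (sφ hU) ((((sφ hV).add (hgr.mul hW))).add
      (((sφ hX).dρ hI).add ((sφ hY).dz hI))) ht fun x hx => hest φ hφ x.1 hx.1.1 x.2).trans ?_
    rw [boxInt_add hI ((sφ hV).add (hgr.mul hW)) (((sφ hX).dρ hI).add ((sφ hY).dz hI)) ht, hdiv,
      add_zero]
  have h3 : boxInt (2 * R) (fun t ρ z => φ t ρ z ^ 2 * V t ρ z
        + (dρ φ t ρ z ^ 2 + dz φ t ρ z ^ 2) * W t ρ z) t ≤
      boxInt (2 * R) (fun t ρ z => V t ρ z + 2 * M ^ 2 / R ^ 2 * W t ρ z) t := by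
    refine boxInt_mono hI ((sφ hV).add (hgr.mul hW))
      (hV.add ((isSmooth_const (2 * M ^ 2 / R ^ 2)).mul hW)) ht fun x hx => ?_
    refine add_le_add (mul_le_of_le_one_left (pV _ hx.1.1 _)
      (pow_le_one₀ (cutoff_nonneg _ _ _) (cutoff_le_one _ _ _)))
      (mul_le_mul_of_nonneg_right ?_ (pW _ hx.1.1 _))
    obtain ⟨b1, b2, -, -⟩ := hb R (by linarith) 0 0 t x.1 x.2
    have e1 := pow_le_pow_left₀ (abs_nonneg _) b1 2
    have e2 := pow_le_pow_left₀ (abs_nonneg _) b2 2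
    rw [sq_abs] at e1 e2
    rw [div_pow] at e1 e2
    rw [mul_div_assoc]
    linarith
  have h4 := boxInt_add (L := 2 * R) hI hV ((isSmooth_const (2 * M ^ 2 / R ^ 2)).mul hW) ht
  rw [boxInt_const_mul] at h4
  exact h1.trans (h2.trans (h3.trans_eq h4))

section

variable {a : ℕ} {A B N : ℝ} {D l F : Field}

theorem LocalEstimate.exists_sqInt_bound (hI : IsOpen I) (hD : IsSmooth I D) (hl : IsSmooth I l)
    (hF : IsSmooth I F) (ht : t ∈ I) (hA : 0 ≤ A) (hB : 0 ≤ B)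
    (h : LocalEstimate I t (fun t ρ z => ρ ^ a * D t ρ z ^ 2)
      (fun t ρ z => A * (ρ ^ a * l t ρ z ^ 2)) (fun t ρ z => B * (ρ ^ a * F t ρ z ^ 2))) :
    ∃ M > 0, ∀ R ≥ 2, sqInt a (R / 4) D t ≤
      A * sqInt a (2 * R) l t + M / R ^ 2 * sqInt a (2 * R) F t := by
  have pos : ∀ (F : Field), ∀ ρ > 0, ∀ z, 0 ≤ ρ ^ a * F t ρ z ^ 2 := fun F ρ hρ z => by positivity
  obtain ⟨M, hM, hb⟩ := h.exists_bound hI (isSmooth_sq_weight a hD)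
    ((isSmooth_const A).mul (isSmooth_sq_weight a hl))
    ((isSmooth_const B).mul (isSmooth_sq_weight a hF)) ht (pos D)
    (fun ρ hρ z => mul_nonneg hA (pos l ρ hρ z)) (fun ρ hρ z => mul_nonneg hB (pos F ρ hρ z))
  refine ⟨M * (B + 1), by positivity, fun R hR => (hb R hR).trans ?_⟩
  rw [boxInt_const_mul, boxInt_const_mul]
  refine add_le_add le_rfl ?_
  have h1 : 0 ≤ M / R ^ 2 * sqInt a (2 * R) F t :=
    mul_nonneg (by positivity) (sqInt_nonneg _ _ _ _)
  have e : M * (B + 1) / R ^ 2 * sqInt a (2 * R) F t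
      = M / R ^ 2 * (B * sqInt a (2 * R) F t) + M / R ^ 2 * sqInt a (2 * R) F t := by ring
  rw [e]
  exact le_add_of_nonneg_right h1

theorem LocalEstimate.sqBdd (hI : IsOpen I) (hD : IsSmooth I D) (hl : IsSmooth I l)
    (hF : IsSmooth I F) (ht : t ∈ I) (hA : 0 ≤ A) (hB : 0 ≤ B)
    (h : LocalEstimate I t (fun t ρ z => ρ ^ a * D t ρ z ^ 2)
      (fun t ρ z => A * (ρ ^ a * l t ρ z ^ 2)) (fun t ρ z => B * (ρ ^ a * F t ρ z ^ 2)))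
    (bl : SqBdd a t l N) (bF : SqSub a t F) : SqBdd a t D (A * N) := by
  obtain ⟨M, hM, hb⟩ := h.exists_sqInt_bound hI hD hl hF ht hA hB
  intro L hL
  refine le_of_forall_pos_le_add fun ε hε => ?_
  obtain ⟨L₀, h₀⟩ := bF (ε / (4 * M)) (by positivity)
  set R := max (max 2 (4 * L)) L₀
  have hR2 : 2 ≤ R := (le_max_left _ _).trans (le_max_left _ _)
  have hRL : 4 * L ≤ R := (le_max_right _ _).trans (le_max_left _ _)
  have hR0 : L₀ ≤ 2 * R := (le_max_right _ _ : L₀ ≤ R).trans (by linarith)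
  refine (sqInt_mono a hI hD ht (by linarith : L ≤ R / 4)).trans ((hb R hR2).trans ?_)
  refine add_le_add (mul_le_mul_of_nonneg_left (bl _ (by linarith)) hA) ?_
  refine (mul_le_mul_of_nonneg_left (h₀ _ hR0) (by positivity)).trans (le_of_eq ?_)
  field_simp
  ring

theorem LocalEstimate.sqSub (hI : IsOpen I) (hD : IsSmooth I D) (hl : IsSmooth I l)
    (hF : IsSmooth I F) (ht : t ∈ I) (hA : 0 ≤ A) (hB : 0 ≤ B)
    (h : LocalEstimate I t (fun t ρ z => ρ ^ a * D t ρ z ^ 2)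
      (fun t ρ z => A * (ρ ^ a * l t ρ z ^ 2)) (fun t ρ z => B * (ρ ^ a * F t ρ z ^ 2)))
    (bl : SqSub a t l) (bF : SqSub a t F) : SqSub a t D := by
  obtain ⟨M, hM, hb⟩ := h.exists_sqInt_bound hI hD hl hF ht hA hB
  intro ε hε
  set δ := ε / (64 * A + 4 * M) with hδ
  obtain ⟨L₁, h₁⟩ := bl δ (by positivity)
  obtain ⟨L₂, h₂⟩ := bF δ (by positivity)
  refine ⟨max (max L₁ L₂) 1, fun L hL => ?_⟩
  have e1 : 1 ≤ L := (le_max_right _ _).trans hL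
  have e2 : L₁ ≤ 8 * L := ((le_max_left _ _).trans ((le_max_left _ _).trans hL)).trans (by linarith)
  have e3 : L₂ ≤ 8 * L := ((le_max_right _ _).trans ((le_max_left _ _).trans hL)).trans (by linarith)
  have := hb (4 * L) (by linarith)
  rw [show 4 * L / 4 = L by ring, show 2 * (4 * L) = 8 * L by ring] at this
  refine this.trans ((add_le_add (mul_le_mul_of_nonneg_left (h₁ _ e2) hA)
    (mul_le_mul_of_nonneg_left (h₂ _ e3) (by positivity))).trans ?_)
  have e4 : M / (4 * L) ^ 2 * (δ * (8 * L) ^ 2) = 4 * M * δ := by field_simp; ring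
  have e5 : 4 * M * δ ≤ 4 * M * δ * L ^ 2 :=
    le_mul_of_one_le_right (by positivity) (one_le_pow₀ e1)
  have e6 : (64 * A + 4 * M) * δ = ε := by rw [hδ]; field_simp
  rw [e4, ← e6]
  linarith

end

/-- The derivative in `ρ` of a field times the square of a cutoff. -/
theorem dρ_sq_mul (hI : IsOpen I) {φ X : Field} (hφ : IsSmooth I φ) (hX : IsSmooth I X) (ht : t ∈ I)
    (ρ z : ℝ) : dρ (fun t ρ z => φ t ρ z ^ 2 * X t ρ z) t ρ z
      = 2 * φ t ρ z * dρ φ t ρ z * X t ρ z + φ t ρ z ^ 2 * dρ X t ρ z := by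
  have h := ((hφ.hasDerivAt_dρ hI ht ρ z).pow 2).mul (hX.hasDerivAt_dρ hI ht ρ z)
  refine h.deriv.trans ?_
  simp

theorem dz_sq_mul (hI : IsOpen I) {φ X : Field} (hφ : IsSmooth I φ) (hX : IsSmooth I X) (ht : t ∈ I)
    (ρ z : ℝ) : dz (fun t ρ z => φ t ρ z ^ 2 * X t ρ z) t ρ z
      = 2 * φ t ρ z * dz φ t ρ z * X t ρ z + φ t ρ z ^ 2 * dz X t ρ z := by
  have h := ((hφ.hasDerivAt_dz hI ht ρ z).pow 2).mul (hX.hasDerivAt_dz hI ht ρ z)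
  refine h.deriv.trans ?_
  simp

theorem dρ_pow_mul (hI : IsOpen I) {X : Field} (hX : IsSmooth I X) (ht : t ∈ I)
    (ρ z : ℝ) (n : ℕ) : dρ (fun t ρ z => ρ ^ (n + 1) * X t ρ z) t ρ z
      = (n + 1) * ρ ^ n * X t ρ z + ρ ^ (n + 1) * dρ X t ρ z := by
  have h := (hasDerivAt_pow (n + 1) ρ).mul (hX.hasDerivAt_dρ hI ht ρ z)
  refine h.deriv.trans ?_
  simp

theorem dz_pow_mul (hI : IsOpen I) {X : Field} (hX : IsSmooth I X) (ht : t ∈ I)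
    (ρ z : ℝ) (n : ℕ) : dz (fun t ρ z => ρ ^ n * X t ρ z) t ρ z = ρ ^ n * dz X t ρ z :=
  ((hX.hasDerivAt_dz hI ht ρ z).const_mul (ρ ^ n)).deriv

theorem dρ_mul (hI : IsOpen I) (hf : IsSmooth I f) (hg : IsSmooth I g) (ht : t ∈ I) (ρ z : ℝ) :
    dρ (fun t ρ z => f t ρ z * g t ρ z) t ρ z = dρ f t ρ z * g t ρ z + f t ρ z * dρ g t ρ z :=
  ((hf.hasDerivAt_dρ hI ht ρ z).mul (hg.hasDerivAt_dρ hI ht ρ z)).deriv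

theorem dz_mul (hI : IsOpen I) (hf : IsSmooth I f) (hg : IsSmooth I g) (ht : t ∈ I) (ρ z : ℝ) :
    dz (fun t ρ z => f t ρ z * g t ρ z) t ρ z = dz f t ρ z * g t ρ z + f t ρ z * dz g t ρ z :=
  ((hf.hasDerivAt_dz hI ht ρ z).mul (hg.hasDerivAt_dz hI ht ρ z)).deriv

theorem dρ_rho_mul (hI : IsOpen I) {X : Field} (hX : IsSmooth I X) (ht : t ∈ I)
    (ρ z : ℝ) : dρ (fun t ρ z => ρ * X t ρ z) t ρ z = X t ρ z + ρ * dρ X t ρ z := by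
  have h := (hasDerivAt_id ρ).mul (hX.hasDerivAt_dρ hI ht ρ z)
  refine h.deriv.trans ?_
  simp

theorem dz_rho_mul (hI : IsOpen I) {X : Field} (hX : IsSmooth I X) (ht : t ∈ I)
    (ρ z : ℝ) : dz (fun t ρ z => ρ * X t ρ z) t ρ z = ρ * dz X t ρ z :=
  ((hX.hasDerivAt_dz hI ht ρ z).const_mul ρ).deriv

theorem dρ_const_mul (hI : IsOpen I) {X : Field} (hX : IsSmooth I X) (ht : t ∈ I) (c ρ z : ℝ) :
    dρ (fun t ρ z => c * X t ρ z) t ρ z = c * dρ X t ρ z :=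
  ((hX.hasDerivAt_dρ hI ht ρ z).const_mul c).deriv

theorem dz_const_mul (hI : IsOpen I) {X : Field} (hX : IsSmooth I X) (ht : t ∈ I) (c ρ z : ℝ) :
    dz (fun t ρ z => c * X t ρ z) t ρ z = c * dz X t ρ z :=
  ((hX.hasDerivAt_dz hI ht ρ z).const_mul c).deriv

/-- If `∂ρ f = ρ g` then `∂ρ ∂z f = ρ ∂z g`. -/
theorem dz_dρ_eq (hI : IsOpen I) (hg : IsSmooth I g)
    (hfg : ∀ t ∈ I, ∀ ρ z, dρ f t ρ z = ρ * g t ρ z) :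
    ∀ t ∈ I, ∀ ρ z, dz (dρ f) t ρ z = ρ * dz g t ρ z := fun t ht ρ z => by
  rw [dz_congr (g := fun t ρ z => ρ * g t ρ z) (fun z => hfg t ht ρ z), dz_rho_mul hI hg ht]

theorem dρ_dz_eq (hI : IsOpen I) (hf : IsSmooth I f) (hg : IsSmooth I g)
    (hfg : ∀ t ∈ I, ∀ ρ z, dρ f t ρ z = ρ * g t ρ z) :
    ∀ t ∈ I, ∀ ρ z, dρ (dz f) t ρ z = ρ * dz g t ρ z := fun t ht ρ z => by
  rw [hf.dρ_dz hI ht, dz_dρ_eq hI hg hfg t ht]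

theorem dρ_dρ_eq (hI : IsOpen I) (hg : IsSmooth I g)
    (hfg : ∀ t ∈ I, ∀ ρ z, dρ f t ρ z = ρ * g t ρ z) :
    ∀ t ∈ I, ∀ ρ z, dρ (dρ f) t ρ z = g t ρ z + ρ * dρ g t ρ z := fun t ht ρ z => by
  rw [dρ_congr (g := fun t ρ z => ρ * g t ρ z) (fun ρ => hfg t ht ρ z), dρ_rho_mul hI hg ht]

section

variable {a : ℕ} {l : Field} {N : ℝ}

/-- For `∂ρ f = ρ g` and `l = ∂z²f + ∂ρ²f + (a/ρ) ∂ρ f`, the integral of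
`ρ ^ a ((∂z²f)² + (∂ρ∂z f)²)` is controlled by that of `ρ ^ a l²`. -/
theorem localEstimate_dz (hI : IsOpen I) (hf : IsSmooth I f) (hg : IsSmooth I g)
    (hfg : ∀ t ∈ I, ∀ ρ z, dρ f t ρ z = ρ * g t ρ z) (ht : t ∈ I)
    (hl : ∀ ρ > 0, ∀ z, l t ρ z = dz (dz f) t ρ z + (a + 1) * g t ρ z + ρ * dρ g t ρ z) :
    LocalEstimate I t
      (fun t ρ z => ρ ^ a * (dz (dz f) t ρ z ^ 2 + (ρ * dz g t ρ z) ^ 2))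
      (fun t ρ z => 2 * (ρ ^ a * l t ρ z ^ 2))
      (fun t ρ z => 8 * (ρ ^ a * (ρ * g t ρ z) ^ 2)) := by
  have hzz := (hf.dz hI).dz hI
  have hX : IsSmooth I (fun t ρ z => ρ ^ (a + 1) * (dz (dz f) t ρ z * g t ρ z)) :=
    (isSmooth_rho.pow _).mul (hzz.mul hg)
  have hY : IsSmooth I (fun t ρ z => ρ ^ (a + 2) * (dz g t ρ z * g t ρ z)) :=
    (isSmooth_rho.pow _).mul ((hg.dz hI).mul hg)
  refine ⟨_, _, (isSmooth_const (-2)).mul hX, (isSmooth_const 2).mul hY, fun z => by simp,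
    fun φ hφ ρ hρ z => ?_⟩
  have e1 : dρ (dz (dz f)) t ρ z = ρ * dz (dz g) t ρ z :=
    dρ_dz_eq hI (hf.dz hI) (hg.dz hI) (dρ_dz_eq hI hf hg hfg) t ht ρ z
  rw [dρ_sq_mul hI hφ ((isSmooth_const (-2)).mul hX) ht,
    dz_sq_mul hI hφ ((isSmooth_const 2).mul hY) ht, dρ_const_mul hI hX ht, dz_const_mul hI hY ht,
    dρ_pow_mul hI (hzz.mul hg) ht, dz_pow_mul hI ((hg.dz hI).mul hg) ht, dρ_mul hI hzz hg ht,
    dz_mul hI (hg.dz hI) hg ht, e1]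
  beta_reduce
  have hW : 0 ≤ ρ ^ a := pow_nonneg hρ.le a
  rw [pow_succ ρ (a + 1), pow_succ ρ a]
  have hl' := hl ρ hρ z
  generalize ρ ^ a = W at *
  generalize φ t ρ z = P, dρ φ t ρ z = p, dz φ t ρ z = q, dz (dz f) t ρ z = A, dz g t ρ z = G,
    g t ρ z = y, dz (dz g) t ρ z = k, dρ g t ρ z = j, l t ρ z = m at *
  subst hl'
  -- after expanding, the right side minus the left side is this sum of squares
  have key : 0 ≤ W * (1 / 2 * (P * A - 2 * P * (A + (a + 1) * y + ρ * j)) ^ 2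
      + 1 / 2 * (P * A - 4 * p * (ρ * y)) ^ 2 + (P * (ρ * G) + 2 * q * (ρ * y)) ^ 2
      + 4 * (q * (ρ * y)) ^ 2) := by positivity
  linear_combination key

/-- For `a ≤ b` and `∂ρ f = ρ g`, the integral of `ρ ^ a ((∂ρ²f)² + (b / 2) g²)` is controlled by
that of `ρ ^ a (∂ρ²f + b g)²`. -/
theorem localEstimate_dρ (hI : IsOpen I) (hg : IsSmooth I g) (ht : t ∈ I) {b : ℝ} (hab : a ≤ b) :
    LocalEstimate I t
      (fun t ρ z => ρ ^ a * ((g t ρ z + ρ * dρ g t ρ z) ^ 2 + b / 2 * g t ρ z ^ 2))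
      (fun t ρ z => ρ ^ a * ((g t ρ z + ρ * dρ g t ρ z) + b * g t ρ z) ^ 2)
      (fun t ρ z => 2 * b * (ρ ^ a * (ρ * g t ρ z) ^ 2)) := by
  have hX : IsSmooth I (fun t ρ z => ρ ^ (a + 1) * (g t ρ z * g t ρ z)) :=
    (isSmooth_rho.pow _).mul (hg.mul hg)
  have hb : 0 ≤ b := (Nat.cast_nonneg a).trans hab
  refine ⟨_, _, (isSmooth_const (-b)).mul hX, isSmooth_const 0, fun z => by simp,
    fun φ hφ ρ hρ z => ?_⟩
  rw [dρ_sq_mul hI hφ ((isSmooth_const (-b)).mul hX) ht, dρ_const_mul hI hX ht,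
    dρ_pow_mul hI (hg.mul hg) ht, dρ_mul hI hg hg ht]
  have e0 : dz (fun t ρ z => φ t ρ z ^ 2 * 0) t ρ z = 0 := by simp [dz]
  rw [e0]
  beta_reduce
  have hW : 0 ≤ ρ ^ a := pow_nonneg hρ.le a
  rw [pow_succ ρ a]
  generalize ρ ^ a = W at *
  generalize φ t ρ z = P, dρ φ t ρ z = p, dz φ t ρ z = q, g t ρ z = y, dρ g t ρ z = j at *
  -- after expanding, the right side minus the left side is this sum of squares
  have key : 0 ≤ W * (b / 2 * (P * y - 2 * p * (ρ * y)) ^ 2 + b * (b - a) * (P * y) ^ 2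
      + 2 * b * (q * (ρ * y)) ^ 2) := by
    have := sub_nonneg.2 hab
    positivity
  linear_combination key

theorem LocalEstimate.mono {U V W U' V' W' : Field} (h : LocalEstimate I t U V W)
    (hU : ∀ ρ > 0, ∀ z, U' t ρ z ≤ U t ρ z) (hV : ∀ ρ > 0, ∀ z, V t ρ z ≤ V' t ρ z)
    (hW : ∀ ρ > 0, ∀ z, W t ρ z ≤ W' t ρ z) : LocalEstimate I t U' V' W' := by
  obtain ⟨X, Y, hX, hY, h0, h⟩ := h
  refine ⟨X, Y, hX, hY, h0, fun φ hφ ρ hρ z => ?_⟩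
  have h1 := mul_le_mul_of_nonneg_left (hU ρ hρ z) (sq_nonneg (φ t ρ z))
  have h2 := mul_le_mul_of_nonneg_left (hV ρ hρ z) (sq_nonneg (φ t ρ z))
  have h3 := mul_le_mul_of_nonneg_left (hW ρ hρ z)
    (by positivity : 0 ≤ dρ φ t ρ z ^ 2 + dz φ t ρ z ^ 2)
  linarith [h φ hφ ρ hρ z]

/-- The four local estimates behind the bounds on second derivatives. -/
theorem localEstimate_second (ha : 1 ≤ a) (hI : IsOpen I) (hf : IsSmooth I f) (hg : IsSmooth I g)
    (hfg : ∀ t ∈ I, ∀ ρ z, dρ f t ρ z = ρ * g t ρ z) (ht : t ∈ I)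
    (hl : ∀ ρ > 0, ∀ z, l t ρ z = dz (dz f) t ρ z + (a + 1) * g t ρ z + ρ * dρ g t ρ z) :
    LocalEstimate I t (fun t ρ z => ρ ^ a * dz (dz f) t ρ z ^ 2)
        (fun t ρ z => 2 * (ρ ^ a * l t ρ z ^ 2)) (fun t ρ z => 8 * (ρ ^ a * dρ f t ρ z ^ 2)) ∧
      LocalEstimate I t (fun t ρ z => ρ ^ a * dz (dρ f) t ρ z ^ 2)
        (fun t ρ z => 2 * (ρ ^ a * l t ρ z ^ 2)) (fun t ρ z => 8 * (ρ ^ a * dρ f t ρ z ^ 2)) ∧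
      LocalEstimate I t (fun t ρ z => ρ ^ a * dρ (dρ f) t ρ z ^ 2)
        (fun t ρ z => 1 * (ρ ^ a * (l t ρ z - 1 * dz (dz f) t ρ z) ^ 2))
        (fun t ρ z => 2 * a * (ρ ^ a * dρ f t ρ z ^ 2)) ∧
      LocalEstimate I t (fun t ρ z => ρ ^ a * (1 / 2 * g t ρ z) ^ 2)
        (fun t ρ z => 1 * (ρ ^ a * (l t ρ z - 1 * dz (dz f) t ρ z) ^ 2))
        (fun t ρ z => 2 * a * (ρ ^ a * dρ f t ρ z ^ 2)) := by
  have h1 := localEstimate_dz hI hf hg hfg ht hl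
  have h2 := localEstimate_dρ hI hg ht (le_refl (a : ℝ))
  have ha' : (1 : ℝ) ≤ a := by exact_mod_cast ha
  have pow_pos : ∀ {ρ : ℝ}, ρ > 0 → 0 ≤ ρ ^ a := fun h => pow_nonneg (le_of_lt h) a
  have e1 := hfg t ht
  have e2 := dz_dρ_eq hI hg hfg t ht
  have e3 := dρ_dρ_eq hI hg hfg t ht
  refine ⟨h1.mono ?_ ?_ ?_, h1.mono ?_ ?_ ?_, h2.mono ?_ ?_ ?_, h2.mono ?_ ?_ ?_⟩ <;>
    intro ρ hρ z <;> (try simp only [e1, e2, e3]) <;> try exact le_rfl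
  · exact mul_le_mul_of_nonneg_left (by nlinarith [sq_nonneg (ρ * dz g t ρ z)]) (pow_pos hρ)
  · exact mul_le_mul_of_nonneg_left (by nlinarith [sq_nonneg (dz (dz f) t ρ z)]) (pow_pos hρ)
  · refine mul_le_mul_of_nonneg_left (le_add_of_nonneg_right (by positivity)) (pow_pos hρ)
  · rw [hl ρ hρ z]
    refine le_of_eq ?_
    ring
  · exact mul_le_mul_of_nonneg_left
      (by nlinarith [sq_nonneg (g t ρ z + ρ * dρ g t ρ z), sq_nonneg (g t ρ z)]) (pow_pos hρ)
  · rw [hl ρ hρ z]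
    refine le_of_eq ?_
    ring

theorem SqBdd.of_half (h : SqBdd a t (fun t ρ z => 1 / 2 * g t ρ z) N) : SqBdd a t g (4 * N) := by
  intro L hL
  have e : sqInt a L g t = 4 * sqInt a L (fun t ρ z => 1 / 2 * g t ρ z) t := by
    rw [sqInt, sqInt, ← boxInt_const_mul]
    exact boxInt_congr fun x _ => by ring
  linarith [h L hL]

theorem SqSub.of_half (h : SqSub a t (fun t ρ z => 1 / 2 * g t ρ z)) : SqSub a t g := by
  intro ε hε
  obtain ⟨L₀, h₀⟩ := h (ε / 4) (by positivity)
  refine ⟨L₀, fun L hL => ?_⟩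
  have e : sqInt a L g t = 4 * sqInt a L (fun t ρ z => 1 / 2 * g t ρ z) t := by
    rw [sqInt, sqInt, ← boxInt_const_mul]
    exact boxInt_congr fun x _ => by ring
  linarith [h₀ L hL]

/-- The `L²` estimate for second derivatives: if `∂ρ f = ρ g`, then `∂z²f`, `∂z∂ρ f`, `∂ρ²f` and
`g` are controlled by `l = ∂z²f + ∂ρ²f + (a/ρ) ∂ρ f`. Only the growth of `∂ρ f` has to be
limited. -/
theorem SqBdd.second_derivatives (ha : 1 ≤ a) (hI : IsOpen I) (hf : IsSmooth I f)
    (hg : IsSmooth I g) (hfg : ∀ t ∈ I, ∀ ρ z, dρ f t ρ z = ρ * g t ρ z) (ht : t ∈ I)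
    (hl : IsSmooth I l)
    (hleq : ∀ ρ > 0, ∀ z, l t ρ z = dz (dz f) t ρ z + (a + 1) * g t ρ z + ρ * dρ g t ρ z)
    (bl : SqBdd a t l N) (bf : SqSub a t (dρ f)) :
    SqBdd a t (dz (dz f)) (2 * N) ∧ SqBdd a t (dz (dρ f)) (2 * N) ∧
      SqBdd a t (dρ (dρ f)) (6 * N) ∧ SqBdd a t g (24 * N) := by
  obtain ⟨h1, h2, h3, h4⟩ := localEstimate_second ha hI hf hg hfg ht hleq
  have hzz := (hf.dz hI).dz hI
  have hρ := hf.dρ hI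
  have b1 := h1.sqBdd hI hzz hl hρ ht (by norm_num) (by norm_num) bl bf
  have b5 := SqBdd.comb hI hl hzz ht bl b1 1
  have hl' := hl.sub ((isSmooth_const 1).mul hzz)
  have b3 := h3.sqBdd hI (hρ.dρ hI) hl' hρ ht (by norm_num) (by positivity) b5 bf
  have b4 := h4.sqBdd hI ((isSmooth_const (1 / 2)).mul hg) hl' hρ ht (by norm_num) (by positivity)
    b5 bf
  exact ⟨b1, h2.sqBdd hI (hρ.dz hI) hl hρ ht (by norm_num) (by norm_num) bl bf,
    b3.mono (by linarith), b4.of_half.mono (by linarith)⟩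

/-- The variant of `SqBdd.second_derivatives` in which only limited growth is known and obtained. -/
theorem SqSub.second_derivatives (ha : 1 ≤ a) (hI : IsOpen I) (hf : IsSmooth I f)
    (hg : IsSmooth I g) (hfg : ∀ t ∈ I, ∀ ρ z, dρ f t ρ z = ρ * g t ρ z) (ht : t ∈ I)
    (hl : IsSmooth I l)
    (hleq : ∀ ρ > 0, ∀ z, l t ρ z = dz (dz f) t ρ z + (a + 1) * g t ρ z + ρ * dρ g t ρ z)
    (bl : SqSub a t l) (bf : SqSub a t (dρ f)) :
    SqSub a t (dz (dρ f)) ∧ SqSub a t (dρ (dρ f)) ∧ SqSub a t g := by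
  obtain ⟨h1, h2, h3, h4⟩ := localEstimate_second ha hI hf hg hfg ht hleq
  have hzz := (hf.dz hI).dz hI
  have hρ := hf.dρ hI
  have b1 := h1.sqSub hI hzz hl hρ ht (by norm_num) (by norm_num) bl bf
  have b5 := SqSub.comb hI hl hzz ht bl b1 1
  have hl' := hl.sub ((isSmooth_const 1).mul hzz)
  exact ⟨h2.sqSub hI (hρ.dz hI) hl hρ ht (by norm_num) (by norm_num) bl bf,
    h3.sqSub hI (hρ.dρ hI) hl' hρ ht (by norm_num) (by positivity) b5 bf,
    (h4.sqSub hI ((isSmooth_const (1 / 2)).mul hg) hl' hρ ht (by norm_num) (by positivity)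
      b5 bf).of_half⟩

/-- A bound on `∂ρ²f + (b/ρ) ∂ρ f` with a weight `ρ ^ a`, `a ≤ b`, gives one on `∂ρ²f`. -/
theorem SqBdd.dρ_dρ (hI : IsOpen I) (hf : IsSmooth I f) (hg : IsSmooth I g)
    (hfg : ∀ t ∈ I, ∀ ρ z, dρ f t ρ z = ρ * g t ρ z) (ht : t ∈ I) (hl : IsSmooth I l) {b : ℝ}
    (hab : a ≤ b) (hleq : ∀ ρ > 0, ∀ z, l t ρ z = dρ (dρ f) t ρ z + b * g t ρ z)
    (bl : SqBdd a t l N) (bf : SqSub a t (dρ f)) : SqBdd a t (dρ (dρ f)) N := by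
  have hb : 0 ≤ b := (Nat.cast_nonneg a).trans hab
  have h : LocalEstimate I t (fun t ρ z => ρ ^ a * dρ (dρ f) t ρ z ^ 2)
      (fun t ρ z => 1 * (ρ ^ a * l t ρ z ^ 2)) (fun t ρ z => 2 * b * (ρ ^ a * dρ f t ρ z ^ 2)) := by
    refine (localEstimate_dρ hI hg ht hab).mono ?_ ?_ ?_ <;> intro ρ hρ z
    · simp only [dρ_dρ_eq hI hg hfg t ht]
      exact mul_le_mul_of_nonneg_left (le_add_of_nonneg_right (by positivity)) (by positivity)
    · simp only [hleq ρ hρ z, dρ_dρ_eq hI hg hfg t ht, one_mul]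
      exact le_rfl
    · simp only [hfg t ht]
      exact le_rfl
  exact (h.sqBdd hI ((hf.dρ hI).dρ hI) hl (hf.dρ hI) ht zero_le_one (by positivity) bl bf).mono
    (by linarith)

/-- If `w = ∂z²f + ∂ρ²f + (a/ρ) ∂ρ f`, limited growth of the gradients of `f` and `w` gives limited
growth of `w`. -/
theorem SqSub.of_gradients (hI : IsOpen I) {w : Field} (hf : IsSmooth I f) (hg : IsSmooth I g)
    (hfg : ∀ t ∈ I, ∀ ρ z, dρ f t ρ z = ρ * g t ρ z) (ht : t ∈ I) (hw : IsSmooth I w)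
    (hweq : ∀ ρ > 0, ∀ z, w t ρ z = dz (dz f) t ρ z + (a + 1) * g t ρ z + ρ * dρ g t ρ z)
    (fρ : SqSub a t (dρ f)) (fz : SqSub a t (dz f)) (wρ : SqSub a t (dρ w))
    (wz : SqSub a t (dz w)) : SqSub a t w := by
  set E : Field := fun t ρ z => ρ ^ a * dρ f t ρ z ^ 2 + ρ ^ a * dz f t ρ z ^ 2 with hE
  set E' : Field := fun t ρ z => ρ ^ a * dρ w t ρ z ^ 2 + ρ ^ a * dz w t ρ z ^ 2 with hE'
  have sE : IsSmooth I E := (isSmooth_sq_weight a (hf.dρ hI)).add (isSmooth_sq_weight a (hf.dz hI))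
  have sE' : IsSmooth I E' :=
    (isSmooth_sq_weight a (hw.dρ hI)).add (isSmooth_sq_weight a (hw.dz hI))
  have pE : ∀ ρ > 0, ∀ z, 0 ≤ E t ρ z := fun ρ hρ z => by simp only [hE]; positivity
  have pE' : ∀ ρ > 0, ∀ z, 0 ≤ E' t ρ z := fun ρ hρ z => by simp only [hE']; positivity
  have est : LocalEstimate I t (fun t ρ z => ρ ^ a * w t ρ z ^ 2) (fun t ρ z => E t ρ z + E' t ρ z)
      (fun t ρ z => 4 * E t ρ z) := by
    have hX : IsSmooth I (fun t ρ z => ρ ^ (a + 1) * (w t ρ z * g t ρ z)) :=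
      (isSmooth_rho.pow _).mul (hw.mul hg)
    have hY : IsSmooth I (fun t ρ z => ρ ^ a * (w t ρ z * dz f t ρ z)) :=
      (isSmooth_rho.pow _).mul (hw.mul (hf.dz hI))
    refine ⟨_, _, (isSmooth_const 2).mul hX, (isSmooth_const 2).mul hY, fun z => by simp,
      fun φ hφ ρ hρ z => ?_⟩
    rw [dρ_sq_mul hI hφ ((isSmooth_const 2).mul hX) ht,
      dz_sq_mul hI hφ ((isSmooth_const 2).mul hY) ht, dρ_const_mul hI hX ht, dz_const_mul hI hY ht,
      dρ_pow_mul hI (hw.mul hg) ht, dz_pow_mul hI (hw.mul (hf.dz hI)) ht, dρ_mul hI hw hg ht,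
      dz_mul hI hw (hf.dz hI) ht]
    simp only [hE, hE', hfg t ht]
    have hW : 0 ≤ ρ ^ a := pow_nonneg hρ.le a
    rw [pow_succ ρ a]
    have hw' := hweq ρ hρ z
    generalize ρ ^ a = W at *
    generalize φ t ρ z = P, dρ φ t ρ z = p, dz φ t ρ z = q, dz (dz f) t ρ z = A, dz f t ρ z = B,
      g t ρ z = y, dρ g t ρ z = j, w t ρ z = m, dρ w t ρ z = m₁, dz w t ρ z = m₂ at *
    -- after expanding, the right side minus the left side is this sum of squares
    have key : 0 ≤ W * ((P * m + 2 * (p * (ρ * y) + q * B)) ^ 2 + 4 * (p * B - q * (ρ * y)) ^ 2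
        + (P * (m₁ + ρ * y)) ^ 2 + (P * (m₂ + B)) ^ 2) := by positivity
    subst hw'
    linear_combination key
  obtain ⟨M, hM, hb⟩ := est.exists_bound hI (isSmooth_sq_weight a hw) (sE.add sE')
    ((isSmooth_const 4).mul sE) ht (fun ρ hρ z => by positivity)
    (fun ρ hρ z => add_nonneg (pE ρ hρ z) (pE' ρ hρ z))
    (fun ρ hρ z => mul_nonneg (by norm_num) (pE ρ hρ z))
  intro ε hε
  set δ := ε / (256 + 32 * M) with hδ
  have hδ0 : 0 < δ := by positivity
  obtain ⟨L₁, h₁⟩ := fρ δ hδ0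
  obtain ⟨L₂, h₂⟩ := fz δ hδ0
  obtain ⟨L₃, h₃⟩ := wρ δ hδ0
  obtain ⟨L₄, h₄⟩ := wz δ hδ0
  refine ⟨max (max (max L₁ L₂) (max L₃ L₄)) 1, fun L hL => ?_⟩
  rw [ge_iff_le, max_le_iff, max_le_iff, max_le_iff, max_le_iff] at hL
  obtain ⟨⟨⟨l1, l2⟩, l3, l4⟩, e1⟩ := hL
  have := hb (4 * L) (by linarith)
  rw [show 4 * L / 4 = L by ring, show 2 * (4 * L) = 8 * L by ring, boxInt_add hI sE sE' ht,
    boxInt_const_mul, hE, hE', boxInt_add hI (isSmooth_sq_weight a (hf.dρ hI))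
    (isSmooth_sq_weight a (hf.dz hI)) ht, boxInt_add hI (isSmooth_sq_weight a (hw.dρ hI))
    (isSmooth_sq_weight a (hw.dz hI)) ht] at this
  have b1 := h₁ (8 * L) (by linarith)
  have b2 := h₂ (8 * L) (by linarith)
  have b3 := h₃ (8 * L) (by linarith)
  have b4 := h₄ (8 * L) (by linarith)
  have b5 := mul_le_mul_of_nonneg_left (add_le_add b1 b2) (by positivity : 0 ≤ M / (4 * L) ^ 2 * 4)
  have e4 : M / (4 * L) ^ 2 * 4 * (δ * (8 * L) ^ 2 + δ * (8 * L) ^ 2) = 32 * M * δ := by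
    field_simp; ring
  have e5 : 32 * M * δ ≤ 32 * M * δ * L ^ 2 :=
    le_mul_of_one_le_right (by positivity) (one_le_pow₀ e1)
  have e6 : (256 + 32 * M) * δ = ε := by rw [hδ]; field_simp
  unfold sqInt at b1 b2 b3 b4 b5 ⊢
  rw [← e6]
  linarith

end

end LinGrav

namespace LinGrav

variable {I : Set ℝ} {f g : Field} {t ρ z L : ℝ}

/-! ### Pointwise bounds from derivatives in weighted `L²` -/

theorem iterate_dz_congr (h : ∀ z, f t ρ z = g t ρ z) (n : ℕ) (z : ℝ) :
    dz^[n] f t ρ z = dz^[n] g t ρ z := by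
  induction n generalizing z with
  | zero => exact h z
  | succ n ih =>
    rw [Function.iterate_succ_apply', Function.iterate_succ_apply']
    exact dz_congr ih

theorem IsSmooth.iterate_dρ (hI : IsOpen I) (hf : IsSmooth I f) (n : ℕ) :
    IsSmooth I (LinGrav.dρ^[n] f) := by
  induction n with
  | zero => exact hf
  | succ n ih => rw [Function.iterate_succ_apply']; exact ih.dρ hI

theorem IsSmooth.iterate_dρ_dz (hI : IsOpen I) (hf : IsSmooth I f) (ht : t ∈ I) (n : ℕ) (ρ z : ℝ) :
    LinGrav.dρ^[n] (LinGrav.dz f) t ρ z = LinGrav.dz (LinGrav.dρ^[n] f) t ρ z := by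
  induction n generalizing ρ with
  | zero => rfl
  | succ n ih =>
    rw [Function.iterate_succ_apply', Function.iterate_succ_apply', dρ_congr ih,
      (hf.iterate_dρ hI n).dρ_dz hI ht]

/-- The `k`-th derivative in the scale of a moment of `f`. -/
noncomputable def momentDeriv : ℕ → Field → ℝ → ℝ → ℝ → ℕ → ℕ → ℝ → ℝ
  | 0, f, t, ρ, z, i, j, l => moment f t ρ z i j l
  | k + 1, f, t, ρ, z, i, j, l =>
    momentDeriv k (dρ f) t ρ z (i + 1) j l + momentDeriv k (dz f) t ρ z i (j + 1) l

theorem hasDerivAt_momentDeriv (hI : IsOpen I) (hf : IsSmooth I f) (ht : t ∈ I) (ρ z : ℝ)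
    (k i j : ℕ) (l : ℝ) :
    HasDerivAt (momentDeriv k f t ρ z i j) (momentDeriv (k + 1) f t ρ z i j l) l := by
  induction k generalizing f i j with
  | zero => exact hasDerivAt_moment hI hf ht ρ z i j l
  | succ k ih => exact (ih (hf.dρ hI) (i + 1) j).add (ih (hf.dz hI) i (j + 1))

theorem abs_momentDeriv_le (hI : IsOpen I) (hf : IsSmooth I f) (ht : t ∈ I) (hρ : 0 ≤ ρ) (z : ℝ)
    {a k : ℕ} {N : ℝ} (hN : 0 < N)
    (h : ∀ m n, m + n = k → SqBdd a t (dz^[n] (dρ^[m] f)) N) (i j : ℕ) {l : ℝ} (hl : 0 < l) :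
    |momentDeriv k f t ρ z i j l| ≤ 3 ^ k * 2 ^ i * (√N * l ^ (-((a + 2) / 2) : ℝ)) := by
  induction k generalizing f i j with
  | zero =>
    refine (abs_moment_le hI hf ht hρ z hN (h 0 0 rfl) hl i j).trans (le_of_eq ?_)
    ring
  | succ k ih =>
    have h1 := ih (hf.dρ hI) (fun m n hmn => h (m + 1) n (by omega)) (i + 1) j
    have h2 := ih (hf.dz hI) (fun m n hmn => (h m (n + 1) (by omega)).congr fun ρ _ z => by
      rw [Function.iterate_succ_apply, iterate_dz_congr (fun z =>
        hf.iterate_dρ_dz hI ht m ρ z) n z]) i (j + 1)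
    refine (abs_add_le _ _).trans ((add_le_add h1 h2).trans (le_of_eq ?_))
    ring

theorem momentDeriv_zero_zero (f : Field) (t ρ z : ℝ) : momentDeriv 0 f t ρ z 0 0 0 = f t ρ z :=
  moment_zero f t ρ z

/-- In three space dimensions: two derivatives in `L²` bound a function vanishing at infinity. -/
theorem abs_le_of_first_second (hI : IsOpen I) (hf : IsSmooth I f) (ht : t ∈ I) (hρ : 0 ≤ ρ) (z : ℝ)
    {N : ℝ} (hN : 0 < N)
    (h1 : ∀ m n, m + n = 1 → SqBdd 1 t (dz^[n] (dρ^[m] f)) N)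
    (h2 : ∀ m n, m + n = 2 → SqBdd 1 t (dz^[n] (dρ^[m] f)) N)
    (h0 : ∀ ε > 0, ∃ R : ℝ, ∀ ρ > 0, ∀ z, R ≤ √(ρ ^ 2 + z ^ 2) → |f t ρ z| ≤ ε) :
    |f t ρ z| ≤ 72 * √N := by
  have hd := fun k l => hasDerivAt_momentDeriv hI hf ht ρ z k 0 0 l
  have e : (-(((1 : ℕ) : ℝ) + 2) / 2 : ℝ) = -(3 / 2) := by norm_num
  have := abs_zero_le_of_two (K := 9 * √N)
    (continuous_iff_continuousAt.2 fun l => (hd 0 l).continuousAt) (fun l _ => hd 0 l)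
    (fun l _ => hd 1 l) (fun l hl => ?_) (fun l hl => ?_) (tendsto_moment_zero hρ z h0 0 0)
  · rw [momentDeriv_zero_zero] at this
    linarith
  · refine (abs_momentDeriv_le hI hf ht hρ z hN h1 0 0 hl).trans ?_
    rw [← neg_div, e]
    have := mul_nonneg (Real.sqrt_nonneg N) (Real.rpow_nonneg hl.le (-(3 / 2)))
    linarith
  · refine (abs_momentDeriv_le hI hf ht hρ z hN h2 0 0 hl).trans (le_of_eq ?_)
    rw [← neg_div, e]
    ring

/-- In seven space dimensions: third and fourth derivatives in `L²` bound a function vanishing at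
infinity together with its gradient. -/
theorem abs_le_of_third_fourth (hI : IsOpen I) (hf : IsSmooth I f) (ht : t ∈ I) (hρ : 0 ≤ ρ) (z : ℝ)
    {N : ℝ} (hN : 0 < N)
    (h3 : ∀ m n, m + n = 3 → SqBdd 5 t (dz^[n] (dρ^[m] f)) N)
    (h4 : ∀ m n, m + n = 4 → SqBdd 5 t (dz^[n] (dρ^[m] f)) N)
    (h0 : ∀ ε > 0, ∃ R : ℝ, ∀ ρ > 0, ∀ z, R ≤ √(ρ ^ 2 + z ^ 2) → |f t ρ z| ≤ ε)
    (hρ0 : ∀ ε > 0, ∃ R : ℝ, ∀ ρ > 0, ∀ z, R ≤ √(ρ ^ 2 + z ^ 2) → |dρ f t ρ z| ≤ ε)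
    (hz0 : ∀ ε > 0, ∃ R : ℝ, ∀ ρ > 0, ∀ z, R ≤ √(ρ ^ 2 + z ^ 2) → |dz f t ρ z| ≤ ε) :
    |f t ρ z| ≤ 1296 * √N := by
  have hd := fun k l => hasDerivAt_momentDeriv hI hf ht ρ z k 0 0 l
  have e : (-(((5 : ℕ) : ℝ) + 2) / 2 : ℝ) = -(7 / 2) := by norm_num
  have hlim1 : Tendsto (momentDeriv 1 f t ρ z 0 0) atTop (𝓝 0) := by
    have := (tendsto_moment_zero hρ z hρ0 1 0).add (tendsto_moment_zero hρ z hz0 0 1)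
    rwa [add_zero] at this
  have := abs_zero_le_of_four (K := 81 * √N)
    (continuous_iff_continuousAt.2 fun l => (hd 0 l).continuousAt) (fun l _ => hd 0 l)
    (fun l _ => hd 1 l) (fun l _ => hd 2 l) (fun l _ => hd 3 l) (fun l hl => ?_) (fun l hl => ?_)
    (tendsto_moment_zero hρ z h0 0 0) hlim1
  · rw [momentDeriv_zero_zero] at this
    linarith
  · refine (abs_momentDeriv_le hI hf ht hρ z hN h3 0 0 hl).trans ?_
    rw [← neg_div, e]
    have := mul_nonneg (Real.sqrt_nonneg N) (Real.rpow_nonneg hl.le (-(7 / 2)))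
    linarith
  · refine (abs_momentDeriv_le hI hf ht hρ z hN h4 0 0 hl).trans (le_of_eq ?_)
    rw [← neg_div, e]
    ring

theorem SqBdd.of_eq {a : ℕ} {N : ℝ} (h : SqBdd a t f N) (e : ∀ ρ > 0, ∀ z, g t ρ z = f t ρ z) :
    SqBdd a t g N := h.congr fun ρ hρ z => by rw [e ρ hρ z]

/-- Elliptic regularity for the operator `∂ρ² + ∂z² + (5/ρ) ∂ρ` in the cases needed: with
`w = ∂ρ²v + ∂z²v + (5/ρ) ∂ρ v` and `y` the same operator applied to `w`, all third and fourth
derivatives of `v` are controlled by `∂w` and `y`. -/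
theorem third_fourth_derivatives {v w y g k : Field} {N : ℝ} (hI : IsOpen I)
    (hv : IsSmooth I v) (hw : IsSmooth I w) (hy : IsSmooth I y) (hg : IsSmooth I g)
    (hge : IsEven I g) (hk : IsSmooth I k)
    (hvg : ∀ t ∈ I, ∀ ρ z, dρ v t ρ z = ρ * g t ρ z)
    (hwk : ∀ t ∈ I, ∀ ρ z, dρ w t ρ z = ρ * k t ρ z) (ht : t ∈ I)
    (hwv : ∀ ρ > 0, ∀ z, w t ρ z = dz (dz v) t ρ z + 6 * g t ρ z + ρ * dρ g t ρ z)
    (hyw : ∀ ρ > 0, ∀ z, y t ρ z = dz (dz w) t ρ z + 6 * k t ρ z + ρ * dρ k t ρ z)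
    (bwρ : SqBdd 5 t (dρ w) N) (bwz : SqBdd 5 t (dz w) N) (bwy : SqBdd 5 t y N)
    (bvρ : SqSub 5 t (dρ v)) (bvz : SqSub 5 t (dz v)) (hN : 0 ≤ N) :
    (∀ m n, m + n = 3 → SqBdd 5 t (dz^[n] (dρ^[m] v)) (8000 * N)) ∧
      ∀ m n, m + n = 4 → SqBdd 5 t (dz^[n] (dρ^[m] v)) (8000 * N) := by
  have one5 : 1 ≤ 5 := by norm_num
  have one7 : 1 ≤ 7 := by norm_num
  have six : ((5 : ℕ) : ℝ) + 1 = 6 := by norm_num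
  have eight : ((7 : ℕ) : ℝ) + 1 = 8 := by norm_num
  obtain ⟨h, hh, -, hgh⟩ := hg.exists_dρ_eq hI hge
  have sz : ∀ {f : Field}, IsSmooth I f → IsSmooth I (dz f) := fun hf => hf.dz hI
  have sρ : ∀ {f : Field}, IsSmooth I f → IsSmooth I (dρ f) := fun hf => hf.dρ hI
  -- the equations satisfied by `g` and by the derivatives of `v` along the axis
  have hkg : ∀ ρ > 0, ∀ z, k t ρ z = dz (dz g) t ρ z + 8 * h t ρ z + ρ * dρ h t ρ z := by
    intro ρ hρ z
    have e1 : dρ w t ρ z = ρ * dz (dz g) t ρ z + 6 * (ρ * h t ρ z)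
        + (ρ * h t ρ z + ρ * (h t ρ z + ρ * dρ h t ρ z)) := by
      rw [dρ_congr_pos (g := fun t ρ z => dz (dz v) t ρ z + 6 * g t ρ z + ρ * dρ g t ρ z)
        (fun ρ hρ => hwv ρ hρ z) hρ]
      have d1 := (sz (sz hv)).hasDerivAt_dρ hI ht ρ z
      have d2 := (hg.hasDerivAt_dρ hI ht ρ z).const_mul 6
      have d3 := (hasDerivAt_id ρ).mul ((sρ hg).hasDerivAt_dρ hI ht ρ z)
      refine ((d1.add d2).add d3).deriv.trans ?_
      rw [dρ_dz_eq hI (sz hv) (sz hg) (dρ_dz_eq hI hv hg hvg) t ht, hgh t ht,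
        dρ_dρ_eq hI hh hgh t ht]
      simp
    rw [hwk t ht] at e1
    exact mul_left_cancel₀ hρ.ne' (by linarith)
  have hwv_z : ∀ ρ > 0, ∀ z, dz w t ρ z
      = dz (dz (dz v)) t ρ z + 6 * dz g t ρ z + ρ * dρ (dz g) t ρ z := by
    intro ρ hρ z
    rw [dz_congr (g := fun t ρ z => dz (dz v) t ρ z + 6 * g t ρ z + ρ * dρ g t ρ z)
        (fun z => hwv ρ hρ z), hg.dρ_dz hI ht]
    exact ((((sz (sz hv)).hasDerivAt_dz hI ht ρ z).add
      ((hg.hasDerivAt_dz hI ht ρ z).const_mul 6)).add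
      (((sρ hg).hasDerivAt_dz hI ht ρ z).const_mul ρ)).deriv
  have hwv_zz : ∀ ρ > 0, ∀ z, dz (dz w) t ρ z
      = dz (dz (dz (dz v))) t ρ z + 6 * dz (dz g) t ρ z + ρ * dρ (dz (dz g)) t ρ z := by
    intro ρ hρ z
    rw [dz_congr (g := fun t ρ z => dz (dz (dz v)) t ρ z + 6 * dz g t ρ z + ρ * dρ (dz g) t ρ z)
        (fun z => hwv_z ρ hρ z), (sz hg).dρ_dz hI ht]
    exact ((((sz (sz (sz hv))).hasDerivAt_dz hI ht ρ z).add
      (((sz hg).hasDerivAt_dz hI ht ρ z).const_mul 6)).add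
      (((sρ (sz hg)).hasDerivAt_dz hI ht ρ z).const_mul ρ)).deriv
  have hkg_z : ∀ ρ > 0, ∀ z, dz k t ρ z
      = dz (dz (dz g)) t ρ z + 8 * dz h t ρ z + ρ * dρ (dz h) t ρ z := by
    intro ρ hρ z
    rw [dz_congr (g := fun t ρ z => dz (dz g) t ρ z + 8 * h t ρ z + ρ * dρ h t ρ z)
        (fun z => hkg ρ hρ z), hh.dρ_dz hI ht]
    exact ((((sz (sz hg)).hasDerivAt_dz hI ht ρ z).add
      ((hh.hasDerivAt_dz hI ht ρ z).const_mul 8)).add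
      (((sρ hh).hasDerivAt_dz hI ht ρ z).const_mul ρ)).deriv
  -- second derivatives of `w`
  obtain ⟨w1, w2, w3, w4⟩ := SqBdd.second_derivatives one5 hI hw hk hwk ht hy
    (by rw [six]; exact hyw) bwy bwρ.sqSub
  -- second derivatives of `v`, limited growth only
  have sw : SqSub 5 t w := SqSub.of_gradients hI hv hg hvg ht hw (by rw [six]; exact hwv) bvρ bvz
    bwρ.sqSub bwz.sqSub
  obtain ⟨v1, v2, v3⟩ := SqSub.second_derivatives one5 hI hv hg hvg ht hw (by rw [six]; exact hwv)
    sw bvρ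
  have cρz : ∀ {f : Field}, IsSmooth I f → ∀ ρ z, dρ (dz f) t ρ z = dz (dρ f) t ρ z :=
    fun hf => hf.dρ_dz hI ht
  -- second derivatives of `∂z v` and of `∂z² v`
  have hvg1 := dρ_dz_eq hI hv hg hvg
  have hvg2 := dρ_dz_eq hI (sz hv) (sz hg) hvg1
  obtain ⟨a1, a2, a3, a4⟩ := SqBdd.second_derivatives one5 hI (sz hv) (sz hg) hvg1 ht (sz hw)
    (by rw [six]; exact hwv_z) bwz (v1.congr fun ρ _ z => by rw [cρz hv])
  obtain ⟨b1, b2, b3, b4⟩ := SqBdd.second_derivatives one5 hI (sz (sz hv)) (sz (sz hg)) hvg2 ht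
    (sz (sz hw)) (by rw [six]; exact hwv_zz) w1 (a2.sqSub.congr fun ρ _ z => by rw [cρz (sz hv)])
  -- second derivatives of `g = ∂ρ v / ρ`, in nine space dimensions
  have sg : SqSub 7 t (dρ g) := by
    refine (SqSub.comb hI (sρ (sρ hv)) hg ht v2 v3 1).congr fun ρ _ z => ?_
    rw [dρ_dρ_eq hI hg hvg t ht]
    ring
  have bk : SqBdd 7 t k N := bwρ.congr fun ρ _ z => by rw [hwk t ht]; ring
  obtain ⟨g1, g2, g3, g4⟩ := SqBdd.second_derivatives one7 hI hg hh hgh ht hk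
    (by rw [eight]; exact hkg) bk sg
  have hgh1 := dρ_dz_eq hI hg hh hgh
  have bkz : SqBdd 7 t (dz k) (2 * N) := w2.congr fun ρ _ z => by
    rw [dz_dρ_eq hI hk hwk t ht]; ring
  obtain ⟨c1, c2, c3, c4⟩ := SqBdd.second_derivatives one7 hI (sz hg) (sz hh) hgh1 ht (sz hk)
    (by rw [eight]; exact hkg_z) bkz (g2.sqSub.congr fun ρ _ z => by rw [cρz hg])
  have bgρ : SqBdd 5 t (dρ g) (24 * N) := g4.congr fun ρ _ z => by rw [hgh t ht]; ring
  have bgρz : SqBdd 5 t (dz (dρ g)) (48 * N) := (c4.congr fun ρ _ z => by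
    rw [dz_dρ_eq hI hh hgh t ht]; ring).mono (by linarith)
  have bgρρ : SqBdd 5 t (dρ (dρ g)) (144 * N) := by
    refine (SqBdd.dρ_dρ (b := 7) hI hg hh hgh ht (hk.sub ((isSmooth_const 1).mul (sz (sz hg))))
      (by norm_num) (fun ρ hρ z => ?_) (SqBdd.comb hI hk (sz (sz hg)) ht w4 b4 1)
      bgρ.sqSub).mono (by linarith)
    rw [hkg ρ hρ z, dρ_dρ_eq hI hh hgh t ht]
    ring
  -- the pure derivatives in `ρ` from the equation
  have hvρρ : ∀ ρ > 0, ∀ z, dρ (dρ v) t ρ z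
      = w t ρ z - 1 * dz (dz v) t ρ z - 5 * g t ρ z := fun ρ hρ z => by
    rw [hwv ρ hρ z, dρ_dρ_eq hI hg hvg t ht]; ring
  have hvρρρ : ∀ ρ > 0, ∀ z, dρ (dρ (dρ v)) t ρ z
      = dρ w t ρ z - 1 * dρ (dz (dz v)) t ρ z - 5 * dρ g t ρ z := fun ρ hρ z => by
    rw [dρ_congr_pos (g := fun t ρ z => w t ρ z - 1 * dz (dz v) t ρ z - 5 * g t ρ z)
      (fun ρ hρ => hvρρ ρ hρ z) hρ]
    exact (((hw.hasDerivAt_dρ hI ht ρ z).sub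
      (((sz (sz hv)).hasDerivAt_dρ hI ht ρ z).const_mul 1)).sub
      ((hg.hasDerivAt_dρ hI ht ρ z).const_mul 5)).deriv
  have hvρρρρ : ∀ ρ > 0, ∀ z, dρ (dρ (dρ (dρ v))) t ρ z
      = dρ (dρ w) t ρ z - 1 * dρ (dρ (dz (dz v))) t ρ z - 5 * dρ (dρ g) t ρ z := fun ρ hρ z => by
    rw [dρ_congr_pos (g := fun t ρ z => dρ w t ρ z - 1 * dρ (dz (dz v)) t ρ z - 5 * dρ g t ρ z)
      (fun ρ hρ => hvρρρ ρ hρ z) hρ]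
    exact ((((sρ hw).hasDerivAt_dρ hI ht ρ z)).sub
      (((sρ (sz (sz hv))).hasDerivAt_dρ hI ht ρ z).const_mul 1) |>.sub
      (((sρ hg).hasDerivAt_dρ hI ht ρ z).const_mul 5)).deriv
  have hvρρρz : ∀ ρ > 0, ∀ z, dz (dρ (dρ (dρ v))) t ρ z
      = dz (dρ w) t ρ z - 1 * dz (dρ (dz (dz v))) t ρ z - 5 * dz (dρ g) t ρ z := fun ρ hρ z => by
    rw [dz_congr (g := fun t ρ z => dρ w t ρ z - 1 * dρ (dz (dz v)) t ρ z - 5 * dρ g t ρ z)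
      (fun z => hvρρρ ρ hρ z)]
    exact ((((sρ hw).hasDerivAt_dz hI ht ρ z)).sub
      (((sρ (sz (sz hv))).hasDerivAt_dz hI ht ρ z).const_mul 1) |>.sub
      (((sρ hg).hasDerivAt_dz hI ht ρ z).const_mul 5)).deriv
  have a2' : SqBdd 5 t (dρ (dz (dz v))) (2 * N) := a2.of_eq fun ρ _ z => cρz (sz hv) ρ z
  -- commuting `∂z` to the outside
  have comm2 : ∀ m ρ z, dρ^[m] (dz (dz v)) t ρ z = dz (dz (dρ^[m] v)) t ρ z := fun m ρ z => by
    rw [(sz hv).iterate_dρ_dz hI ht]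
    exact dz_congr fun z => hv.iterate_dρ_dz hI ht m ρ z
  have s1 : ∀ {f : Field}, IsSmooth I f → IsSmooth I fun t ρ z => 1 * f t ρ z :=
    fun hf => (isSmooth_const 1).mul hf
  constructor
  · intro m n hmn
    obtain ⟨rfl, rfl⟩ | ⟨rfl, rfl⟩ | ⟨rfl, rfl⟩ | ⟨rfl, rfl⟩ : (m = 0 ∧ n = 3) ∨ (m = 1 ∧ n = 2) ∨
      (m = 2 ∧ n = 1) ∨ (m = 3 ∧ n = 0) := by omega
    · exact a1.mono (by linarith)
    · exact (a2.of_eq fun ρ _ z => by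
        rw [dz_congr (g := dz (dρ v)) (cρz hv ρ)]
        rfl).mono (by linarith)
    · exact (a3.of_eq fun ρ _ z => (hv.iterate_dρ_dz hI ht 2 ρ z).symm).mono (by linarith)
    · exact ((SqBdd.comb hI (hw.dρ hI |>.sub (s1 (sρ (sz (sz hv))))) (sρ hg) ht
        (SqBdd.comb hI (sρ hw) (sρ (sz (sz hv))) ht bwρ a2' 1) bgρ 5).of_eq hvρρρ).mono
        (by linarith)
  · intro m n hmn
    obtain ⟨rfl, rfl⟩ | ⟨rfl, rfl⟩ | ⟨rfl, rfl⟩ | ⟨rfl, rfl⟩ | ⟨rfl, rfl⟩ : (m = 0 ∧ n = 4) ∨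
      (m = 1 ∧ n = 3) ∨ (m = 2 ∧ n = 2) ∨ (m = 3 ∧ n = 1) ∨ (m = 4 ∧ n = 0) := by omega
    · exact b1.mono (by linarith)
    · exact (b2.of_eq fun ρ _ z => (dz_congr fun z => comm2 1 ρ z).symm).mono (by linarith)
    · exact (b3.of_eq fun ρ _ z => (comm2 2 ρ z).symm).mono (by linarith)
    · exact ((SqBdd.comb hI ((sz (sρ hw)).sub (s1 (sz (sρ (sz (sz hv)))))) (sz (sρ hg)) ht
        (SqBdd.comb hI (sz (sρ hw)) (sz (sρ (sz (sz hv)))) ht w2 b2 1) bgρz 5).of_eq hvρρρz).mono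
        (by linarith)
    · exact ((SqBdd.comb hI ((sρ (sρ hw)).sub (s1 (sρ (sρ (sz (sz hv)))))) (sρ (sρ hg)) ht
        (SqBdd.comb hI (sρ (sρ hw)) (sρ (sρ (sz (sz hv)))) ht w3 b3 1) bgρρ 5).of_eq hvρρρρ).mono
        (by linarith)

end LinGrav

namespace LinGrav

variable {I : Set ℝ} {f g : Field} {t ρ z L : ℝ}

/-! ### From the energies to the pointwise bounds -/

/-- A density dominating `ρ ^ a f²` whose integral over the half plane is at most `N`. -/
theorem sqBdd_of_halfPlaneIntegral (hI : IsOpen I) {e : Field} (he : IsSmooth I e)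
    (hf : IsSmooth I f) (ht : t ∈ I) {a : ℕ} {N : ℝ} (hN : 0 ≤ N)
    (h : ∀ ρ > 0, ∀ z, ρ ^ a * f t ρ z ^ 2 ≤ e t ρ z)
    (hle : halfPlaneIntegral e t ≤ ENNReal.ofReal N) : SqBdd a t f N := fun L _ => by
  have hpos : ∀ ρ > 0, ∀ z, 0 ≤ e t ρ z := fun ρ hρ z => le_trans (by positivity) (h ρ hρ z)
  have h1 := (ofReal_boxInt_le hI he ht hpos L).trans hle
  rw [ENNReal.ofReal_le_ofReal_iff hN] at h1
  exact (boxInt_mono hI (isSmooth_sq_weight a hf) he ht fun x hx => h x.1 hx.1.1 x.2).trans h1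

/-- The decay rates `o(r ^ (-a/2))` at a fixed time, for a field and its gradient. -/
theorem decay_of_littleO1 {k : ℝ} (h : LittleO1 I k f) (ht : t ∈ I)
    (hfg : ∀ ρ > 0, ∀ z, g t ρ z = f t ρ z) :
    ∀ ε > 0, ∃ R ≥ 1, ∀ ρ > 0, ∀ z, R ≤ √(ρ ^ 2 + z ^ 2) →
      |g t ρ z| ≤ ε * √(ρ ^ 2 + z ^ 2) ^ k ∧ |dρ g t ρ z| ≤ ε * √(ρ ^ 2 + z ^ 2) ^ k ∧
        |dz g t ρ z| ≤ ε * √(ρ ^ 2 + z ^ 2) ^ k := by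
  intro ε hε
  obtain ⟨R, hR⟩ := h {t} (singleton_subset_iff.2 ht) isCompact_singleton ε hε
  refine ⟨max R 1, le_max_right _ _, fun ρ hρ z hr => ?_⟩
  obtain ⟨h1, h2, h3⟩ := hR t rfl ρ hρ z ((le_max_left _ _).trans hr)
  have hr1 : 1 ≤ √(ρ ^ 2 + z ^ 2) := (le_max_right _ _).trans hr
  have hle : ε * √(ρ ^ 2 + z ^ 2) ^ (k - 1) ≤ ε * √(ρ ^ 2 + z ^ 2) ^ k :=
    mul_le_mul_of_nonneg_left (Real.rpow_le_rpow_of_exponent_le hr1 (by linarith)) hε.le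
  rw [hfg ρ hρ, dρ_congr_pos (fun ρ hρ => hfg ρ hρ z) hρ, dz_congr (hfg ρ hρ)]
  exact ⟨h1, h2.trans hle, h3.trans hle⟩

theorem tendsto_zero_of_decay {k : ℝ} (hk : k ≤ 0)
    (h : ∀ ε > 0, ∃ R ≥ 1, ∀ ρ > 0, ∀ z, R ≤ √(ρ ^ 2 + z ^ 2) →
      |f t ρ z| ≤ ε * √(ρ ^ 2 + z ^ 2) ^ k) :
    ∀ ε > 0, ∃ R : ℝ, ∀ ρ > 0, ∀ z, R ≤ √(ρ ^ 2 + z ^ 2) → |f t ρ z| ≤ ε := by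
  intro ε hε
  obtain ⟨R, hR1, hR⟩ := h ε hε
  exact ⟨R, fun ρ hρ z hr => (hR ρ hρ z hr).trans
    (mul_le_of_le_one_right hε.le (Real.rpow_le_one_of_one_le_of_nonpos (hR1.trans hr) hk))⟩

theorem sqSub_of_rpow (a : ℕ) (hI : IsOpen I) (hf : IsSmooth I f) (ht : t ∈ I)
    (h : ∀ ε > 0, ∃ R ≥ 1, ∀ ρ > 0, ∀ z, R ≤ √(ρ ^ 2 + z ^ 2) →
      |f t ρ z| ≤ ε * √(ρ ^ 2 + z ^ 2) ^ (-a / 2 : ℝ)) : SqSub a t f := by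
  refine sqSub_of_decay a hI hf ht fun ε hε => ?_
  obtain ⟨R, hR1, hR⟩ := h (√ε) (Real.sqrt_pos.2 hε)
  refine ⟨R, fun ρ hρ z hr => ?_⟩
  set r := √(ρ ^ 2 + z ^ 2)
  have hr0 : 0 < r := one_pos.trans_le (hR1.trans hr)
  have hρr : ρ ≤ r := Real.le_sqrt_of_sq_le (by nlinarith [sq_nonneg z])
  have h1 := pow_le_pow_left₀ (abs_nonneg _) (hR ρ hρ z hr) 2
  rw [sq_abs, mul_pow, Real.sq_sqrt hε.le] at h1
  have h2 : r ^ a * (r ^ (-a / 2 : ℝ)) ^ 2 = 1 := by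
    rw [← Real.rpow_natCast r a, ← Real.rpow_natCast _ 2, ← Real.rpow_mul hr0.le,
      ← Real.rpow_add hr0]
    convert Real.rpow_zero r using 2
    push_cast
    ring
  calc ρ ^ a * f t ρ z ^ 2 ≤ r ^ a * (ε * (r ^ (-a / 2 : ℝ)) ^ 2) :=
        mul_le_mul (pow_le_pow_left₀ hρ.le hρr a) h1 (sq_nonneg _) (by positivity)
    _ = ε * (r ^ a * (r ^ (-a / 2 : ℝ)) ^ 2) := by ring
    _ = ε := by rw [h2, mul_one]

/-- A pointwise bound for every real upper bound of `m` passes to `m ∈ [0, ∞]`. -/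
theorem ofReal_le_of_forall_real {x C : ℝ} {m : ℝ≥0∞}
    (h : ∀ N > 0, m ≤ ENNReal.ofReal N → C * x ≤ N) : ENNReal.ofReal (C * x) ≤ m := by
  refine ENNReal.le_of_forall_pos_le_add fun ε hε hm => ?_
  have e : m + ε = ENNReal.ofReal (m.toReal + ε) := by
    rw [ENNReal.ofReal_add ENNReal.toReal_nonneg ε.coe_nonneg, ENNReal.ofReal_toReal hm.ne,
      ENNReal.ofReal_coe_nnreal]
  rw [e]
  have h0 : 0 < m.toReal + ε := add_pos_of_nonneg_of_pos ENNReal.toReal_nonneg hε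
  exact ENNReal.ofReal_le_ofReal (h _ h0 (by rw [← e]; exact le_self_add))

namespace Perturbation

variable {P : Perturbation}

/-- The energy bounds `∂σ` in `L²`, and the energy of the time derivative bounds `∂ₜp`, that is the
three-dimensional Laplacian of `σ`; so all second derivatives of `σ` are bounded in `L²`. -/
theorem IsSolution.sq_σ_le (hI : IsOpen I) (hP : P.IsSolution I) (hA : P.AxisRegular I)
    (h0 : P.FallsOff I 0) (ht : t ∈ I) (hρ : 0 ≤ ρ) (z : ℝ) :
    ENNReal.ofReal (1 / 10 ^ 11 * |P.σ t ρ z| ^ 2) ≤ P.massσ 0 t + P.massσ 1 t := by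
  refine ofReal_le_of_forall_real fun N hN hle => ?_
  have hs := hP.smooth_σ
  obtain ⟨B, hBs, hB⟩ := hP.smooth_βρ.exists_eq_rho_mul hI (fun t ht z => hA.odd_βρ.axis ht z)
  have hP1 := hP.tderiv hI
  have hB1 : ∀ t ∈ I, ∀ ρ z, P.tderiv.βρ t ρ z = ρ * dt B t ρ z := fun t ht ρ z =>
    (dt_congr (g := fun t ρ z => ρ * B t ρ z) hI (fun t ht => hB t ht ρ z) ht).trans
      ((hBs.hasDerivAt_dt hI ht ρ z).const_mul ρ).deriv
  have m0 : halfPlaneIntegral (P.σDensity B) t ≤ ENNReal.ofReal N := by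
    rw [← hP.massσ_zero_eq hB ht]; exact le_self_add.trans hle
  have m1 : halfPlaneIntegral (P.tderiv.σDensity (dt B)) t ≤ ENNReal.ofReal N := by
    rw [← hP1.massσ_zero_eq hB1 ht]
    have := hP.massσ_add hI 1 0 ht
    exact (this.symm.trans_le le_add_self).trans hle
  obtain ⟨g, hg, -, hfg⟩ := hs.exists_dρ_eq hI hA.even_σ
  -- `∂ₜp`, which is the three-dimensional Laplacian of `σ`
  have hl : IsSmooth I (fun t ρ z => dt (dt P.σ) t ρ z - 2 * dt B t ρ z) :=
    ((hs.dt hI).dt hI).sub ((isSmooth_const 2).mul (hBs.dt hI))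
  have hleq : ∀ ρ > 0, ∀ z, dt (dt P.σ) t ρ z - 2 * dt B t ρ z
      = dz (dz P.σ) t ρ z + ((1 : ℕ) + 1) * g t ρ z + ρ * dρ g t ρ z := by
    intro ρ hρ z
    have h1 := hP.evol_σ t ht ρ hρ z
    have h2 : dt P.p t ρ z = dt (dt P.σ) t ρ z - 2 * dt B t ρ z := by
      rw [dt_congr (g := fun t ρ z => dt P.σ t ρ z - 2 * B t ρ z) hI
        (fun t ht => p_eq hB ht hρ z) ht]
      exact (((hs.dt hI).hasDerivAt_dt hI ht ρ z).sub
        ((hBs.hasDerivAt_dt hI ht ρ z).const_mul 2)).deriv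
    rw [← h2]
    rw [lap3, lap, hfg t ht, dρ_dρ_eq hI hg hfg t ht] at h1
    field_simp at h1
    push_cast
    linarith
  have key : ∀ {f : Field}, IsSmooth I f →
      (∀ ρ > 0, ∀ z, ρ ^ 1 * f t ρ z ^ 2 ≤ P.σDensity B t ρ z) → SqBdd 1 t f N := fun hf h =>
    sqBdd_of_halfPlaneIntegral hI (hP.smooth_σDensity hI hBs) hf ht hN.le h m0
  have bρ : SqBdd 1 t (dρ P.σ) N := key (hs.dρ hI) fun ρ hρ z => by
    unfold σDensity gradSq
    rw [pow_one, mul_comm]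
    refine mul_le_mul_of_nonneg_right ?_ (le_of_lt hρ)
    have : 0 ≤ 2 * (dt P.σ t ρ z - 2 * B t ρ z) ^ 2 + dρ P.σ t ρ z ^ 2 + 2 * dz P.σ t ρ z ^ 2
      + 8 * (P.shearρρ t ρ z ^ 2 + P.shearρz t ρ z ^ 2) := by positivity
    linarith
  have bz : SqBdd 1 t (dz P.σ) N := key (hs.dz hI) fun ρ hρ z => by
    unfold σDensity gradSq
    rw [pow_one, mul_comm]
    refine mul_le_mul_of_nonneg_right ?_ (le_of_lt hρ)
    have : 0 ≤ 2 * (dt P.σ t ρ z - 2 * B t ρ z) ^ 2 + 2 * dρ P.σ t ρ z ^ 2 + dz P.σ t ρ z ^ 2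
      + 8 * (P.shearρρ t ρ z ^ 2 + P.shearρz t ρ z ^ 2) := by positivity
    linarith
  have bl : SqBdd 1 t (fun t ρ z => dt (dt P.σ) t ρ z - 2 * dt B t ρ z) N := by
    refine sqBdd_of_halfPlaneIntegral hI (hP1.smooth_σDensity hI (hBs.dt hI)) hl ht hN.le
      (fun ρ hρ z => ?_) m1
    unfold σDensity gradSq
    rw [pow_one, mul_comm]
    refine mul_le_mul_of_nonneg_right ?_ (le_of_lt hρ)
    have : 0 ≤ (dt P.tderiv.σ t ρ z - 2 * dt B t ρ z) ^ 2
      + 2 * (dρ P.tderiv.σ t ρ z ^ 2 + dz P.tderiv.σ t ρ z ^ 2)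
      + 8 * (P.tderiv.shearρρ t ρ z ^ 2 + P.tderiv.shearρz t ρ z ^ 2) := by positivity
    have e : P.tderiv.σ = dt P.σ := rfl
    rw [e] at this ⊢
    linarith
  obtain ⟨d1, d2, d3, -⟩ := SqBdd.second_derivatives le_rfl hI hs hg hfg ht hl hleq bl bρ.sqSub
  have hb := abs_le_of_first_second hI hs ht hρ z (by positivity : 0 < 6 * N)
    (fun m n hmn => by
      obtain ⟨rfl, rfl⟩ | ⟨rfl, rfl⟩ : (m = 0 ∧ n = 1) ∨ (m = 1 ∧ n = 0) := by omega
      · exact bz.mono (by linarith)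
      · exact bρ.mono (by linarith))
    (fun m n hmn => by
      obtain ⟨rfl, rfl⟩ | ⟨rfl, rfl⟩ | ⟨rfl, rfl⟩ : (m = 0 ∧ n = 2) ∨ (m = 1 ∧ n = 1) ∨
        (m = 2 ∧ n = 0) := by omega
      · exact d1.mono (by linarith)
      · exact d2.mono (by linarith)
      · exact d3)
    (tendsto_zero_of_decay (k := -1 / 2) (by norm_num) fun ε hε => by
      obtain ⟨R, hR1, hR⟩ := decay_of_littleO1 h0.σ ht (g := P.σ) (fun ρ _ z => rfl) ε hε
      exact ⟨R, hR1, fun ρ hρ z hr => (hR ρ hρ z hr).1⟩)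
  have h2 := pow_le_pow_left₀ (abs_nonneg _) hb 2
  rw [mul_pow, Real.sq_sqrt (by positivity)] at h2
  linarith

/-- All time derivatives of `ω / ρ⁴` satisfy the wave equation in seven space dimensions. -/
theorem IsSolution.iterate_twist_wave {v : Field} (hI : IsOpen I) (hP : P.IsSolution I)
    (hv : IsSmooth I v) (h : ∀ t ∈ I, ∀ ρ z, P.ω t ρ z = ρ ^ 4 * v t ρ z) (n : ℕ) (ht : t ∈ I)
    (hρ : 0 < ρ) (z : ℝ) : dt (dt (dt^[n] v)) t ρ z = dρ (dρ (dt^[n] v)) t ρ z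
      + dz (dz (dt^[n] v)) t ρ z + 5 * dρ (dt^[n] v) t ρ z / ρ := by
  have hw := (hP.iterate_tderiv hI n).evol_ω
  rw [iterate_tderiv_eq] at hw
  exact twist_wave hI (hv.iterate_dt hI n) (iterate_dt_twist hI hv h n) hw ht hρ z

/-- With `w = ∂ₜ²v` the seven-dimensional Laplacian of `v`, the energy of `∂ₜ²ω` bounds `∂w` in `L²`,
and the energy of `∂ₜ³ω` bounds `∂ₜ⁴v`, the Laplacian of `w`; so all third and fourth derivatives of
`v` are bounded in `L²`. -/
theorem IsSolution.sq_twist_le {v : Field} (hI : IsOpen I) (hP : P.IsSolution I)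
    (hT : P.TwistConditions I) (hv : IsSmooth I v) (hve : IsEven I v)
    (h : ∀ t ∈ I, ∀ ρ z, P.ω t ρ z = ρ ^ 4 * v t ρ z) (ht : t ∈ I) (hρ : 0 ≤ ρ) (z : ℝ) :
    ENNReal.ofReal (1 / 10 ^ 11 * v t ρ z ^ 2) ≤ P.massω 2 t + P.massω 3 t := by
  refine ofReal_le_of_forall_real fun N hN hle => ?_
  have hn := hv.iterate_dt hI
  have mass : ∀ n, P.massω n t ≤ ENNReal.ofReal N →
      halfPlaneIntegral (barDensity (dt^[n] v)) t ≤ ENNReal.ofReal N := fun n hm => by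
    refine (barIntegral_le_twistIntegral hI (hn n) ht).trans ?_
    rw [← massω_eq_twist hI (hn n) (iterate_dt_twist hI hv h n) ht]
    exact hm
  have m2 := mass 2 (le_self_add.trans hle)
  have m3 := mass 3 (le_add_self.trans hle)
  set w := dt^[2] v with hw
  have hws : IsSmooth I w := hn 2
  have hwe : IsEven I w := (hve.dt hI).dt hI
  obtain ⟨g, hg, hge, hvg⟩ := hv.exists_dρ_eq hI hve
  obtain ⟨k, hk, -, hwk⟩ := hws.exists_dρ_eq hI hwe
  have wave : ∀ n, ∀ t ∈ I, ∀ ρ > 0, ∀ z, dt^[n + 2] v t ρ z = dρ (dρ (dt^[n] v)) t ρ z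
      + dz (dz (dt^[n] v)) t ρ z + 5 * dρ (dt^[n] v) t ρ z / ρ := fun n t ht ρ hρ z => by
    rw [Function.iterate_succ_apply', Function.iterate_succ_apply']
    exact hP.iterate_twist_wave hI hv h n ht hρ z
  have hwv : ∀ ρ > 0, ∀ z, w t ρ z = dz (dz v) t ρ z + 6 * g t ρ z + ρ * dρ g t ρ z := by
    intro ρ hρ z
    refine (wave 0 t ht ρ hρ z).trans ?_
    simp only [Function.iterate_zero, id]
    rw [hvg t ht, dρ_dρ_eq hI hg hvg t ht]
    field_simp
    ring
  have hyw : ∀ ρ > 0, ∀ z, dt^[4] v t ρ z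
      = dz (dz w) t ρ z + 6 * k t ρ z + ρ * dρ k t ρ z := by
    intro ρ hρ z
    refine (wave 2 t ht ρ hρ z).trans ?_
    rw [← hw, hwk t ht, dρ_dρ_eq hI hk hwk t ht]
    field_simp
    ring
  have bwρ : SqBdd 5 t (dρ w) N :=
    sqBdd_of_halfPlaneIntegral hI (isSmooth_barDensity hI hws) (hws.dρ hI) ht hN.le
      (fun ρ hρ z => by
        unfold barDensity gradSq
        rw [mul_comm]
        refine mul_le_mul_of_nonneg_right ?_ (by positivity)
        nlinarith [sq_nonneg (dt w t ρ z), sq_nonneg (dρ w t ρ z), sq_nonneg (dz w t ρ z)]) m2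
  have bwz : SqBdd 5 t (dz w) N :=
    sqBdd_of_halfPlaneIntegral hI (isSmooth_barDensity hI hws) (hws.dz hI) ht hN.le
      (fun ρ hρ z => by
        unfold barDensity gradSq
        rw [mul_comm]
        refine mul_le_mul_of_nonneg_right ?_ (by positivity)
        nlinarith [sq_nonneg (dt w t ρ z), sq_nonneg (dρ w t ρ z), sq_nonneg (dz w t ρ z)]) m2
  have bwy : SqBdd 5 t (dt^[4] v) N :=
    sqBdd_of_halfPlaneIntegral hI (isSmooth_barDensity hI (hn 3)) (hn 4) ht hN.le
      (fun ρ hρ z => by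
        have e : dt^[4] v = dt (dt^[3] v) := Function.iterate_succ_apply' dt 3 v
        unfold barDensity gradSq
        rw [mul_comm, e]
        refine mul_le_mul_of_nonneg_right ?_ (by positivity)
        nlinarith [sq_nonneg (dt (dt^[3] v) t ρ z), sq_nonneg (dρ (dt^[3] v) t ρ z),
          sq_nonneg (dz (dt^[3] v) t ρ z)]) m3
  have hdecay := decay_of_littleO1 hT.infinity ht (g := v) (fun ρ hρ z => by
    rw [ωbar, h t ht]
    field_simp)
  have dec0 : ∀ ε > 0, ∃ R ≥ 1, ∀ ρ > 0, ∀ z, R ≤ √(ρ ^ 2 + z ^ 2) →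
      |v t ρ z| ≤ ε * √(ρ ^ 2 + z ^ 2) ^ (-5 / 2 : ℝ) := fun ε hε => by
    obtain ⟨R, hR1, hR⟩ := hdecay ε hε
    exact ⟨R, hR1, fun ρ hρ z hr => (hR ρ hρ z hr).1⟩
  have decρ : ∀ ε > 0, ∃ R ≥ 1, ∀ ρ > 0, ∀ z, R ≤ √(ρ ^ 2 + z ^ 2) →
      |dρ v t ρ z| ≤ ε * √(ρ ^ 2 + z ^ 2) ^ (-5 / 2 : ℝ) := fun ε hε => by
    obtain ⟨R, hR1, hR⟩ := hdecay ε hε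
    exact ⟨R, hR1, fun ρ hρ z hr => (hR ρ hρ z hr).2.1⟩
  have decz : ∀ ε > 0, ∃ R ≥ 1, ∀ ρ > 0, ∀ z, R ≤ √(ρ ^ 2 + z ^ 2) →
      |dz v t ρ z| ≤ ε * √(ρ ^ 2 + z ^ 2) ^ (-5 / 2 : ℝ) := fun ε hε => by
    obtain ⟨R, hR1, hR⟩ := hdecay ε hε
    exact ⟨R, hR1, fun ρ hρ z hr => (hR ρ hρ z hr).2.2⟩
  have e5 : (-((5 : ℕ) : ℝ) / 2) = -5 / 2 := by norm_num
  obtain ⟨t3, t4⟩ := third_fourth_derivatives hI hv hws (hn 4) hg hge hk hvg hwk ht hwv hyw bwρ bwz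
    bwy (sqSub_of_rpow 5 hI (hv.dρ hI) ht (by rw [e5]; exact decρ))
    (sqSub_of_rpow 5 hI (hv.dz hI) ht (by rw [e5]; exact decz)) hN.le
  have hk0 : (-5 / 2 : ℝ) ≤ 0 := by norm_num
  have hb := abs_le_of_third_fourth hI hv ht hρ z (by positivity) t3 t4
    (tendsto_zero_of_decay hk0 dec0) (tendsto_zero_of_decay hk0 decρ)
    (tendsto_zero_of_decay hk0 decz)
  have h2 := pow_le_pow_left₀ (abs_nonneg _) hb 2
  rw [mul_pow, Real.sq_sqrt (by positivity), sq_abs] at h2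
  linarith

end Perturbation

end LinGrav

open LinGrav

theorem theorem1 :
    ∃ C : ℝ, 0 < C ∧
      ∀ (I : Set ℝ) (P : LinGrav.Perturbation), IsOpen I → I.OrdConnected →
        P.IsSolution I → P.AxisRegular I →
        P.FallsOff I 0 → P.FallsOff I 1 → P.TwistConditions I →
        -- (i) conservation of the masses
        ((∀ s ∈ I, ∀ t ∈ I, P.massσ 0 s = P.massσ 0 t) ∧
          (∀ s ∈ I, ∀ t ∈ I, P.massω 0 s = P.massω 0 t) ∧
          (∀ s ∈ I, ∀ t ∈ I, P.massωbar 0 s = P.massωbar 0 t) ∧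
          (∀ t ∈ I, P.massω 0 t = P.massωbar 0 t) ∧
          -- the higher order masses
          (∀ n : ℕ, (∀ k : ℕ, 2 ≤ k → k ≤ n → P.FallsOff I k) →
            ∀ s ∈ I, ∀ t ∈ I, P.massσ n s = P.massσ n t) ∧
          (∀ n : ℕ, ∀ s ∈ I, ∀ t ∈ I, P.massω n s = P.massω n t) ∧
          (∀ n : ℕ, ∀ s ∈ I, ∀ t ∈ I, P.massωbar n s = P.massωbar n t)) ∧
        -- (ii) pointwise bounds, with the masses taken at an arbitrary time `s`
        (∀ s ∈ I, ∀ t ∈ I, ∀ ρ z : ℝ, 0 ≤ ρ →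
          ENNReal.ofReal (C * |P.σ t ρ z| ^ 2) ≤ P.massσ 0 s + P.massσ 1 s) ∧
        (∀ s ∈ I, ∀ t ∈ I, ∀ ρ z : ℝ, 0 < ρ →
          ENNReal.ofReal (C * (|P.ω t ρ z| / ρ ^ 4) ^ 2) ≤ P.massω 2 s + P.massω 3 s) := by
  -- the two bounds hold with constants `1 / (6 * 72 ^ 2)` and `1 / (8000 * 1296 ^ 2)`
  refine ⟨1 / 10 ^ 11, by positivity, fun I P hI hc hP hA h0 h1 hT => ?_⟩
  obtain ⟨v, hv, hve, h⟩ := exists_smooth_twist hI hP hA hT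
  have hn := hv.iterate_dt hI
  have hωn := iterate_dt_twist hI hv h
  have hbar : ∀ n, ∀ t ∈ I, ∀ ρ > 0, ∀ z, dt^[n] P.ωbar t ρ z = dt^[n] v t ρ z :=
    fun n t ht ρ hρ z => iterate_dt_congr hI (fun t ht => by
      rw [Perturbation.ωbar, h t ht]; field_simp) n ht
  have hwave := fun n => fun t (ht : t ∈ I) ρ (hρ : 0 < ρ) z =>
    hP.iterate_twist_wave hI hv h n ht hρ z
  have eω : ∀ n, ∀ t ∈ I, P.massω n t = halfPlaneIntegral (twistDensity (dt^[n] v)) t :=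
    fun n t ht => massω_eq_twist hI (hn n) (hωn n) ht
  have eb : ∀ n, ∀ t ∈ I, P.massωbar n t = halfPlaneIntegral (barDensity (dt^[n] v)) t :=
    fun n t ht => massωbar_eq hI (hbar n) ht
  have cω : ∀ n : ℕ, ∀ s ∈ I, ∀ t ∈ I, P.massω n s = P.massω n t := fun n s hs t ht => by
    rw [eω n s hs, eω n t ht]
    exact twistDensity_conserved hI hc (hn n) (hwave n) s hs t ht
  have cb : ∀ n : ℕ, ∀ s ∈ I, ∀ t ∈ I, P.massωbar n s = P.massωbar n t := fun n s hs t ht => by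
    rw [eb n s hs, eb n t ht]
    exact barDensity_conserved hI hc (hn n) (hwave n) s hs t ht
  have c0 := hP.massσ_zero_conserved hI hc hA h0 h1
  have c1 := hP.massσ_one_conserved hI hc hA h0 h1
  refine ⟨⟨c0, cω 0, cb 0, fun t ht => ?_, fun n hk s hs t ht => ?_, cω, cb⟩,
    fun s hs t ht ρ z hρ => ?_, fun s hs t ht ρ z hρ => ?_⟩
  · rw [eω 0 t ht, eb 0 t ht]
    refine twistIntegral_eq_barIntegral hI hv ht fun ε hε => ?_
    obtain ⟨R, hR⟩ := hT.infinity {t} (singleton_subset_iff.2 ht) isCompact_singleton ε hε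
    exact ⟨R, fun ρ hρ z hr => by
      rw [← hbar 0 t ht ρ hρ z]
      exact (hR t rfl ρ hρ z hr).1⟩
  · -- the `n`-th energy of the solution is the first energy of its `(n - 1)`-st time derivative
    rcases n with _ | n
    · exact c0 s hs t ht
    have hf : ∀ k ≤ n + 1, P.FallsOff I k := fun k hkn => by
      rcases k with _ | _ | k
      exacts [h0, h1, hk _ (by omega) hkn]
    rw [add_comm n 1, hP.massσ_add hI n 1 hs, hP.massσ_add hI n 1 ht]
    exact (hP.iterate_tderiv hI n).massσ_one_conserved hI hc (hA.iterate_tderiv hI n)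
      (Perturbation.FallsOff.iterate_tderiv (hf (0 + n) (by omega)))
      (Perturbation.FallsOff.iterate_tderiv (hf (1 + n) (by omega))) s hs t ht
  · rw [c0 s hs t ht, c1 s hs t ht]
    exact hP.sq_σ_le hI hA h0 ht hρ z
  · rw [cω 2 s hs t ht, cω 3 s hs t ht]
    have e : (|P.ω t ρ z| / ρ ^ 4) ^ 2 = v t ρ z ^ 2 := by
      rw [h t ht, abs_mul, abs_of_pos (by positivity : 0 < ρ ^ 4), mul_div_cancel_left₀ _
        (by positivity), sq_abs]
    rw [e]
    exact hP.sq_twist_le hI hT hv hve h ht hρ.le z
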